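/- Let $q\ge 2$ be an integer and let $\mathrm{BS}(1,q)=\langle a,t\mid tat^{-1}=a^q\rangle$, identified with the semidirect product $\mathbb{Z}[\tfrac1q]\rtimes\mathbb{Z}$, i.e. the set of pairs $(r,m)$ with $r\in\mathbb{Z}[\tfrac1q]=\{nq^i\mid n,i\in\mathbb{Z}\}$ and $m\in\mathbb{Z}$, with multiplication $(r,m)(r',m')=(r+q^m r',\,m+m')$, where $a=(1,0)$ and $t=(0,1)$. A subset $R$ of a monoid $M$ is *rational* if there is an automaton over $M$ (finitely many states, finitely many edges labelled by elements of $M$, one initial and one final state) such that $R$ is the set of all products of edge labels along runs from the initial to the final state. The *pointed expansion* $\mathsf{pe}(v)$ of $v=(r,m)\in\mathrm{BS}(1,q)$ is the word $$\pm\, a_{k_1}\cdots a_1\,(a_0)_\bullet\, a_{-1}\cdots a_{-k_2},$$ where $a_i\in\{0,\dots,q-1\}$, $|r|=\sum_{i=-k_2}^{k_1}a_iq^i$, the first letter is $-$ if $r<0$ and $+$ otherwise, the digit $a_0$ carries the mark $\bullet$ (radix point), the digit $a_m$ carries the mark $\triangleleft$ (cursor), and $k_1,k_2\ge 0$ are the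 least integers with $-k_2\le m\le k_1$ for which such an expansion exists. It is a word over the finite alphabet consisting of $+$, $-$ and the digits $0,\dots,q-1$, each optionally decorated with $\bullet$, $\triangleleft$ or both. A subset $R\subseteq\mathrm{BS}(1,q)$ is *PE-regular* if the language $\{\mathsf{pe}(v)\mid v\in R\}$ is regular. Then every rational subset of $\mathrm{BS}(1,q)$ is PE-regular. Moreover, this is effective: there is a computable function that maps every automaton over $\mathrm{BS}(1,q)$ with edge labels in $\{a,a^{-1},t,t^{-1}\}$ (given as its finite list of edges, its initial and its final state), accepting $R\subseteq\mathrm{BS}(1,q)$, to a nondeterministic finite automaton that accepts the language $\{\mathsf{pe}(v)\mid v\in R\}$. -/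

import Mathlib

/-! ### The Baumslag–Solitar group `BS(1,q)` as `ℤ[1/q] ⋊ ℤ` -/

/-- The elements of `BS(1,q) = ⟨a, t ∣ t a t⁻¹ = a ^ q⟩`, identified with `ℤ[1/q] ⋊ ℤ`: pairs
`(r, m)` with `r ∈ ℤ[1/q] = {n * q ^ i ∣ n, i ∈ ℤ} ⊆ ℚ` and `m ∈ ℤ` (the cursor). -/
@[ext]
structure BS (q : ℕ) where
  r : ℚ
  m : ℤ
  r_mem : ∃ n i : ℤ, r = n * (q : ℚ) ^ i

namespace BS

variable {q : ℕ}

theorem natCast_ne_zero (q : ℕ) [q.AtLeastTwo] : (q : ℚ) ≠ 0 := by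
  have := Nat.AtLeastTwo.prop (n := q)
  exact_mod_cast (by omega : q ≠ 0)

theorem add_mem_aux [q.AtLeastTwo] {x y : ℚ} (hx : ∃ n i : ℤ, x = n * (q : ℚ) ^ i)
    (hy : ∃ n i : ℤ, y = n * (q : ℚ) ^ i) : ∃ n i : ℤ, x + y = n * (q : ℚ) ^ i := by
  obtain ⟨n, i, rfl⟩ := hx
  obtain ⟨k, j, rfl⟩ := hy
  have hq := natCast_ne_zero q
  have key : ∀ l : ℤ, min i j ≤ l →
      (q : ℚ) ^ l = (q : ℚ) ^ (l - min i j).toNat * (q : ℚ) ^ min i j := by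
    intro l hl
    rw [← zpow_natCast, ← zpow_add₀ hq]
    congr 1
    omega
  refine ⟨n * (q : ℤ) ^ (i - min i j).toNat + k * (q : ℤ) ^ (j - min i j).toNat, min i j, ?_⟩
  rw [key i (min_le_left _ _), key j (min_le_right _ _)]
  push_cast
  ring

theorem zpow_mul_mem_aux [q.AtLeastTwo] {x : ℚ} (m : ℤ) (hx : ∃ n i : ℤ, x = n * (q : ℚ) ^ i) :
    ∃ n i : ℤ, (q : ℚ) ^ m * x = n * (q : ℚ) ^ i := by
  obtain ⟨n, i, rfl⟩ := hx
  refine ⟨n, m + i, ?_⟩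
  rw [zpow_add₀ (natCast_ne_zero q)]
  ring

theorem neg_mem_aux {x : ℚ} (hx : ∃ n i : ℤ, x = n * (q : ℚ) ^ i) :
    ∃ n i : ℤ, -x = n * (q : ℚ) ^ i := by
  obtain ⟨n, i, rfl⟩ := hx
  exact ⟨-n, i, by push_cast; ring⟩

/-- The group law of `ℤ[1/q] ⋊ ℤ`: `(r, m) (r', m') = (r + q ^ m * r', m + m')`. -/
instance [q.AtLeastTwo] : Mul (BS q) :=
  ⟨fun x y => ⟨x.r + (q : ℚ) ^ x.m * y.r, x.m + y.m,
    add_mem_aux x.r_mem (zpow_mul_mem_aux x.m y.r_mem)⟩⟩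

instance : One (BS q) := ⟨⟨0, 0, 0, 0, by simp⟩⟩

instance [q.AtLeastTwo] : Inv (BS q) :=
  ⟨fun x => ⟨-((q : ℚ) ^ (-x.m) * x.r), -x.m, neg_mem_aux (zpow_mul_mem_aux _ x.r_mem)⟩⟩

@[simp] theorem mul_r [q.AtLeastTwo] (x y : BS q) : (x * y).r = x.r + (q : ℚ) ^ x.m * y.r := rfl
@[simp] theorem mul_m [q.AtLeastTwo] (x y : BS q) : (x * y).m = x.m + y.m := rfl
@[simp] theorem one_r : (1 : BS q).r = 0 := rfl
@[simp] theorem one_m : (1 : BS q).m = 0 := rfl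
@[simp] theorem inv_r [q.AtLeastTwo] (x : BS q) : (x⁻¹).r = -((q : ℚ) ^ (-x.m) * x.r) := rfl
@[simp] theorem inv_m [q.AtLeastTwo] (x : BS q) : (x⁻¹).m = -x.m := rfl

instance [q.AtLeastTwo] : Group (BS q) :=
  Group.ofLeftAxioms
    (fun x y z => by
      ext
      · simp only [mul_r, mul_m, zpow_add₀ (natCast_ne_zero q)]; ring
      · simp only [mul_m]; ring)
    (fun x => by ext <;> simp)
    (fun x => by ext <;> simp)

/-- The generator `a = (1, 0)`. -/
def a (q : ℕ) : BS q := ⟨1, 0, 1, 0, by simp⟩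

/-- The generator `t = (0, 1)`. -/
def t (q : ℕ) : BS q := ⟨0, 1, 0, 0, by simp⟩

end BS

/-! ### Runs, automata over a monoid, rational subsets -/

/-- `IsRun E p w p'`: there is a run from `p` to `p'` along edges in `E` whose sequence of labels
is `w`. -/
inductive IsRun {S Λ : Type*} (E : Set (S × Λ × S)) : S → List Λ → S → Prop
  | nil (p : S) : IsRun E p [] p
  | cons {p p' p'' : S} {x : Λ} {w : List Λ} :
      (p, x, p') ∈ E → IsRun E p' w p'' → IsRun E p (x :: w) p''

/-- A subset of a monoid `M` is rational if it is the set of productions of the accepting runs of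
an automaton over `M`, with finitely many states, finitely many edges labelled by elements of `M`,
one initial and one final state. -/
def IsRationalSubset {M : Type*} [Monoid M] (R : Set M) : Prop :=
  ∃ (Q : Type) (_ : Finite Q) (E : Set (Q × M × Q)) (_ : E.Finite) (q₀ q_f : Q),
    R = {g | ∃ w, IsRun E q₀ w q_f ∧ w.prod = g}

/-! ### Pointed expansions -/

/-- The alphabet of pointed expansions. `Sum.inl s` is a sign (`true` is `-`, `false` is `+`).
`Sum.inr (d, b, c)` is the digit `d`, decorated with the radix point `•` iff `b = true` and with
the cursor mark `◁` iff `c = true`. -/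
abbrev PELetter (q : ℕ) : Type := Bool ⊕ (Fin q × Bool × Bool)

namespace BS

variable {q : ℕ}

/-- The digit of `|r|` at position `i`, i.e. the coefficient of `q ^ i` in the finite base-`q`
expansion of `|r|`. -/
def digit [q.AtLeastTwo] (v : BS q) (i : ℤ) : Fin q :=
  ⟨⌊|v.r| * (q : ℚ) ^ (-i)⌋₊ % q, Nat.mod_lt _ (by
    have := Nat.AtLeastTwo.prop (n := q)
    omega)⟩

/-- The position `k₁ ≥ 0` of the leftmost digit in the pointed expansion: the least one such that
the cursor is not to the left of it and no nonzero digit of `|r|` is. -/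
noncomputable def hi (v : BS q) : ℕ :=
  sInf {k : ℕ | v.m ≤ k ∧ |v.r| < (q : ℚ) ^ (k + 1)}

/-- The number `k₂ ≥ 0` such that `-k₂` is the position of the rightmost digit in the pointed
expansion: the least one such that the cursor is not to the right of it and no nonzero digit of
`|r|` is. -/
noncomputable def lo (v : BS q) : ℕ :=
  sInf {k : ℕ | -v.m ≤ k ∧ ∃ N : ℕ, |v.r| * (q : ℚ) ^ k = N}

/-- The pointed expansion `± a_{k₁} ⋯ a_1 (a_0)_• a_{-1} ⋯ a_{-k₂}` of `(r, m)`, with `◁` added to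
`a_m`; the sign is `-` iff `r < 0`. -/
noncomputable def pe [q.AtLeastTwo] (v : BS q) : List (PELetter q) :=
  Sum.inl (decide (v.r < 0)) ::
    (List.range (v.hi + v.lo + 1)).map fun j =>
      let i : ℤ := v.hi - j
      Sum.inr (v.digit i, decide (i = 0), decide (i = v.m))

end BS

/-- The language `{pe(v) ∣ v ∈ R}`. -/
def peLanguage {q : ℕ} [q.AtLeastTwo] (R : Set (BS q)) : Language (PELetter q) :=
  {w | ∃ v ∈ R, v.pe = w}

/-- `R` is PE-regular if the language of its pointed expansions is regular. -/
def IsPERegular {q : ℕ} [q.AtLeastTwo] (R : Set (BS q)) : Prop :=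
  (peLanguage R).IsRegular

/-! ### Finite descriptions of automata, as inputs and outputs of algorithms -/

/-- Names of the generators `a`, `a⁻¹`, `t`, `t⁻¹`: the first component tells whether the generator
is `t` or its inverse (`true`) or `a` or its inverse (`false`); the second component tells whether
it is inverted. -/
abbrev Gen : Type := Bool × Bool

/-- The element of `BS(1,q)` named by a generator. -/
def Gen.toBS (q : ℕ) [q.AtLeastTwo] : Gen → BS q
  | (false, false) => BS.a q
  | (false, true) => (BS.a q)⁻¹
  | (true, false) => BS.t q
  | (true, true) => (BS.t q)⁻¹

/-- A finite description of an automaton over `BS(1,q)` with labels in `{a, a⁻¹, t, t⁻¹}`: the list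
of its edges, its initial state and its final state. The states are the natural numbers that
occur. -/
abbrev BSAutomaton : Type := List (ℕ × Gen × ℕ) × ℕ × ℕ

/-- The subset of `BS(1,q)` accepted by the automaton: the productions of its accepting runs. -/
def BSAutomaton.accepted (q : ℕ) [q.AtLeastTwo] (A : BSAutomaton) : Set (BS q) :=
  {g | ∃ w : List Gen, IsRun {e | e ∈ A.1} A.2.1 w A.2.2 ∧ (w.map (Gen.toBS q)).prod = g}

/-- A finite description of a nondeterministic finite automaton on words over `Γ`: the list of its
edges, its initial state and the list of its final states. -/
abbrev WordAutomaton (Γ : Type) : Type := List (ℕ × Γ × ℕ) × ℕ × List ℕ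

/-- The language accepted by a nondeterministic finite automaton. -/
def WordAutomaton.language {Γ : Type} (B : WordAutomaton Γ) : Language Γ :=
  {w | ∃ p ∈ B.2.2, IsRun {e | e ∈ B.1} B.2.1 w p}

/-! A word in the generators is a walk on pairs (state, level): `t` and `t⁻¹` move one level up or
down, and `a` and `a⁻¹` add or subtract `q ^ level`. An element `(r, m)` is accepted iff some walk
from the initial state at level `0` to the final state at level `m` adds `r` in total. The pointed
expansion lists the digits of `r` from the top level downwards, so an automaton can guess the walk
level by level in the same order. It remembers the pieces of the walk above the current level by
their end states (a crossing sequence) and a carry: the difference between what has been added and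
what has been written, in units of the current level. The check is sound whatever the size of these
data (`Core.Tot.step`, `Core.Tot.level`); the point is that data of bounded size suffice.

The carry is harmless. It is `0` at the end and `q ≥ 2`, so bounded net additions at each level
force bounded carries throughout (`exists_carries`). The number of pieces is the real problem, since
a walk may return to a vertex arbitrarily often. The remedy is to fix, at each state `b`, a few
auxiliary loops: integers `z` that are values of actual closed walks at `b` staying above their
first level. Suppose a walk leaves some vertex more than `K + 1` times, so that it contains `K + 1`
consecutive cycles there. Take the deepest one, with its bottom at state `β`. Conjugated to this
bottom, every cycle becomes part of a closed walk at `β` that stays above its first level. Hence the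
cycle values are integers in units of the bottom level, and if the values of such closed walks at
`β` are bounded on one side, repetition shows that all cycle values have the corresponding sign. If
they are bounded on both sides, the cycles have value zero and one can be erased. Otherwise, among
`K ≥ |z|` cycles some have a sum divisible by `z` (pigeonhole), and they can be traded for copies of
a loop `z` or `-z` at the bottom of the deepest cycle (`Walk.exists_replacement`). Iterating yields
a walk with few visits to each vertex (`Walk.exists_thin`), at the price of an uncontrolled number
of auxiliary loops.

These loops can be pushed down: one loop at level `i + 1` is worth `q` loops at level `i`. So all
copies of a loop at `b` are collected at the lowest visit to `b` (`Walk.exists_val_proper`), and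
their number is written in base `q`. At each level the machine adds fewer than `q` copies, and it
only has to remember that `b` must still be visited further down; `AbsPath.loop_down` is the reason
why this is sound. Thus every accepted element is found by a sweep through configurations of bounded
size (`Core.exists_sweep`). A finite component, the phase, makes sure that the written word has the
shape of a pointed expansion, and `Sweep.language_automaton` identifies the language.

For effectiveness, the suitable loops and the number `K` depend on which sets of closed-walk values
are bounded. This is not decided directly. A certificate contains loops that are found by a finite
enumeration, and a table of bounds that is closed under composition of walks. Validity is primitive
recursive and a valid certificate always exists (`Certificate.exists_valid`), so a search finds one;
the rest of the construction is primitive recursive. For rational subsets with arbitrary labels, the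
edges are subdivided into generators (`IsRationalSubset.exists_accepted_eq`). -/

/-! ### Elimination of silent edges -/

/-- A nondeterministic finite automaton with silent edges, given as its list of edges, its initial
state and the list of its final states. -/
abbrev EpsAutomaton (Γ : Type) : Type := List (ℕ × Option Γ × ℕ) × ℕ × List ℕ

/-- The language of a nondeterministic finite automaton with silent edges. -/
def EpsAutomaton.language {Γ : Type} (B : EpsAutomaton Γ) : Language Γ :=
  {w | ∃ p ∈ B.2.2, ∃ l, IsRun {e | e ∈ B.1} B.2.1 l p ∧ l.reduceOption = w}

theorem IsRun.append {S Λ : Type*} {E : Set (S × Λ × S)} {p p' p'' : S} {u v : List Λ}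
    (h : IsRun E p u p') (h' : IsRun E p' v p'') : IsRun E p (u ++ v) p'' := by
  induction h with
  | nil => exact h'
  | cons he _ ih => exact .cons he (ih h')

namespace EpsAutomaton

variable {Γ : Type}

/-- `u` and the states from which a pair in `T` leads to `u`. -/
def preds (T : List (ℕ × ℕ)) (u : ℕ) : List ℕ :=
  u :: T.flatMap fun e => if e.2 = u then [e.1] else []

/-- `u` and the states to which a pair in `T` leads from `u`. -/
def succs (T : List (ℕ × ℕ)) (u : ℕ) : List ℕ :=
  u :: T.flatMap fun e => if e.1 = u then [e.2] else []

theorem mem_preds {T : List (ℕ × ℕ)} {u a : ℕ} : a ∈ preds T u ↔ a = u ∨ (a, u) ∈ T := by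
  simp [preds]

theorem mem_succs {T : List (ℕ × ℕ)} {u a : ℕ} : a ∈ succs T u ↔ u = a ∨ (u, a) ∈ T := by
  simp [succs, eq_comm]

/-- The reachability relation after the addition of one silent edge. -/
def addEps (T : List (ℕ × ℕ)) (e : ℕ × Option Γ × ℕ) : List (ℕ × ℕ) :=
  if e.2.1 = none then
    ((preds T e.1).flatMap fun a => (succs T e.2.2).map fun b => (a, b)) ++ T
  else T

/-- The pairs of states that are connected by silent edges. -/
def epsClosure (E : List (ℕ × Option Γ × ℕ)) : List (ℕ × ℕ) := E.foldl addEps []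

/-- One use of the new edge suffices: whatever happens between its first and its last use can be cut
out. -/
theorem reflTransGen_or_edge {α : Type*} {r : α → α → Prop} {u v a b : α} :
    Relation.ReflTransGen (fun x y => r x y ∨ (x = u ∧ y = v)) a b ↔
      Relation.ReflTransGen r a b ∨
        (Relation.ReflTransGen r a u ∧ Relation.ReflTransGen r v b) := by
  constructor
  · intro h
    induction h with
    | refl => exact .inl .refl
    | tail _ hs ih =>
      rcases hs with hs | ⟨rfl, rfl⟩
      · rcases ih with ih | ⟨h1, h2⟩
        · exact .inl (ih.tail hs)
        · exact .inr ⟨h1, h2.tail hs⟩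
      · rcases ih with ih | ⟨h1, h2⟩
        · exact .inr ⟨ih, .refl⟩
        · exact .inr ⟨h1, .refl⟩
  · have key : ∀ {x y}, Relation.ReflTransGen r x y →
        Relation.ReflTransGen (fun x y => r x y ∨ (x = u ∧ y = v)) x y :=
      fun h => Relation.ReflTransGen.mono (fun _ _ h => .inl h) _ _ h
    rintro (h | ⟨h1, h2⟩)
    · exact key h
    · exact ((key h1).tail (.inr ⟨rfl, rfl⟩)).trans (key h2)

/-- The table is updated edge by edge according to `reflTransGen_or_edge`. Reflexive pairs are kept
outside the table, so that no list of states is needed. -/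
theorem epsClosure_spec (E : List (ℕ × Option Γ × ℕ)) (a b : ℕ) :
    (a = b ∨ (a, b) ∈ epsClosure E) ↔
      Relation.ReflTransGen (fun x y => (x, none, y) ∈ E) a b := by
  induction E using List.reverseRecOn generalizing a b with
  | nil =>
    have : (fun x y : ℕ => (x, (none : Option Γ), y) ∈ ([] : List (ℕ × Option Γ × ℕ))) =
        fun _ _ => False := by simp
    rw [this]
    constructor
    · rintro (rfl | h)
      · exact .refl
      · simp [epsClosure] at h
    · intro h
      cases h with
      | refl => exact .inl rfl
      | tail _ h => exact h.elim
  | append_singleton E e ih =>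
    obtain ⟨u, o, v⟩ := e
    have hfold : epsClosure (E ++ [(u, o, v)]) = addEps (epsClosure E) (u, o, v) := by
      simp [epsClosure]
    rw [hfold]
    cases o with
    | some x => simpa [addEps] using ih a b
    | none =>
      have : (fun x y : ℕ => (x, (none : Option Γ), y) ∈ E ++ [(u, none, v)]) =
          fun x y => (x, none, y) ∈ E ∨ (x = u ∧ y = v) := by
        funext x y; simp
      rw [this, reflTransGen_or_edge, ← ih a b, ← ih a u, ← ih v b]
      simp only [addEps, if_true, List.mem_append, List.mem_flatMap, List.mem_map, mem_preds,
        mem_succs, Prod.mk.injEq]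
      constructor
      · rintro (h | ⟨a', h1, b', h2, rfl, rfl⟩ | h)
        · exact .inl (.inl h)
        · exact .inr ⟨h1, h2⟩
        · exact .inl (.inr h)
      · rintro ((h | h) | ⟨h1, h2⟩)
        · exact .inl h
        · exact .inr (.inr h)
        · exact .inr (.inl ⟨a, h1, b, h2, rfl, rfl⟩)

/-- The automaton without silent edges that accepts the same language. -/
def elim (B : EpsAutomaton Γ) : WordAutomaton Γ :=
  (B.1.flatMap fun e => e.2.1.toList.flatMap fun x =>
      (preds (epsClosure B.1) e.1).map fun a => (a, x, e.2.2),
    B.2.1, B.2.2.flatMap fun p => preds (epsClosure B.1) p)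

theorem mem_elim_edges (B : EpsAutomaton Γ) (a : ℕ) (x : Γ) (b : ℕ) :
    (a, x, b) ∈ (elim B).1 ↔
      ∃ u, Relation.ReflTransGen (fun x y => (x, none, y) ∈ B.1) a u ∧ (u, some x, b) ∈ B.1 := by
  simp only [elim, List.mem_flatMap, List.mem_map, mem_preds, epsClosure_spec, Prod.mk.injEq,
    Option.mem_toList]
  constructor
  · rintro ⟨⟨u, o, v⟩, he, y, hy, c, hc, rfl, rfl, rfl⟩
    simp only at hy hc he
    subst hy
    exact ⟨u, hc, he⟩
  · rintro ⟨u, hu, he⟩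
    exact ⟨_, he, x, rfl, a, hu, rfl, rfl, rfl⟩

theorem isRun_of_reflTransGen {E : List (ℕ × Option Γ × ℕ)} {a b : ℕ}
    (h : Relation.ReflTransGen (fun x y => (x, none, y) ∈ E) a b) :
    ∃ l, IsRun {e | e ∈ E} a l b ∧ l.reduceOption = [] := by
  induction h with
  | refl => exact ⟨[], .nil _, rfl⟩
  | tail _ hs ih =>
    obtain ⟨l, hl, h0⟩ := ih
    exact ⟨l ++ [none], hl.append (.cons hs (.nil _)), by simp [List.reduceOption_append, h0]⟩

/-- Each letter absorbs the silent edges in front of it; those after the last letter are absorbed by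
the enlarged set of final states. -/
theorem elim_language (B : EpsAutomaton Γ) : (elim B).language = B.language := by
  ext w
  constructor
  · rintro ⟨p, hp, hrun⟩
    change IsRun {e | e ∈ (elim B).1} B.2.1 w p at hrun
    simp only [elim, List.mem_flatMap, mem_preds, epsClosure_spec] at hp
    obtain ⟨f, hf, hpf⟩ := hp
    refine ⟨f, hf, ?_⟩
    generalize B.2.1 = p₀ at hrun
    induction hrun with
    | nil p => exact isRun_of_reflTransGen hpf
    | cons he _ ih =>
      obtain ⟨l, hl, hw⟩ := ih hpf
      obtain ⟨u, hu, he⟩ := (mem_elim_edges B _ _ _).1 he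
      obtain ⟨l', hl', hw'⟩ := isRun_of_reflTransGen hu
      exact ⟨l' ++ some _ :: l, hl'.append (.cons he hl), by
        simp [List.reduceOption_append, hw, hw']⟩
  · rintro ⟨f, hf, l, hrun, rfl⟩
    have key : ∀ {p₀}, IsRun {e | e ∈ B.1} p₀ l f → ∃ p,
        Relation.ReflTransGen (fun x y => (x, none, y) ∈ B.1) p f ∧
          IsRun {e | e ∈ (elim B).1} p₀ l.reduceOption p := by
      intro p₀ h
      clear hrun
      induction h with
      | nil p => exact ⟨p, .refl, .nil p⟩
      | @cons p p' p'' x w he _ ih =>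
        obtain ⟨s, hs, hr⟩ := ih hf
        cases x with
        | some x =>
          refine ⟨s, hs, ?_⟩
          rw [List.reduceOption_cons_of_some]
          exact .cons ((mem_elim_edges B _ _ _).2 ⟨p, .refl, he⟩) hr
        | none =>
          rw [List.reduceOption_cons_of_none]
          -- The silent edge is merged into the next edge of the run without silent edges or, if
          -- that run is over, into the silent path to `f`.
          generalize w.reduceOption = w' at hr
          cases hr with
          | nil => exact ⟨p, hs.head he, .nil p⟩
          | cons he' hr =>
            obtain ⟨u, hu, he''⟩ := (mem_elim_edges B _ _ _).1 he'
            exact ⟨s, hs, .cons ((mem_elim_edges B _ _ _).2 ⟨u, hu.head he, he''⟩) hr⟩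
    obtain ⟨p, hp, hr⟩ := key hrun
    refine ⟨p, ?_, hr⟩
    simp only [elim, List.mem_flatMap, mem_preds, epsClosure_spec]
    exact ⟨f, hf, hp⟩

end EpsAutomaton

/-! ### Primitive recursive functions -/

namespace Primrec

variable {α β γ σ : Type*} [Primcodable α] [Primcodable β] [Primcodable γ] [Primcodable σ]

theorem forall_mem {f : α → List β} {p : α → β → Prop} (hf : Primrec f) (hp : PrimrecRel p) :
    PrimrecPred fun a => ∀ b ∈ f a, p a b :=
  (hp.swap.forall_mem_list).comp hf .id

theorem exists_mem {f : α → List β} {p : α → β → Prop} (hf : Primrec f) (hp : PrimrecRel p) :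
    PrimrecPred fun a => ∃ b ∈ f a, p a b :=
  (hp.swap.exists_mem_list).comp hf .id

theorem singleton {f : α → β} (hf : Primrec f) : Primrec fun a => [f a] :=
  list_cons.comp hf (const [])

theorem cons_nil_of {p : α → Prop} [DecidablePred p] {f : α → β} (hp : PrimrecPred p)
    (hf : Primrec f) : Primrec fun a => if p a then [f a] else [] :=
  ite hp (singleton hf) (const [])

end Primrec

/-! ### Primitive recursiveness of the elimination of silent edges -/

namespace EpsAutomaton

variable {Γ : Type} [Primcodable Γ]

theorem primrec_preds : Primrec₂ preds := by
  refine Primrec.list_cons.comp .snd (Primrec.list_flatMap .fst ?_)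
  exact Primrec.cons_nil_of (Primrec.eq.comp (Primrec.snd.comp .snd) (Primrec.snd.comp .fst))
    (Primrec.fst.comp .snd)

theorem primrec_succs : Primrec₂ succs := by
  refine Primrec.list_cons.comp .snd (Primrec.list_flatMap .fst ?_)
  exact Primrec.cons_nil_of (Primrec.eq.comp (Primrec.fst.comp .snd) (Primrec.snd.comp .fst))
    (Primrec.snd.comp .snd)

theorem primrec_addEps : Primrec₂ (addEps (Γ := Γ)) := by
  have h1 : PrimrecPred fun x : List (ℕ × ℕ) × (ℕ × Option Γ × ℕ) => x.2.2.1 = none :=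
    Primrec.eq.comp (Primrec.fst.comp (Primrec.snd.comp .snd)) (.const none)
  refine Primrec.ite h1 (Primrec.list_append.comp (Primrec.list_flatMap
    (primrec_preds.comp .fst (Primrec.fst.comp .snd)) ?_) .fst) .fst
  exact Primrec.list_map (primrec_succs.comp (Primrec.fst.comp .fst)
    (Primrec.snd.comp (Primrec.snd.comp (Primrec.snd.comp .fst))))
    (Primrec.pair (Primrec.snd.comp .fst) .snd).to₂

theorem primrec_epsClosure : Primrec (epsClosure (Γ := Γ)) :=
  Primrec.list_foldl .id (.const []) (primrec_addEps.comp (Primrec.fst.comp .snd)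
    (Primrec.snd.comp .snd)).to₂

theorem primrec_elim : Primrec (elim (Γ := Γ)) := by
  refine Primrec.pair (Primrec.list_flatMap .fst ?_)
    (Primrec.pair (Primrec.fst.comp .snd) (Primrec.list_flatMap (Primrec.snd.comp .snd) ?_))
  · refine Primrec.list_flatMap (Primrec.optionToList.comp
      (Primrec.fst.comp (Primrec.snd.comp .snd))) ?_
    refine Primrec.list_map (primrec_preds.comp
      (primrec_epsClosure.comp (Primrec.fst.comp (Primrec.fst.comp .fst)))
      (Primrec.fst.comp (Primrec.snd.comp .fst))) ?_
    exact Primrec.pair .snd (Primrec.pair (Primrec.snd.comp .fst)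
      (Primrec.snd.comp (Primrec.snd.comp (Primrec.snd.comp (Primrec.fst.comp .fst)))))
  · exact primrec_preds.comp (primrec_epsClosure.comp (Primrec.fst.comp .fst)) .snd

end EpsAutomaton

/-! ### Primitive recursive arithmetic of integers -/

namespace Primrec

/-- The code of an integer is `2 * n` for `n` and `2 * n + 1` for `-(n + 1)`, so the parity gives
the sign. Splitting into positive and negative part reduces integer arithmetic to natural numbers.
-/
theorem int_toNat_pair : Primrec fun z : ℤ => (z.toNat, (-z).toNat) := by
  have h : Primrec fun n : ℕ =>
      if n % 2 = 0 then (n / 2, 0) else (0, n / 2 + 1) :=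
    ite (Primrec.eq.comp (nat_mod.comp .id (const 2)) (const 0))
      (pair (nat_div.comp .id (const 2)) (const 0))
      (pair (const 0) (succ.comp (nat_div.comp .id (const 2))))
  refine (h.comp (Primrec.encode (α := ℤ))).of_eq fun z => ?_
  cases z with
  | ofNat n =>
    have : Encodable.encode (Int.ofNat n) = 2 * n := rfl
    rw [this]
    simp
  | negSucc n =>
    have : Encodable.encode (Int.negSucc n) = 2 * n + 1 := rfl
    rw [this]
    have h2 : (2 * n + 1) / 2 = n := by omega
    simp [h2]

theorem int_subNatNat : Primrec₂ fun m n : ℕ => (m : ℤ) - n := by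
  have h : Primrec₂ fun m n : ℕ => if n ≤ m then 2 * (m - n) else 2 * (n - m - 1) + 1 :=
    ite (nat_le.comp snd fst) (nat_double.comp (nat_sub.comp fst snd))
      (nat_double_succ.comp (nat_sub.comp (nat_sub.comp snd fst) (const 1)))
  refine (Primrec₂.encode_iff (σ := ℤ)).1 (h.of_eq fun m n => ?_)
  have key : ∀ z : ℤ, Encodable.encode z =
      if 0 ≤ z then 2 * z.toNat else 2 * ((-z).toNat - 1) + 1 := by
    rintro (k | k)
    · exact (if_pos (Int.natCast_nonneg k)).symm
    · rw [if_neg (Int.negSucc_not_nonneg _).1]; rfl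
  rw [key]
  split_ifs <;> omega

theorem int_add : Primrec₂ ((· + ·) : ℤ → ℤ → ℤ) := by
  have h1 := int_toNat_pair.comp (fst (α := ℤ) (β := ℤ))
  have h2 := int_toNat_pair.comp (snd (α := ℤ) (β := ℤ))
  refine (int_subNatNat.comp (nat_add.comp (fst.comp h1) (fst.comp h2))
    (nat_add.comp (snd.comp h1) (snd.comp h2))).of_eq fun x => ?_
  push_cast
  omega

theorem int_neg : Primrec (Neg.neg : ℤ → ℤ) := by
  refine (int_subNatNat.comp (snd.comp int_toNat_pair) (fst.comp int_toNat_pair)).of_eq fun x => ?_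
  push_cast
  omega

theorem int_sub : Primrec₂ ((· - ·) : ℤ → ℤ → ℤ) :=
  (int_add.comp fst (int_neg.comp snd)).of_eq fun _ => (sub_eq_add_neg _ _).symm

theorem int_natCast : Primrec (Nat.cast : ℕ → ℤ) :=
  (int_subNatNat.comp .id (const 0)).of_eq fun n => by simp

theorem int_nat_mul : Primrec₂ fun (n : ℕ) (z : ℤ) => (n : ℤ) * z := by
  have h := int_toNat_pair.comp (snd (α := ℕ) (β := ℤ))
  refine (int_subNatNat.comp (nat_mul.comp fst (fst.comp h))
    (nat_mul.comp fst (snd.comp h))).of_eq fun x => ?_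
  push_cast
  rw [← mul_sub]
  congr 1
  omega

theorem int_nonneg : PrimrecPred fun z : ℤ => 0 ≤ z :=
  (Primrec.eq.comp (snd.comp int_toNat_pair) (const 0)).of_eq fun z => by simp

theorem int_le : PrimrecRel ((· ≤ ·) : ℤ → ℤ → Prop) :=
  (int_nonneg.comp (int_sub.comp snd fst)).of_eq fun z => by simp

theorem int_lt : PrimrecRel ((· < ·) : ℤ → ℤ → Prop) :=
  (int_le.comp snd fst).not.of_eq fun z => by simp

theorem int_natAbs : Primrec Int.natAbs :=
  (nat_add.comp (fst.comp int_toNat_pair) (snd.comp int_toNat_pair)).of_eq fun z => by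
    simp only; omega

end Primrec

/-! ### Walks in the product of the states and the levels -/

/-- The moves of a walk: the cursor goes up or down, or an integer is added at the cursor, either
along an edge of the automaton (`add`) or along an auxiliary loop (`att`). -/
inductive Mv
  | up
  | down
  | add (z : ℤ)
  | att (z : ℤ)

namespace Mv

/-- The change of the level. -/
def lev : Mv → ℤ
  | up => 1
  | down => -1
  | _ => 0

/-- The integer added at the cursor. -/
def val : Mv → ℤ
  | add z => z
  | att z => z
  | _ => 0

/-- The number of edges of the automaton: `0` for auxiliary loops and `1` otherwise. -/
def size : Mv → ℕ
  | att _ => 0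
  | _ => 1

end Mv

/-- The integer added by `a` (`false`) or by `a⁻¹` (`true`). -/
def sgn (b : Bool) : ℤ := if b then -1 else 1

/-- `Ok E G p x p'`: the move `x` leads from `p` to `p'` along an edge in `E` or a loop in `G`. -/
def Ok (E : List (ℕ × Gen × ℕ)) (G : List (ℕ × ℤ)) (p : ℕ) (x : Mv) (p' : ℕ) : Prop :=
  match x with
  | .up => (p, (true, false), p') ∈ E
  | .down => (p, (true, true), p') ∈ E
  | .add z => ∃ b, z = sgn b ∧ (p, (false, b), p') ∈ E
  | .att z => p' = p ∧ (p, z) ∈ G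

/-- A walk is the list of its moves together with the states that they lead to. -/
abbrev Walk : Type := List (Mv × ℕ)

namespace Walk

/-- The moves of `w` are possible from `p`. -/
def Valid (E : List (ℕ × Gen × ℕ)) (G : List (ℕ × ℤ)) : ℕ → Walk → Prop
  | _, [] => True
  | p, x :: w => Ok E G p x.1 x.2 ∧ Valid E G x.2 w

/-- The last state of a walk. -/
def fin : ℕ → Walk → ℕ
  | p, [] => p
  | _, x :: w => fin x.2 w

/-- The change of the level along a walk. -/
def lev : Walk → ℤ
  | [] => 0
  | x :: w => x.1.lev + lev w

/-- The number added along a walk, in units of the first level. -/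
def val (q : ℕ) : Walk → ℚ
  | [] => 0
  | x :: w => x.1.val + (q : ℚ) ^ x.1.lev * val q w

/-- The least level on a walk, relative to the first level. -/
def minLev : Walk → ℤ
  | [] => 0
  | x :: w => min 0 (x.1.lev + minLev w)

/-- The number of edges of the automaton on a walk. -/
def size : Walk → ℕ
  | [] => 0
  | x :: w => x.1.size + size w

/-- The number of edges of the automaton on a walk from `(p, ℓ)` that leave the vertex `(s, j)`. -/
def leaves (s : ℕ) (j : ℤ) : ℤ → ℕ → Walk → ℕ
  | _, _, [] => 0
  | ℓ, p, x :: w => (if p = s ∧ ℓ = j then x.1.size else 0) + leaves s j (ℓ + x.1.lev) x.2 w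

variable {E : List (ℕ × Gen × ℕ)} {G : List (ℕ × ℤ)} {q : ℕ}

theorem valid_append {p : ℕ} {u v : Walk} :
    Valid E G p (u ++ v) ↔ Valid E G p u ∧ Valid E G (fin p u) v := by
  induction u generalizing p with
  | nil => simp [Valid, fin]
  | cons x u ih => simp [Valid, fin, ih, and_assoc]

theorem fin_append {p : ℕ} {u v : Walk} : fin p (u ++ v) = fin (fin p u) v := by
  induction u generalizing p with
  | nil => rfl
  | cons x u ih => exact ih

theorem lev_append {u v : Walk} : lev (u ++ v) = lev u + lev v := by
  induction u with
  | nil => simp [lev]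
  | cons x u ih => simp [lev, ih, add_assoc]

theorem size_append {u v : Walk} : size (u ++ v) = size u + size v := by
  induction u with
  | nil => simp [size]
  | cons x u ih => simp [size, ih, add_assoc]

theorem val_append [q.AtLeastTwo] {u v : Walk} :
    val q (u ++ v) = val q u + (q : ℚ) ^ lev u * val q v := by
  induction u with
  | nil => simp [val, lev]
  | cons x u ih =>
    simp only [List.cons_append, val, ih, lev, zpow_add₀ (BS.natCast_ne_zero q)]
    ring

theorem minLev_nonpos (w : Walk) : minLev w ≤ 0 := by
  cases w <;> simp [minLev]

theorem minLev_append {u v : Walk} : minLev (u ++ v) = min (minLev u) (lev u + minLev v) := by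
  induction u with
  | nil => simp [minLev, lev, minLev_nonpos]
  | cons x u ih =>
    simp only [List.cons_append, minLev, ih, lev]
    omega

/-- A walk can be split at its lowest point. -/
theorem exists_split_minLev (w : Walk) : ∃ u v, w = u ++ v ∧ lev u = minLev w := by
  induction w with
  | nil => exact ⟨[], [], rfl, rfl⟩
  | cons x w ih =>
    obtain ⟨u, v, rfl, h⟩ := ih
    by_cases hx : x.1.lev + minLev (u ++ v) ≤ 0
    · exact ⟨x :: u, v, rfl, by simp only [lev, minLev, h]; omega⟩
    · exact ⟨[], x :: (u ++ v), rfl, by simp only [lev, minLev]; omega⟩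

/-- A walk that ends below its first level can be split where it first goes below it. -/
theorem exists_split_down (w : Walk) (k : ℕ) (h : lev w < -k) :
    ∃ u s v, w = u ++ (.down, s) :: v ∧ lev u = -k ∧ -k ≤ minLev u := by
  induction w generalizing k with
  | nil => simp [lev] at h; omega
  | cons x w ih =>
    obtain ⟨x, s⟩ := x
    cases x with
    -- Seen from the level after this move, the walk has one level more to descend.
    | up =>
      obtain ⟨u, s', v, rfl, h1, h2⟩ := ih (k + 1) (by simp [lev, Mv.lev] at h ⊢; omega)
      refine ⟨(.up, s) :: u, s', v, rfl, ?_, ?_⟩ <;> simp [lev, minLev, Mv.lev] at * <;> omega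
    | down =>
      cases k with
      | zero => exact ⟨[], s, w, rfl, by simp [lev], by simp [minLev]⟩
      | succ k =>
        obtain ⟨u, s', v, rfl, h1, h2⟩ := ih k (by simp [lev, Mv.lev] at h ⊢; omega)
        refine ⟨(.down, s) :: u, s', v, rfl, ?_, ?_⟩ <;> simp [lev, minLev, Mv.lev] at * <;> omega
    | add z =>
      obtain ⟨u, s', v, rfl, h1, h2⟩ := ih k (by simpa [lev, Mv.lev] using h)
      refine ⟨(.add z, s) :: u, s', v, rfl, ?_, ?_⟩ <;> simp [lev, minLev, Mv.lev] at * <;> omega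
    | att z =>
      obtain ⟨u, s', v, rfl, h1, h2⟩ := ih k (by simpa [lev, Mv.lev] using h)
      refine ⟨(.att z, s) :: u, s', v, rfl, ?_, ?_⟩ <;> simp [lev, minLev, Mv.lev] at * <;> omega

/-! ### Cycles at a vertex -/

/-- `c` is a closed walk from `s` to `s` that returns to its first level. -/
structure Cycle (E : List (ℕ × Gen × ℕ)) (G : List (ℕ × ℤ)) (s : ℕ) (c : Walk) : Prop where
  valid : Valid E G s c
  fin : Walk.fin s c = s
  lev : Walk.lev c = 0

namespace Cycle

variable {s : ℕ}

theorem nil : Cycle E G s [] := ⟨trivial, rfl, rfl⟩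

theorem append {u v : Walk} (hu : Cycle E G s u) (hv : Cycle E G s v) : Cycle E G s (u ++ v) :=
  ⟨valid_append.2 ⟨hu.valid, by rw [hu.fin]; exact hv.valid⟩, by rw [fin_append, hu.fin, hv.fin],
    by rw [lev_append, hu.lev, hv.lev, add_zero]⟩

theorem flatten {cs : List Walk} (h : ∀ c ∈ cs, Cycle E G s c) : Cycle E G s cs.flatten := by
  induction cs with
  | nil => exact nil
  | cons c cs ih =>
    rw [List.flatten_cons]
    exact (h c (by simp)).append (ih fun c' hc' => h c' (by simp [hc']))

theorem val_append [q.AtLeastTwo] {u : Walk} (hu : Cycle E G s u) (v : Walk) :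
    val q (u ++ v) = val q u + val q v := by
  rw [Walk.val_append, hu.lev]; simp

theorem val_flatten [q.AtLeastTwo] {cs : List Walk} (h : ∀ c ∈ cs, Cycle E G s c) :
    val q cs.flatten = (cs.map (val q)).sum := by
  induction cs with
  | nil => simp [val]
  | cons c cs ih =>
    rw [List.flatten_cons, (h c (by simp)).val_append, ih fun c' hc' => h c' (by simp [hc'])]
    simp

theorem le_minLev_append {u v : Walk} {d : ℤ} (hu : Cycle E G s u) (h : d ≤ minLev u)
    (h' : d ≤ minLev v) : d ≤ minLev (u ++ v) := by
  rw [minLev_append, hu.lev]; omega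

theorem le_minLev_flatten {cs : List Walk} {d : ℤ} (hd : d ≤ 0) (h : ∀ c ∈ cs, Cycle E G s c)
    (h' : ∀ c ∈ cs, d ≤ minLev c) : d ≤ minLev cs.flatten := by
  induction cs with
  | nil => simpa [minLev]
  | cons c cs ih =>
    rw [List.flatten_cons]
    exact (h c (by simp)).le_minLev_append (h' c (by simp))
      (ih (fun c' hc' => h c' (by simp [hc'])) fun c' hc' => h' c' (by simp [hc']))

end Cycle

theorem size_flatten (cs : List Walk) : size cs.flatten = (cs.map size).sum := by
  induction cs with
  | nil => rfl
  | cons c cs ih => rw [List.flatten_cons, size_append, ih]; simp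

/-- A walk that leaves a vertex often contains many consecutive cycles at this vertex. -/
theorem exists_cycles {s : ℕ} {j : ℤ} (k : ℕ) (w : Walk) {p : ℕ} {ℓ : ℤ} (hw : Valid E G p w)
    (h : k + 1 ≤ leaves s j ℓ p w) :
    ∃ (w₀ : Walk) (cs : List Walk) (w₁ : Walk), w = w₀ ++ (cs.flatten ++ w₁) ∧ fin p w₀ = s ∧ ℓ + lev w₀ = j ∧ cs.length = k ∧
      ∀ c ∈ cs, Cycle E G s c ∧ 0 < size c := by
  induction w generalizing k p ℓ with
  | nil => simp [leaves] at h
  | cons x w ih =>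
    by_cases hx : (p = s ∧ ℓ = j) ∧ 0 < x.1.size
    · obtain ⟨⟨rfl, rfl⟩, hx⟩ := hx
      have hx1 : x.1.size = 1 := by
        rcases x with ⟨_ | _ | _ | _, _⟩ <;> simp_all [Mv.size]
      cases k with
      | zero => exact ⟨[], [], x :: w, by simp, rfl, by simp [lev], rfl, by simp⟩
      | succ k =>
        obtain ⟨w₀, cs, w₁, rfl, h1, h2, h3, h4⟩ := ih k (ℓ := ℓ + x.1.lev) hw.2
          (by simp only [leaves, and_self, if_true, hx1] at h; omega)
        -- The move `x` together with the part of the tail before its first cycle leads back to the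
        -- vertex and forms one more cycle.
        refine ⟨[], (x :: w₀) :: cs, w₁, by simp, rfl, by simp [lev], by simp [h3], ?_⟩
        rintro c hc
        rcases List.mem_cons.1 hc with rfl | hc
        · refine ⟨⟨⟨hw.1, (valid_append.1 hw.2).1⟩, h1, ?_⟩, ?_⟩
          · simp only [lev]; omega
          · simp only [size]; omega
        · exact h4 c hc
    · have h0 : (if p = s ∧ ℓ = j then x.1.size else 0) = 0 := by
        split_ifs with h'
        · simpa using fun h0 => hx ⟨h', Nat.pos_of_ne_zero h0⟩
        · rfl
      obtain ⟨w₀, cs, w₁, rfl, h1, h2, h3, h4⟩ := ih k (ℓ := ℓ + x.1.lev) hw.2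
        (by simp only [leaves, h0] at h; omega)
      exact ⟨x :: w₀, cs, w₁, rfl, h1, by simp only [lev]; omega, h3, h4⟩

end Walk

/-! ### Bounds on the values of walks that stay above their first level -/

/-- A list of entries `(p, p', lo, hi)`: the elements of `lo` are lower bounds and those of `hi` are
upper bounds of the values of walks from `p` to `p'` that stay above their first level and return
to it. -/
abbrev BoundTable : Type := List (ℕ × ℕ × List ℤ × List ℤ)

/-- `z` respects the bounds `(lo, hi)`. -/
def Within (z : ℤ) (b : List ℤ × List ℤ) : Prop := (∀ l ∈ b.1, l ≤ z) ∧ ∀ h ∈ b.2, z ≤ h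

/-- The table has an entry for each pair of states that is connected by a walk, and its bounds are
closed under the ways in which such walks are composed. -/
structure BoundTable.Closed (q : ℕ) (E : List (ℕ × Gen × ℕ)) (G : List (ℕ × ℤ)) (S : List ℕ)
    (D : BoundTable) : Prop where
  unique : ∀ e ∈ D, ∀ e' ∈ D, e.1 = e'.1 ∧ e.2.1 = e'.2.1 → e = e'
  nil : ∀ p ∈ S, ∃ e ∈ D, e.1 = p ∧ e.2.1 = p ∧ Within 0 e.2.2
  add : ∀ f ∈ E, f.2.1.1 = false → ∃ e ∈ D, e.1 = f.1 ∧ e.2.1 = f.2.2 ∧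
    Within (sgn f.2.1.2) e.2.2
  att : ∀ g ∈ G, ∃ e ∈ D, e.1 = g.1 ∧ e.2.1 = g.1 ∧ Within g.2 e.2.2
  lift : ∀ f ∈ E, f.2.1 = (true, false) → ∀ e ∈ D, e.1 = f.2.2 →
    ∀ f' ∈ E, f'.2.1 = (true, true) ∧ f'.1 = e.2.1 → ∃ e' ∈ D, e'.1 = f.1 ∧ e'.2.1 = f'.2.2 ∧
      (∀ l' ∈ e'.2.2.1, ∃ l ∈ e.2.2.1, l' ≤ q * l) ∧ ∀ h' ∈ e'.2.2.2, ∃ h ∈ e.2.2.2, q * h ≤ h'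
  comp : ∀ e ∈ D, ∀ e' ∈ D, e.2.1 = e'.1 → ∃ e'' ∈ D, e''.1 = e.1 ∧ e''.2.1 = e'.2.1 ∧
      (∀ l'' ∈ e''.2.2.1, ∃ l ∈ e.2.2.1, ∃ l' ∈ e'.2.2.1, l'' ≤ l + l') ∧
      ∀ h'' ∈ e''.2.2.2, ∃ h ∈ e.2.2.2, ∃ h' ∈ e'.2.2.2, h + h' ≤ h''

/-- The auxiliary loops in `G` suffice to replace sums of `K` values of cycles. -/
def BoundTable.Suffices (G : List (ℕ × ℤ)) (K : ℕ) (D : BoundTable) : Prop :=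
  ∀ e ∈ D, e.1 = e.2.1 → (e.2.2.1 ≠ [] ∧ e.2.2.2 ≠ []) ∨ ∃ g ∈ G, g.1 = e.1 ∧ g.2 ≠ 0 ∧
    g.2.natAbs ≤ K ∧ ((e.2.2.1 ≠ [] ∧ 0 < g.2) ∨ (e.2.2.2 ≠ [] ∧ g.2 < 0) ∨ (e.1, -g.2) ∈ G)

namespace BoundTable

variable {E : List (ℕ × Gen × ℕ)} {G : List (ℕ × ℤ)} {S : List ℕ} {D : BoundTable} {q : ℕ}

theorem Closed.exists_comp (hD : D.Closed q E G S) {p s p' : ℕ} {e e' : ℕ × ℕ × List ℤ × List ℤ}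
    (he : e ∈ D) (h1 : e.1 = p) (h2 : e.2.1 = s) (he' : e' ∈ D) (h1' : e'.1 = s)
    (h2' : e'.2.1 = p') {z z' : ℤ} (hz : Within z e.2.2) (hz' : Within z' e'.2.2) :
    ∃ e'' ∈ D, e''.1 = p ∧ e''.2.1 = p' ∧ Within (z + z') e''.2.2 := by
  obtain ⟨e'', h, h3, h4, h5, h6⟩ := hD.comp e he e' he' (h2.trans h1'.symm)
  refine ⟨e'', h, h3.trans h1, h4.trans h2', fun l hl => ?_, fun l hl => ?_⟩
  · obtain ⟨a, ha, b, hb, hab⟩ := h5 l hl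
    linarith [hz.1 a ha, hz'.1 b hb]
  · obtain ⟨a, ha, b, hb, hab⟩ := h6 l hl
    linarith [hz.2 a ha, hz'.2 b hb]

/-- A nonempty walk of this kind starts either with an addition or a loop, followed by a shorter
walk of the same kind, or with an ascent; in the latter case it is cut at the first return into a
lifted walk and a rest. The fields of `Closed` answer exactly to these cases. An empty list of
bounds claims nothing, so unbounded sets of values are admitted. -/
theorem Closed.within [q.AtLeastTwo] (hD : D.Closed q E G S)
    (hS : ∀ e ∈ E, e.2.2 ∈ S) (w : Walk) {p : ℕ} (hp : p ∈ S)
    (hw : Walk.Valid E G p w) (hl : Walk.lev w = 0) (hm : 0 ≤ Walk.minLev w) :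
    ∃ e ∈ D, e.1 = p ∧ e.2.1 = Walk.fin p w ∧ ∃ z : ℤ, Walk.val q w = z ∧ Within z e.2.2 := by
  induction hn : w.length using Nat.strong_induction_on generalizing w p with
  | _ n ih =>
    subst hn
    have hq0 : (q : ℤ) > 0 := by have := Nat.AtLeastTwo.prop (n := q); omega
    rcases w with _ | ⟨⟨x, s⟩, w⟩
    · obtain ⟨e, he, h1, h2, h3⟩ := hD.nil p hp
      exact ⟨e, he, h1, h2, 0, by simp [Walk.val], h3⟩
    · cases x with
      | add z =>
        obtain ⟨⟨b, rfl, hx⟩, hw⟩ := hw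
        simp only [Walk.lev, Walk.minLev, Mv.lev, zero_add] at hl hm
        obtain ⟨e, he, h1, h2, h3⟩ := hD.add _ hx rfl
        obtain ⟨e', he', h1', h2', z', hz', h3'⟩ := ih w.length (by simp) w (hS _ hx) hw hl
          (by omega) rfl
        obtain ⟨e'', he'', h1'', h2'', h3''⟩ :=
          hD.exists_comp he h1 h2 he' h1' h2' h3 h3'
        exact ⟨e'', he'', h1'', h2'', _, by simp [Walk.val, Mv.val, Mv.lev, hz'], h3''⟩
      | att z =>
        obtain ⟨⟨rfl, hx⟩, hw⟩ := hw
        simp only [Walk.lev, Walk.minLev, Mv.lev, zero_add] at hl hm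
        obtain ⟨e, he, h1, h2, h3⟩ := hD.att _ hx
        obtain ⟨e', he', h1', h2', z', hz', h3'⟩ := ih w.length (by simp) w hp hw hl
          (by omega) rfl
        obtain ⟨e'', he'', h1'', h2'', h3''⟩ :=
          hD.exists_comp he h1 h2 he' h1' h2' h3 h3'
        exact ⟨e'', he'', h1'', h2'', _, by simp [Walk.val, Mv.val, Mv.lev, hz'], h3''⟩
      | down =>
        simp only [Walk.minLev, Mv.lev] at hm
        have := Walk.minLev_nonpos w
        omega
      | up =>
        obtain ⟨hx, hw⟩ := hw
        simp only [Walk.lev, Walk.minLev, Mv.lev] at hl hm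
        -- The cut is at the first descent below the level that the initial ascent reaches.
        obtain ⟨u, s', v, rfl, hu, hu'⟩ := Walk.exists_split_down w 0 (by simp; omega)
        obtain ⟨hwu, hy, hwv⟩ := Walk.valid_append.1 hw
        rw [Walk.minLev_append] at hm
        rw [Walk.lev_append] at hl
        simp only [Walk.lev, Walk.minLev, Mv.lev, Nat.cast_zero, neg_zero] at hu hu' hl hm
        obtain ⟨e, he, h1, h2, z, hz, h3⟩ := ih u.length (by simp) u (hS _ hx) hwu hu hu' rfl
        obtain ⟨e', he', h1', h2', z', hz', h3'⟩ := ih v.length (by simp; omega) v (hS _ hy) hwv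
          (by omega) (by omega) rfl
        obtain ⟨f, hf, k1, k2, k3, k4⟩ := hD.lift _ hx rfl e he h1 _ hy ⟨rfl, h2.symm⟩
        have k5 : Within (q * z) f.2.2 := by
          refine ⟨fun l hl => ?_, fun l hl => ?_⟩
          · obtain ⟨a, ha, hab⟩ := k3 l hl
            nlinarith [h3.1 a ha]
          · obtain ⟨a, ha, hab⟩ := k4 l hl
            nlinarith [h3.2 a ha]
        obtain ⟨e'', he'', h1'', h2'', h3''⟩ :=
          hD.exists_comp hf k1 k2 he' h1' h2' k5 h3'
        refine ⟨e'', he'', h1'', ?_, _, ?_, h3''⟩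
        · rw [h2'']; simp [Walk.fin, Walk.fin_append]
        · simp only [Walk.val, Mv.val, Mv.lev, Walk.val_append, hu, hz, hz']
          have := BS.natCast_ne_zero q
          push_cast
          rw [zpow_neg, zpow_one, zpow_zero]
          field_simp
          ring

end BoundTable

/-! ### Thin walks -/

/-- Among `n ≥ z` integers there are some whose sum is divisible by `z`. -/
theorem List.exists_dvd_sum {z : ℤ} (hz : z ≠ 0) (l : List ℤ) (hl : z.natAbs ≤ l.length) :
    ∃ a b c, l = a ++ (b ++ c) ∧ b ≠ [] ∧ z ∣ b.sum := by
  have : NeZero z.natAbs := ⟨by simpa using hz⟩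
  -- Pigeonhole on the prefix sums of length `0, …, |z|` modulo `z`: the block between two congruent
  -- prefixes has a sum divisible by `z`.
  obtain ⟨i, j, hij, h⟩ := Fintype.exists_ne_map_eq_of_card_lt
    (fun i : Fin (z.natAbs + 1) => (((l.take i).sum : ℤ) : ZMod z.natAbs)) (by simp [ZMod.card])
  wlog hlt : i < j generalizing i j
  · exact this j i hij.symm h.symm (lt_of_le_of_ne (not_lt.1 hlt) hij.symm)
  have hlt' : (i : ℕ) < j := hlt
  have hj := j.2
  refine ⟨l.take i, (l.drop i).take (j - i), (l.drop i).drop (j - i), by simp, ?_, ?_⟩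
  · intro h0
    have := congrArg List.length h0
    simp at this
    omega
  · have hsum : (l.take j).sum = (l.take i).sum + ((l.drop i).take (j - i)).sum := by
      rw [← List.sum_append, ← List.take_add]
      congr 2
      omega
    simp only [hsum, Int.cast_add] at h
    have h' : (((l.drop i).take (j - i)).sum : ZMod z.natAbs) = 0 := by
      simpa using h
    rw [ZMod.intCast_zmod_eq_zero_iff_dvd] at h'
    simpa using h'

/-- If `v < 0`, the term with index `x - l + 1` is already below `l`. -/
theorem nonneg_of_forall_le_add_mul {l x v : ℤ} (h : ∀ n : ℕ, l ≤ x + n * v) : 0 ≤ v := by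
  by_contra hv
  have := h (x - l + 1).toNat
  have h0 := h 0
  rw [Int.toNat_of_nonneg (by simp at h0; omega)] at this
  simp at h0
  nlinarith

/-! ### Trading cycles for auxiliary loops -/

namespace Walk

variable {E : List (ℕ × Gen × ℕ)} {G : List (ℕ × ℤ)} {S : List ℕ} {D : BoundTable} {q K : ℕ}

theorem fin_mem (hS : ∀ e ∈ E, e.2.2 ∈ S) {p : ℕ} (hp : p ∈ S) (w : Walk) (hw : Valid E G p w) :
    fin p w ∈ S := by
  induction w generalizing p with
  | nil => exact hp
  | cons x w ih =>
    obtain ⟨x, s⟩ := x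
    refine ih ?_ hw.2
    cases x with
    | up => exact hS _ hw.1
    | down => exact hS _ hw.1
    | add z => obtain ⟨⟨b, _, h⟩, _⟩ := hw; exact hS _ h
    | att z => obtain ⟨⟨rfl, h⟩, _⟩ := hw; exact hp

theorem cycle_replicate_att {b : ℕ} {z : ℤ} (h : (b, z) ∈ G) (n : ℕ) :
    Cycle E G b (List.replicate n (.att z, b)) := by
  induction n with
  | zero => exact .nil
  | succ n ih =>
    rw [List.replicate_succ']
    exact ih.append ⟨⟨⟨rfl, h⟩, trivial⟩, rfl, by simp [lev, Mv.lev]⟩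

theorem val_replicate_att {b : ℕ} {z : ℤ} (n : ℕ) :
    val q (List.replicate n (.att z, b)) = n * z := by
  induction n with
  | zero => simp [val]
  | succ n ih => simp [List.replicate_succ, val, ih, Mv.lev, Mv.val]; ring

theorem size_replicate_att {b : ℕ} {z : ℤ} (n : ℕ) :
    size (List.replicate n (.att z, b)) = 0 := by
  induction n with
  | zero => simp [size]
  | succ n ih => simp [List.replicate_succ, size, ih, Mv.size]

/-- Some of at least `K` cycles can be replaced by auxiliary loops at the bottom of a deeper cycle
`u ++ v`. -/
theorem exists_replacement [q.AtLeastTwo] (hD : D.Closed q E G S) (hG : D.Suffices G K)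
    (hK : 1 ≤ K) (hS : ∀ e ∈ E, e.2.2 ∈ S) {s : ℕ} (hs : s ∈ S) {u v : Walk}
    (huv : Cycle E G s (u ++ v)) (hu : lev u = minLev (u ++ v)) {cs : List Walk}
    (hcs : ∀ c ∈ cs, Cycle E G s c) (hmin : ∀ c ∈ cs, lev u ≤ minLev c) (hlen : K ≤ cs.length) :
    ∃ as bs ds w, cs = as ++ (bs ++ ds) ∧ bs ≠ [] ∧ Cycle E G (fin s u) w ∧ size w = 0 ∧
      (q : ℚ) ^ lev u * val q w = (bs.map (val q)).sum := by
  have hq := BS.natCast_ne_zero q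
  set β := fin s u with hβ
  have hvu := valid_append.1 huv.valid
  have hβS : β ∈ S := fin_mem hS hs _ hvu.1
  have hfv : fin β v = s := by rw [hβ, ← fin_append, huv.fin]
  have hlv : lev v = -lev u := by have := huv.lev; rw [lev_append] at this; omega
  have hmu : lev u ≤ minLev u := by rw [hu, minLev_append]; omega
  have hmv : 0 ≤ minLev v := by have := hu; rw [minLev_append] at this; omega
  -- the closed walks at the bottom that traverse a cycle at `s`
  have conj : ∀ c, Cycle E G s c → lev u ≤ minLev c → ∃ e ∈ D, e.1 = β ∧ e.2.1 = β ∧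
      ∃ z : ℤ, val q v + (q : ℚ) ^ (-lev u) * (val q c + val q u) = z ∧ Within z e.2.2 := by
    intro c hc hmc
    obtain ⟨e, he, h1, h2, z, hz, h3⟩ := hD.within hS (v ++ (c ++ u)) hβS
      (valid_append.2 ⟨hvu.2, by
        rw [hfv]; exact valid_append.2 ⟨hc.valid, by rw [hc.fin]; exact hvu.1⟩⟩)
      (by rw [lev_append, lev_append, hc.lev]; omega)
      (by rw [minLev_append, minLev_append, hc.lev]; omega)
    rw [fin_append, fin_append, hfv, hc.fin] at h2
    refine ⟨e, he, h1, h2, z, ?_, h3⟩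
    rw [← hz, val_append, val_append, hc.lev, hlv]
    simp
  -- The closed walk `v ++ u` at the bottom has value `x`; inserting a cycle `c` changes this by the
  -- value `z` of `c` in units of the bottom level, which is therefore an integer.
  obtain ⟨e, he, he1, he2, x, hx, hxe⟩ := conj [] .nil
    (by rw [hu]; exact minLev_nonpos _)
  have conj' : ∀ c, Cycle E G s c → lev u ≤ minLev c → ∃ z : ℤ,
      (q : ℚ) ^ (-lev u) * val q c = z ∧ Within (x + z) e.2.2 := by
    intro c hc hmc
    obtain ⟨e', he', h1, h2, z, hz, h3⟩ := conj c hc hmc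
    -- The table has a single entry for the pair `(β, β)`, so all these closed walks obey the same
    -- bounds.
    obtain rfl := hD.unique e he e' he' ⟨he1.trans h1.symm, he2.trans h2.symm⟩
    refine ⟨z - x, ?_, by simpa using h3⟩
    push_cast
    rw [← hz, ← hx]
    simp [val]
    ring
  have key : ∀ c ∈ cs, ∃ z : ℤ, (q : ℚ) ^ (-lev u) * val q c = z ∧
      (e.2.2.1 ≠ [] → 0 ≤ z) ∧ (e.2.2.2 ≠ [] → z ≤ 0) := by
    intro c hc
    obtain ⟨z, hz, -⟩ := conj' c (hcs c hc) (hmin c hc)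
    -- Repeating `c` makes the bounds hold along the whole progression `x + n * z`, so a lower bound
    -- forces `0 ≤ z` and an upper bound forces `z ≤ 0`.
    have hn : ∀ n : ℕ, Within (x + n * z) e.2.2 := by
      intro n
      have hrep : ∀ c' ∈ List.replicate n c, c' = c := fun c' h => List.eq_of_mem_replicate h
      have hrep' : ∀ c' ∈ List.replicate n c, Cycle E G s c' := fun c' h => by
        rw [hrep c' h]; exact hcs c hc
      obtain ⟨z', hz', hw⟩ := conj' (List.replicate n c).flatten (Cycle.flatten hrep')
        (Cycle.le_minLev_flatten (by rw [hu]; exact minLev_nonpos _) hrep' fun c' h => by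
          rw [hrep c' h]; exact hmin c hc)
      have : z' = n * z := by
        have : (z' : ℚ) = n * z := by
          rw [← hz', ← hz, Cycle.val_flatten hrep']
          simp
          ring
        exact_mod_cast this
      rwa [this] at hw
    refine ⟨z, hz, fun h => ?_, fun h => ?_⟩
    · obtain ⟨l, hl⟩ := List.exists_mem_of_ne_nil _ h
      exact nonneg_of_forall_le_add_mul fun n => (hn n).1 l hl
    · obtain ⟨l, hl⟩ := List.exists_mem_of_ne_nil _ h
      have : 0 ≤ -z := nonneg_of_forall_le_add_mul (l := -l) (x := -x) fun n => by
        linarith [(hn n).2 l hl]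
      omega
  choose! V hV hVlo hVhi using key
  have val_of : ∀ bs : List Walk, (∀ c ∈ bs, c ∈ cs) →
      (q : ℚ) ^ lev u * ((bs.map V).sum : ℤ) = (bs.map (val q)).sum := by
    intro bs hbs
    induction bs with
    | nil => simp
    | cons c bs ih =>
      rw [List.map_cons, List.sum_cons, List.map_cons, List.sum_cons, Int.cast_add, mul_add,
        ih fun c' hc' => hbs c' (by simp [hc']), ← hV c (hbs c (by simp)), ← mul_assoc,
        ← zpow_add₀ hq]
      simp
  rcases hG e he (he1.trans he2.symm) with ⟨hlo, hhi⟩ | ⟨⟨b, z⟩, hg, hgb, hz, hzK, hsign⟩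
  -- With bounds on both sides every cycle has value zero, and the first one is dropped without
  -- replacement.
  · rcases cs with _ | ⟨c, cs⟩
    · simp at hlen; omega
    · refine ⟨[], [c], cs, [], rfl, by simp, .nil, rfl, ?_⟩
      rw [← val_of [c] (by simp)]
      have h1 := hVlo c (by simp) hlo
      have h2 := hVhi c (by simp) hhi
      simp [val, le_antisymm h2 h1]
  · simp only at hgb hz hzK hsign
    rw [he1] at hgb hsign
    subst hgb
    obtain ⟨as', bs', ds', hsplit, hne, n, hn⟩ := List.exists_dvd_sum hz (cs.map V) (by simp; omega)
    obtain ⟨as, r, rfl, rfl, hr⟩ := List.map_eq_append_iff.1 hsplit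
    obtain ⟨bs, ds, rfl, rfl, rfl⟩ := List.map_eq_append_iff.1 hr
    have hsub : ∀ c ∈ bs, c ∈ as ++ (bs ++ ds) := fun c hc => by simp [hc]
    have fin' : ∀ z' : ℤ, (β, z') ∈ G → ∀ n' : ℕ, (bs.map V).sum = n' * z' →
        ∃ as₁ bs₁ ds₁ w, as ++ (bs ++ ds) = as₁ ++ (bs₁ ++ ds₁) ∧ bs₁ ≠ [] ∧ Cycle E G β w ∧
          size w = 0 ∧ (q : ℚ) ^ lev u * val q w = (bs₁.map (val q)).sum := by
      intro z' hz' n' hn'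
      refine ⟨as, bs, ds, List.replicate n' (.att z', β), rfl, by simpa using hne,
        cycle_replicate_att hz' n', size_replicate_att n', ?_⟩
      rw [← val_of bs hsub, hn', val_replicate_att]
      push_cast
      ring
    -- The quotient `n` has to be a number of loops. It is nonnegative if the cycle values have the
    -- sign of `z`; otherwise `-z` is a loop as well and serves for negative `n`.
    rcases hsign with ⟨hlo, hpos⟩ | ⟨hhi, hneg⟩ | hboth
    · have : 0 ≤ (bs.map V).sum := List.sum_nonneg fun v hv => by
        obtain ⟨c, hc, rfl⟩ := List.mem_map.1 hv
        exact hVlo c (hsub c hc) hlo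
      have hn0 : 0 ≤ n := by by_contra hcon; nlinarith
      obtain ⟨m, rfl⟩ := Int.eq_ofNat_of_zero_le hn0
      exact fin' z hg m (by rw [hn]; ring)
    · have : 0 ≤ ((bs.map V).map Neg.neg).sum := List.sum_nonneg fun v hv => by
        simp only [List.map_map, List.mem_map, Function.comp] at hv
        obtain ⟨c, hc, rfl⟩ := hv
        have := hVhi c (hsub c hc) hhi
        omega
      rw [← List.sum_neg] at this
      have hn0 : 0 ≤ n := by by_contra hcon; nlinarith
      obtain ⟨m, rfl⟩ := Int.eq_ofNat_of_zero_le hn0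
      exact fin' z hg m (by rw [hn]; ring)
    · rcases le_total 0 n with hn0 | hn0
      · obtain ⟨m, rfl⟩ := Int.eq_ofNat_of_zero_le hn0
        exact fin' z hg m (by rw [hn]; ring)
      · obtain ⟨m, hm⟩ := Int.eq_ofNat_of_zero_le (neg_nonneg.2 hn0)
        exact fin' (-z) hboth m (by rw [hn, ← hm]; ring)

/-- A walk that leaves some vertex more than `K + 1` times can be shortened. -/
theorem exists_size_lt [q.AtLeastTwo] (hD : D.Closed q E G S) (hG : D.Suffices G K)
    (hK : 1 ≤ K) (hS : ∀ e ∈ E, e.2.2 ∈ S) {p : ℕ} (hp : p ∈ S) {w : Walk} (hw : Valid E G p w)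
    {s : ℕ} {j ℓ : ℤ} (h : K + 2 ≤ leaves s j ℓ p w) :
    ∃ w', Valid E G p w' ∧ fin p w' = fin p w ∧ lev w' = lev w ∧ val q w' = val q w ∧
      size w' < size w := by
  -- One of the `K + 1` cycles, the deepest, is kept to give access to its bottom; `K` cycles remain
  -- as candidates for the replacement.
  obtain ⟨w₀, cs, w₁, rfl, h1, -, hlen, hcs⟩ := exists_cycles (K + 1) w hw h
  have hne : cs ≠ [] := by rintro rfl; simp at hlen
  obtain ⟨c, hc, hmin⟩ := Set.exists_min_image {c | c ∈ cs} minLev cs.finite_toSet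
    (List.exists_mem_of_ne_nil cs hne)
  obtain ⟨cs', hperm⟩ : ∃ cs', cs.Perm (c :: cs') := by
    classical exact ⟨cs.erase c, List.perm_cons_erase hc⟩
  obtain ⟨u, v, rfl, hu⟩ := exists_split_minLev c
  have hcyc : ∀ c' ∈ cs', Cycle E G s c' ∧ 0 < size c' := fun c' hc' =>
    hcs c' (hperm.symm.subset (by simp [hc']))
  have hw' := valid_append.1 hw
  have hs : s ∈ S := h1 ▸ fin_mem hS hp _ hw'.1
  have huv := (hcs _ hc).1
  have hlen' : K ≤ cs'.length := by have := hperm.length_eq; simp at this; omega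
  obtain ⟨as, bs, ds, r, rfl, hbs, hr, hr0, hval⟩ := exists_replacement hD hG hK hS hs huv hu
    (fun c' hc' => (hcyc c' hc').1)
    (fun c' hc' => hu ▸ hmin c' (hperm.symm.subset (by simp [hc']))) hlen'
  have hcF : Cycle E G s cs.flatten := Cycle.flatten fun c hc => (hcs c hc).1
  have hads : ∀ c ∈ as ++ ds, Cycle E G s c := fun c hc => (hcyc c (by
    rcases List.mem_append.1 hc with h | h <;> simp [h])).1
  have hcA : Cycle E G s (as ++ ds).flatten := Cycle.flatten hads
  have hcU : Cycle E G s (u ++ (r ++ v)) := by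
    have h2 := valid_append.1 huv.valid
    refine ⟨valid_append.2 ⟨h2.1, valid_append.2 ⟨hr.valid, by rw [hr.fin]; exact h2.2⟩⟩, ?_, ?_⟩
    · rw [fin_append, fin_append, hr.fin, ← fin_append, huv.fin]
    · have := huv.lev
      rw [lev_append] at this
      rw [lev_append, lev_append, hr.lev]
      omega
  have hcN := hcU.append hcA
  subst h1
  rw [fin_append, fin_append, hcF.fin, lev_append, lev_append, hcF.lev, val_append,
    hcF.val_append, size_append, size_append]
  -- Cycles at a vertex may be reordered without changing the value. The deepest one goes first,
  -- with the loops `r` inserted at its bottom, followed by the cycles that are not replaced; the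
  -- block `bs`, which contains automaton edges, is gone.
  refine ⟨w₀ ++ (((u ++ (r ++ v)) ++ (as ++ ds).flatten) ++ w₁), ?_, ?_, ?_, ?_, ?_⟩
  · refine valid_append.2 ⟨hw'.1, valid_append.2 ⟨hcN.valid, ?_⟩⟩
    have := (valid_append.1 hw'.2).2
    rw [hcF.fin] at this
    rwa [hcN.fin]
  · rw [fin_append, fin_append, hcN.fin]
  · rw [lev_append, lev_append, hcN.lev]
  · rw [val_append, hcN.val_append, hcU.val_append, Cycle.val_flatten hads,
      Cycle.val_flatten fun c hc => (hcs c hc).1, (hperm.map (val q)).sum_eq, val_append,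
      hr.val_append, mul_add ((q : ℚ) ^ lev u), hval]
    simp only [List.map_cons, List.map_append, List.sum_cons, List.sum_append, val_append]
    ring
  · rw [size_append, size_append, size_append, size_append, size_append, hr0, size_flatten,
      size_flatten, (hperm.map size).sum_eq]
    simp only [List.map_cons, List.map_append, List.sum_cons, List.sum_append, size_append]
    rcases bs with _ | ⟨b, bs⟩
    · exact absurd rfl hbs
    · have := (hcyc b (by simp)).2
      simp only [List.map_cons, List.sum_cons]
      omega

/-- Each walk has the same effect as one that leaves each vertex at most `K + 1` times. -/
theorem exists_thin [q.AtLeastTwo] (hD : D.Closed q E G S) (hG : D.Suffices G K)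
    (hK : 1 ≤ K) (hS : ∀ e ∈ E, e.2.2 ∈ S) {p : ℕ} (hp : p ∈ S) (ℓ : ℤ) (w : Walk)
    (hw : Valid E G p w) :
    ∃ w', Valid E G p w' ∧ fin p w' = fin p w ∧ lev w' = lev w ∧ val q w' = val q w ∧
      ∀ s j, leaves s j ℓ p w' ≤ K + 1 := by
  induction hn : size w using Nat.strong_induction_on generalizing w with
  | _ n ih =>
    subst hn
    by_cases h : ∀ s j, leaves s j ℓ p w ≤ K + 1
    · exact ⟨w, hw, rfl, rfl, rfl, h⟩
    · push Not at h
      obtain ⟨s, j, h⟩ := h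
      obtain ⟨w', h1, h2, h3, h4, h5⟩ := exists_size_lt hD hG hK hS hp hw h
      obtain ⟨w'', k1, k2, k3, k4, k5⟩ := ih _ h5 w' h1 rfl
      exact ⟨w'', k1, k2.trans h2, k3.trans h3, k4.trans h4, k5⟩

end Walk

/-! ### A machine that sweeps over the levels -/

/-- A segment of a run above the current level, given by its first and its last state. `none`
stands for the beginning and for the end of the whole run. -/
abbrev Item : Type := Option ℕ × Option ℕ

/-- A configuration of the sweep: the segments above the current level, the segments that have yet
to be continued from the level above, the states that have yet to be visited, and the carry. -/
abbrev Core : Type := List Item × List Item × List ℕ × ℤ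

/-- The states of an automaton. -/
def BSAutomaton.states (A : BSAutomaton) : List ℕ :=
  A.2.1 :: A.2.2 :: A.1.flatMap fun e => [e.1, e.2.2]

theorem BSAutomaton.mem_states {A : BSAutomaton} {e : ℕ × Gen × ℕ} (he : e ∈ A.1) :
    e.1 ∈ A.states ∧ e.2.2 ∈ A.states := by
  refine ⟨?_, ?_⟩ <;>
  · refine List.mem_cons_of_mem _ (List.mem_cons_of_mem _ (List.mem_flatMap.2 ⟨e, he, ?_⟩))
    simp

theorem BSAutomaton.initial_mem_states (A : BSAutomaton) : A.2.1 ∈ A.states := by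
  simp [BSAutomaton.states]

namespace Core

/-- The states below `x` from which an edge goes up to `x`. -/
def lefts (A : BSAutomaton) (x : Option ℕ) : List (Option ℕ) :=
  if x = none then [none] else
    A.1.flatMap fun e => if e.2.1 = (true, false) ∧ x = some e.2.2 then [some e.1] else []

/-- The states below `y` to which an edge goes down from `y`. -/
def rights (A : BSAutomaton) (y : Option ℕ) : List (Option ℕ) :=
  if y = none then [none] else
    A.1.flatMap fun e => if e.2.1 = (true, true) ∧ y = some e.1 then [some e.2.2] else []

theorem mem_lefts_some {A : BSAutomaton} {p : ℕ} {x : Option ℕ} :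
    x ∈ lefts A (some p) ↔ ∃ u, x = some u ∧ (u, (true, false), p) ∈ A.1 := by
  simp only [lefts, reduceCtorEq, if_false, List.mem_flatMap, Option.some.injEq]
  constructor
  · rintro ⟨⟨u, g, v⟩, he, h⟩
    split_ifs at h with h'
    · obtain ⟨rfl, rfl⟩ := h'
      exact ⟨u, by simpa using h, he⟩
    · simp at h
  · rintro ⟨u, rfl, he⟩
    exact ⟨_, he, by simp⟩

theorem mem_lefts_none {A : BSAutomaton} {x : Option ℕ} : x ∈ lefts A none ↔ x = none := by
  simp [lefts]

theorem mem_rights_some {A : BSAutomaton} {p : ℕ} {x : Option ℕ} :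
    x ∈ rights A (some p) ↔ ∃ u, x = some u ∧ (p, (true, true), u) ∈ A.1 := by
  simp only [rights, reduceCtorEq, if_false, List.mem_flatMap, Option.some.injEq]
  constructor
  · rintro ⟨⟨u, g, v⟩, he, h⟩
    split_ifs at h with h'
    · obtain ⟨rfl, rfl⟩ := h'
      exact ⟨v, by simpa using h, he⟩
    · simp at h
  · rintro ⟨u, rfl, he⟩
    exact ⟨_, he, by simp⟩

theorem mem_rights_none {A : BSAutomaton} {x : Option ℕ} : x ∈ rights A none ↔ x = none := by
  simp [rights]

/-- The steps of the sweep at one level. `R` and `C` tell whether this is the level of the radix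
point and the level of the cursor. -/
inductive Step (A : BSAutomaton) (G : List (ℕ × ℤ)) (R C : Bool) : Core → Core → Prop
  | rot (h : Item) (t T : List Item) (P : List ℕ) (c : ℤ) :
      Step A G R C (h :: t, T, P, c) (t ++ [h], T, P, c)
  | new (p : ℕ) (hp : p ∈ A.states) (t T : List Item) (P : List ℕ) (c : ℤ) :
      Step A G R C (t, T, P, c) ((some p, some p) :: t, T, P, c)
  | newEnd (hC : C = true) (t T : List Item) (P : List ℕ) (c : ℤ) :
      Step A G R C (t, T, P, c) ((some A.2.2, none) :: t, T, P, c)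
  | start (hR : R = true) (y : Option ℕ) (t T : List Item) (P : List ℕ) (c : ℤ) :
      Step A G R C ((some A.2.1, y) :: t, T, P, c) ((none, y) :: t, T, P, c)
  | ext {p p' : ℕ} {b : Bool} (he : (p, (false, b), p') ∈ A.1) (y : Option ℕ) (t T : List Item)
      (P : List ℕ) (c : ℤ) :
      Step A G R C ((some p', y) :: t, T, P, c) ((some p, y) :: t, T, P, c + sgn b)
  | join (x : Option ℕ) (u : ℕ) (y : Option ℕ) (t T : List Item) (P : List ℕ) (c : ℤ) :
      Step A G R C ((x, some u) :: (some u, y) :: t, T, P, c) ((x, y) :: t, T, P, c)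
  | on (b : ℕ) (hb : b ∈ A.states) (t T : List Item) (P : List ℕ) (c : ℤ) :
      Step A G R C (t, T, P, c) (t, T, b :: P, c)
  | off (b : ℕ) (y : Option ℕ) (t T : List Item) (P : List ℕ) (c : ℤ) :
      Step A G R C ((some b, y) :: t, T, P, c) ((some b, y) :: t, T, P.filter (· ≠ b), c)
  | gadd {b : ℕ} {z : ℤ} (hg : (b, z) ∈ G) (t T : List Item) (P : List ℕ) (hb : b ∈ P) (c : ℤ) :
      Step A G R C (t, T, P, c) (t, T, P, c + z)
  | low {x x' y y' : Option ℕ} (hx : x' ∈ lefts A x) (hy : y' ∈ rights A y) (t T : List Item)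
      (P : List ℕ) (c : ℤ) :
      Step A G R C (t, (x, y) :: T, P, c) (t ++ [(x', y')], T, P, c)

/-- The configurations that are reached by one step of the sweep. -/
def micro (A : BSAutomaton) (G : List (ℕ × ℤ)) (R C : Bool) (κ : Core) : List Core :=
  (κ.1.head?.toList.map fun h => (κ.1.tail ++ [h], κ.2)) ++
  (A.states.map fun p => ((some p, some p) :: κ.1, κ.2)) ++
  (if C = true then [((some A.2.2, none) :: κ.1, κ.2)] else []) ++
  (κ.1.head?.toList.flatMap fun h =>
    if R = true ∧ h.1 = some A.2.1 then [((none, h.2) :: κ.1.tail, κ.2)] else []) ++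
  (κ.1.head?.toList.flatMap fun h => A.1.flatMap fun e =>
    if e.2.1.1 = false ∧ h.1 = some e.2.2 then
      [((some e.1, h.2) :: κ.1.tail, κ.2.1, κ.2.2.1, κ.2.2.2 + sgn e.2.1.2)] else []) ++
  (κ.1.head?.toList.flatMap fun h => κ.1.tail.head?.toList.flatMap fun h' =>
    if h.2 = h'.1 ∧ h.2 ≠ none then [((h.1, h'.2) :: κ.1.tail.tail, κ.2)] else []) ++
  (A.states.map fun b => (κ.1, κ.2.1, b :: κ.2.2.1, κ.2.2.2)) ++
  (κ.1.head?.toList.flatMap fun h => h.1.toList.map fun b =>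
    (κ.1, κ.2.1, κ.2.2.1.filter (· ≠ b), κ.2.2.2)) ++
  (G.flatMap fun g =>
    if g.1 ∈ κ.2.2.1 then [(κ.1, κ.2.1, κ.2.2.1, κ.2.2.2 + g.2)] else []) ++
  (κ.2.1.head?.toList.flatMap fun h => (lefts A h.1).flatMap fun x => (rights A h.2).map fun y =>
    (κ.1 ++ [(x, y)], κ.2.1.tail, κ.2.2))

theorem mem_micro {A : BSAutomaton} {G : List (ℕ × ℤ)} {R C : Bool} {κ κ' : Core} :
    κ' ∈ micro A G R C κ ↔ Step A G R C κ κ' := by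
  obtain ⟨l, T, P, c⟩ := κ
  constructor
  · intro h
    simp only [micro, List.mem_append, or_assoc] at h
    rcases h with h | h | h | h | h | h | h | h | h | h
    · rcases l with _ | ⟨i, l⟩
      · simp at h
      · simp at h; subst h; exact .rot ..
    · obtain ⟨p, hp, rfl⟩ := List.mem_map.1 h
      exact .new _ hp ..
    · split_ifs at h with hC
      · simp at h; subst h; exact .newEnd hC ..
      · simp at h
    · rcases l with _ | ⟨⟨x, y⟩, l⟩
      · simp at h
      · simp only [List.head?_cons, Option.toList_some, List.flatMap_cons, List.flatMap_nil,
          List.append_nil] at h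
        split_ifs at h with hR
        · obtain ⟨hR, rfl⟩ := hR
          simp at h; subst h; exact .start hR ..
        · simp at h
    · rcases l with _ | ⟨⟨x, y⟩, l⟩
      · simp at h
      · simp only [List.head?_cons, Option.toList_some, List.flatMap_cons, List.flatMap_nil,
          List.append_nil, List.mem_flatMap] at h
        obtain ⟨⟨p, ⟨g, b⟩, p'⟩, he, h⟩ := h
        split_ifs at h with hR
        · obtain ⟨hR, rfl⟩ := hR
          simp only at hR
          subst hR
          simp at h; subst h; exact .ext he ..
        · simp at h
    · rcases l with _ | ⟨⟨x, y⟩, _ | ⟨⟨x', y'⟩, l⟩⟩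
      · simp at h
      · simp at h
      · simp only [List.head?_cons, Option.toList_some, List.flatMap_cons, List.flatMap_nil,
          List.append_nil, List.tail_cons] at h
        split_ifs at h with hR
        · obtain ⟨rfl, hR⟩ := hR
          obtain ⟨u, rfl⟩ := Option.ne_none_iff_exists'.1 hR
          simp at h; subst h; exact .join ..
        · simp at h
    · obtain ⟨p, hp, rfl⟩ := List.mem_map.1 h
      exact .on _ hp ..
    · rcases l with _ | ⟨⟨_ | b, y⟩, l⟩
      · simp at h
      · simp at h
      · simp only [List.head?_cons, Option.toList_some, List.flatMap_cons, List.flatMap_nil,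
          List.append_nil, List.map_cons, List.map_nil, List.mem_singleton] at h
        subst h
        exact .off ..
    · obtain ⟨⟨b, z⟩, hg, h⟩ := List.mem_flatMap.1 h
      split_ifs at h with hb
      · simp at h; subst h; exact .gadd hg _ _ _ hb _
      · simp at h
    · rcases T with _ | ⟨⟨x, y⟩, T⟩
      · simp at h
      · simp only [List.head?_cons, Option.toList_some, List.flatMap_cons, List.flatMap_nil,
          List.append_nil, List.mem_flatMap, List.mem_map] at h
        obtain ⟨x', hx, y', hy, rfl⟩ := h
        exact .low hx hy ..
  · intro h
    simp only [micro, List.mem_append, or_assoc]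
    cases h with
    | rot => left; simp
    | new p hp => right; left; exact List.mem_map.2 ⟨p, hp, rfl⟩
    | newEnd hC => right; right; left; simp [hC]
    | start hR => right; right; right; left; simp [hR]
    | @ext p p' b he =>
      right; right; right; right; left
      simp only [List.head?_cons, Option.toList_some, List.flatMap_cons, List.flatMap_nil,
          List.append_nil, List.mem_flatMap]
      exact ⟨_, he, by simp⟩
    | join => right; right; right; right; right; left; simp
    | on b hb =>
      right; right; right; right; right; right; left
      exact List.mem_map.2 ⟨b, hb, rfl⟩
    | off => right; right; right; right; right; right; right; left; simp
    | gadd hg _ _ _ hb =>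
      right; right; right; right; right; right; right; right; left
      exact List.mem_flatMap.2 ⟨_, hg, by simp [hb]⟩
    | low hx hy =>
      right; right; right; right; right; right; right; right; right
      simp only [List.head?_cons, Option.toList_some, List.flatMap_cons, List.flatMap_nil,
          List.append_nil, List.mem_flatMap, List.mem_map]
      exact ⟨_, hx, _, hy, rfl⟩

/-- The passage to the next level, where the signed digit is `d`. -/
def level (q : ℕ) (d : ℤ) (κ : Core) : List Core :=
  if κ.2.1 = [] then [([], κ.1, κ.2.2.1, q * κ.2.2.2 - d)] else []

end Core

/-! ### Soundness of the sweep -/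

/-- There is a run from `p` at level `i` to `p'` at level `i'` that adds `Z`. -/
def AbsPath (q : ℕ) [q.AtLeastTwo] (E : List (ℕ × Gen × ℕ)) (p : ℕ) (i : ℤ) (Z : ℚ) (p' : ℕ)
    (i' : ℤ) : Prop :=
  ∃ w, IsRun {e | e ∈ E} p w p' ∧ (q : ℚ) ^ i * ((w.map (Gen.toBS q)).prod).r = Z ∧
    i + ((w.map (Gen.toBS q)).prod).m = i'

namespace AbsPath

variable {q : ℕ} [q.AtLeastTwo] {E : List (ℕ × Gen × ℕ)} {p p' p'' : ℕ} {i i' i'' : ℤ} {Z Z' : ℚ}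

theorem refl (p : ℕ) (i : ℤ) : AbsPath q E p i 0 p i := ⟨[], .nil p, by simp, by simp⟩

theorem trans (h : AbsPath q E p i Z p' i') (h' : AbsPath q E p' i' Z' p'' i'') :
    AbsPath q E p i (Z + Z') p'' i'' := by
  obtain ⟨w, hw, rfl, rfl⟩ := h
  obtain ⟨w', hw', rfl, rfl⟩ := h'
  refine ⟨w ++ w', hw.append hw', ?_, ?_⟩
  · rw [List.map_append, List.prod_append, BS.mul_r, zpow_add₀ (BS.natCast_ne_zero q)]
    ring
  · rw [List.map_append, List.prod_append, BS.mul_m]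
    ring

theorem edge {g : Gen} (h : (p, g, p') ∈ E) (i : ℤ) :
    AbsPath q E p i ((q : ℚ) ^ i * (Gen.toBS q g).r) p' (i + (Gen.toBS q g).m) :=
  ⟨[g], .cons h (.nil _), by simp, by simp⟩

theorem up (h : (p, (true, false), p') ∈ E) (i : ℤ) : AbsPath q E p i 0 p' (i + 1) := by
  simpa [Gen.toBS, BS.t] using edge (q := q) h i

theorem down (h : (p, (true, true), p') ∈ E) (i : ℤ) : AbsPath q E p (i + 1) 0 p' i := by
  simpa [Gen.toBS, BS.t] using edge (q := q) h (i + 1)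

theorem add {b : Bool} (h : (p, (false, b), p') ∈ E) (i : ℤ) :
    AbsPath q E p i (sgn b * (q : ℚ) ^ i) p' i := by
  cases b
  · simpa [Gen.toBS, BS.a, sgn] using edge (q := q) h i
  · simpa [Gen.toBS, BS.a, sgn] using edge (q := q) h i

theorem shift (h : AbsPath q E p i Z p' i') (k : ℤ) :
    AbsPath q E p (i + k) ((q : ℚ) ^ k * Z) p' (i' + k) := by
  obtain ⟨w, hw, rfl, rfl⟩ := h
  refine ⟨w, hw, ?_, by ring⟩
  rw [zpow_add₀ (BS.natCast_ne_zero q)]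
  ring

theorem nsmul (h : AbsPath q E p i Z p i) (n : ℕ) : AbsPath q E p i (n * Z) p i := by
  induction n with
  | zero => simpa using refl p i
  | succ n ih =>
    have := ih.trans h
    rwa [show (n : ℚ) * Z + Z = ((n + 1 : ℕ) : ℚ) * Z by push_cast; ring] at this

/-- Shifting the loop one level down divides its value by `q`, and `q` repetitions restore it. So
the loops promised at a pending state can be realized at any lower visit. -/
theorem loop_down (h : AbsPath q E p (i + 1) Z p (i + 1)) : AbsPath q E p i Z p i := by
  have h1 := (h.shift (-1)).nsmul q
  have hq := BS.natCast_ne_zero q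
  rw [zpow_neg, zpow_one, ← mul_assoc, mul_inv_cancel₀ hq, one_mul] at h1
  simpa using h1

end AbsPath

namespace Core

variable {q : ℕ} [q.AtLeastTwo] {A : BSAutomaton} {G : List (ℕ × ℤ)} {i m : ℤ}

/-- The number `Z` is added along a segment with the given ends, where the current level is `i` and
the last level of the whole run is `m`. -/
def ItemOk (q : ℕ) [q.AtLeastTwo] (A : BSAutomaton) (i m : ℤ) (x : Item) (Z : ℚ) : Prop :=
  AbsPath q A.1 (x.1.getD A.2.1) (if x.1 = none then 0 else i) Z
    (x.2.getD A.2.2) (if x.2 = none then m else i)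

/-- The number `T` is the sum of what is added along the segments of `κ` and along loops at the
states that have yet to be visited. -/
def Tot (q : ℕ) [q.AtLeastTwo] (A : BSAutomaton) (i m : ℤ) (κ : Core) (T : ℚ) : Prop :=
  ∃ (zs zt : List ℚ) (f : ℕ → ℚ), List.Forall₂ (ItemOk q A i m) κ.1 zs ∧
    List.Forall₂ (ItemOk q A (i + 1) m) κ.2.1 zt ∧ (∀ b ∈ κ.2.2.1, AbsPath q A.1 b i (f b) b i) ∧
    T = zs.sum + zt.sum + ∑ b ∈ κ.2.2.1.toFinset, f b

/-- A step either regroups segments at no cost or adds something at level `i`, and the carry records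
exactly the latter. Auxiliary loops at a pending state `b` are accumulated in one closed run of
value `f b`, which is put in front of a segment starting at `b` when `b` is crossed off. -/
theorem Tot.step (hG : ∀ g ∈ G, AbsPath q A.1 g.1 0 g.2 g.1 0) {R C : Bool}
    (hR : R = true → i = 0) (hC : C = true → i = m) {κ κ' : Core} {T : ℚ}
    (hT : Tot q A i m κ T) (h : Step A G R C κ κ') :
    Tot q A i m κ' (T + (κ'.2.2.2 - κ.2.2.2) * (q : ℚ) ^ i) := by
  obtain ⟨zs, zt, f, h1, h2, h3, rfl⟩ := hT
  cases h with
  | rot x t T P c =>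
    rcases h1 with _ | ⟨hx, ht⟩
    rename_i z zs
    refine ⟨zs ++ [z], zt, f, List.rel_append ht (.cons hx .nil), h2, h3, ?_⟩
    simp only [List.sum_cons, List.sum_append, List.sum_nil]
    ring
  | new p hp t T P c =>
    exact ⟨0 :: zs, zt, f, .cons (AbsPath.refl p i) h1, h2, h3, by simp⟩
  | newEnd hC' t T P c =>
    refine ⟨0 :: zs, zt, f, .cons ?_ h1, h2, h3, by simp⟩
    simpa [ItemOk, hC hC'] using AbsPath.refl A.2.2 m
  | start hR' y t T P c =>
    rcases h1 with _ | ⟨hx, ht⟩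
    rename_i z zs
    refine ⟨z :: zs, zt, f, .cons ?_ ht, h2, h3, by simp⟩
    simpa [ItemOk, hR hR'] using hx
  | @ext p p' b he y t T P c =>
    rcases h1 with _ | ⟨hx, ht⟩
    rename_i z zs
    refine ⟨(sgn b * (q : ℚ) ^ i + z) :: zs, zt, f, .cons ?_ ht, h2, h3, ?_⟩
    · simpa [ItemOk] using (AbsPath.add he i).trans hx
    · simp only [List.sum_cons]
      push_cast
      ring
  | join x u y t T P c =>
    rcases h1 with _ | ⟨hx, _ | ⟨hx', ht⟩⟩
    rename_i z z' zs
    refine ⟨(z + z') :: zs, zt, f, .cons ?_ ht, h2, h3, ?_⟩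
    · simp only [ItemOk, Option.getD_some, reduceCtorEq, if_false] at hx hx' ⊢
      exact hx.trans hx'
    · simp only [List.sum_cons]
      ring
  | on b hb t T P c =>
    -- A state that is listed twice counts once, because the sum runs over `toFinset`; a new one
    -- starts with the trivial loop.
    by_cases hbP : b ∈ P
    · refine ⟨zs, zt, f, h1, h2, ?_, ?_⟩
      · rintro b' hb'
        rcases List.mem_cons.1 hb' with rfl | hb'
        · exact h3 b' hbP
        · exact h3 b' hb'
      · simp [hbP]
    · refine ⟨zs, zt, fun b' => if b' = b then 0 else f b', h1, h2, ?_, ?_⟩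
      · intro b' hb'
        by_cases hbb : b' = b
        · simp only [hbb, if_true]
          exact AbsPath.refl b i
        · simp only [hbb, if_false]
          exact h3 b' (by simpa [hbb] using hb')
      · have : ∑ b' ∈ P.toFinset, (if b' = b then 0 else f b') = ∑ b' ∈ P.toFinset, f b' :=
          Finset.sum_congr rfl fun b' hb' => if_neg (by rintro rfl; exact hbP (by simpa using hb'))
        simp [Finset.sum_insert, hbP, this]
  | off b y t T P c =>
    by_cases hbP : b ∈ P
    · rcases h1 with _ | ⟨hx, ht⟩
      rename_i z zs
      refine ⟨(f b + z) :: zs, zt, f, .cons ?_ ht, h2, ?_, ?_⟩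
      · simp only [ItemOk, Option.getD_some, reduceCtorEq, if_false] at hx ⊢
        exact (h3 b hbP).trans hx
      · intro b' hb'
        exact h3 b' (List.mem_of_mem_filter hb')
      · have : (P.filter (· ≠ b)).toFinset = P.toFinset.erase b := by
          ext; simp [and_comm]
        simp only [this, sub_self, zero_mul, add_zero, List.sum_cons]
        rw [← Finset.add_sum_erase _ _ (List.mem_toFinset.2 hbP)]
        ring
    · have : P.filter (· ≠ b) = P := by
        rw [List.filter_eq_self]
        intro b' hb'
        simp
        rintro rfl
        exact hbP hb'
      exact ⟨zs, zt, f, h1, h2, by rw [this]; exact h3, by rw [this]; simp⟩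
  | @gadd b z hg t T P hb c =>
    refine ⟨zs, zt, Function.update f b (f b + z * (q : ℚ) ^ i), h1, h2, ?_, ?_⟩
    · intro b' hb'
      by_cases hbb : b' = b
      · subst hbb
        rw [Function.update_self]
        have := (hG _ hg).shift i
        rw [zero_add, mul_comm] at this
        exact (h3 b' hb).trans this
      · rw [Function.update_of_ne hbb]
        exact h3 b' hb'
    · simp only
      rw [Finset.sum_update_of_mem (List.mem_toFinset.2 hb), Finset.sdiff_singleton_eq_erase,
        ← Finset.add_sum_erase _ _ (List.mem_toFinset.2 hb)]
      push_cast
      ring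
  | @low x x' y y' hx hy t T P c =>
    rcases h2 with _ | ⟨hxy, ht⟩
    rename_i z zt
    refine ⟨zs ++ [z], zt, f, List.rel_append h1 (.cons ?_ .nil), ht, h3, ?_⟩
    · simp only [ItemOk] at hxy ⊢
      have hl : AbsPath q A.1 (x'.getD A.2.1) (if x' = none then 0 else i) 0 (x.getD A.2.1)
          (if x = none then 0 else i + 1) := by
        cases x with
        | none =>
          rw [mem_lefts_none] at hx
          subst hx
          exact AbsPath.refl _ _
        | some p =>
          obtain ⟨u, rfl, he⟩ := mem_lefts_some.1 hx
          exact AbsPath.up he i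
      have hr : AbsPath q A.1 (y.getD A.2.2) (if y = none then m else i + 1) 0 (y'.getD A.2.2)
          (if y' = none then m else i) := by
        cases y with
        | none =>
          rw [mem_rights_none] at hy
          subst hy
          exact AbsPath.refl _ _
        | some p =>
          obtain ⟨u, rfl, he⟩ := mem_rights_some.1 hy
          exact AbsPath.down he i
      simpa using (hl.trans hxy).trans hr
    · simp only [List.sum_cons, List.sum_append, List.sum_nil]
      ring

/-- The finished segments become the ones to be continued, which `Tot` already reads one level
higher, and the pending loops move down by `AbsPath.loop_down`. The total is unchanged; only the
unit of the carry changes. -/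
theorem Tot.level {d : ℤ} {κ κ' : Core} {T : ℚ} (hT : Tot q A (i + 1) m κ T)
    (h : κ' ∈ level q d κ) :
    Tot q A i m κ' T ∧ κ'.2.2.2 = q * κ.2.2.2 - d := by
  obtain ⟨l, l', P, c⟩ := κ
  simp only [Core.level] at h
  split_ifs at h with h0
  · simp only [List.mem_singleton] at h
    subst h h0
    obtain ⟨zs, zt, f, h1, h2, h3, rfl⟩ := hT
    rcases h2 with _ | _
    exact ⟨⟨[], zs, f, .nil, h1, fun b hb => (h3 b hb).loop_down, by simp⟩, rfl⟩
  · simp at h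

theorem tot_init (i m : ℤ) : Tot q A i m ([], [], [], 0) 0 :=
  ⟨[], [], fun _ => 0, .nil, .nil, by simp, by simp⟩

theorem Tot.final {T : ℚ} (hT : Tot q A i m ([(none, none)], [], [], 0) T) :
    AbsPath q A.1 A.2.1 0 T A.2.2 m := by
  obtain ⟨zs, zt, f, h1, h2, h3, rfl⟩ := hT
  rcases h1 with _ | ⟨hx, ht⟩
  rcases ht with _ | _
  rcases h2 with _ | _
  simpa [ItemOk] using hx

end Core

/-! ### Completeness of the sweep -/

namespace Walk

/-- The segments above level `i` of a walk from `(p, ℓ)`: if `ℓ ≥ i`, the last state of the first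
segment and the list of the other segments. -/
def sg (i : ℤ) : ℤ → ℕ → Walk → Option ℕ × List Item
  | _, _, [] => (none, [])
  | ℓ, p, x :: w =>
    let r := sg i (ℓ + x.1.lev) x.2 w
    if i ≤ ℓ then (if i ≤ ℓ + x.1.lev then r else (some p, r.2))
    else (if i ≤ ℓ + x.1.lev then (none, (some x.2, r.1) :: r.2) else (none, r.2))

/-- The segments above level `i + 1` of a walk from `(p, ℓ)`, together with the edges that connect
them to level `i`: if `ℓ > i`, the last state of the first segment and the list of the other
segments. -/
def lw (i : ℤ) : ℤ → ℕ → Walk → Option ℕ × List Item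
  | _, _, [] => (none, [])
  | ℓ, p, x :: w =>
    let r := lw i (ℓ + x.1.lev) x.2 w
    if i < ℓ then (if i < ℓ + x.1.lev then r else (some x.2, r.2))
    else (if i < ℓ + x.1.lev then (none, (some p, r.1) :: r.2) else (none, r.2))

/-- What is added at level `i` by a walk from level `ℓ`. -/
def adds (i : ℤ) : ℤ → Walk → ℤ
  | _, [] => 0
  | ℓ, x :: w => (if ℓ = i then x.1.val else 0) + adds i (ℓ + x.1.lev) w

/-- The number of visits to level `i` of a walk from level `ℓ`. -/
def cnt (i : ℤ) : ℤ → Walk → ℕ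
  | ℓ, [] => if ℓ = i then 1 else 0
  | ℓ, x :: w => (if ℓ = i then 1 else 0) + cnt i (ℓ + x.1.lev) w

/-- The vertices of a walk. -/
def verts : ℤ → ℕ → Walk → List (ℕ × ℤ)
  | ℓ, p, [] => [(p, ℓ)]
  | ℓ, p, x :: w => (p, ℓ) :: verts (ℓ + x.1.lev) x.2 w

/-- The segments of a walk above level `i`, where the first state of a walk that starts above level
`i` is given as `x`. -/
def sgList (i ℓ : ℤ) (p : ℕ) (w : Walk) (x : Option ℕ) : List Item :=
  if i < ℓ then (x, (sg i ℓ p w).1) :: (sg i ℓ p w).2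
  else if ℓ = i then (some p, (sg i ℓ p w).1) :: (sg i ℓ p w).2 else (sg i ℓ p w).2

/-- The segments of a walk above level `i + 1`, continued to level `i`. -/
def lwList (i ℓ : ℤ) (p : ℕ) (w : Walk) (x : Option ℕ) : List Item :=
  if i < ℓ then (x, (lw i ℓ p w).1) :: (lw i ℓ p w).2 else (lw i ℓ p w).2

theorem Mv.lev_cases (x : Mv) : x.lev = 1 ∨ x.lev = -1 ∨ x.lev = 0 := by
  cases x <;> simp [Mv.lev]

/-- Each listed segment is entered from below through a visit to level `i` of its own. A start at
level `i` is one more visit, because the first segment is not in the list. -/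
theorem length_sg (i ℓ : ℤ) (p : ℕ) (w : Walk) :
    (sg i ℓ p w).2.length + (if ℓ = i then 1 else 0) ≤ cnt i ℓ w := by
  induction w generalizing ℓ p with
  | nil => simp [sg, cnt]
  | cons x w ih =>
    have h := ih (ℓ + x.1.lev) x.2
    rcases Mv.lev_cases x.1 with hx | hx | hx <;> simp only [sg, cnt, hx] at h ⊢ <;>
      split_ifs at h ⊢ <;> (try simp only [List.length_cons]) <;> omega

/-- Each listed segment begins with an ascent from its own visit to level `i`. -/
theorem length_lw (i ℓ : ℤ) (p : ℕ) (w : Walk) : (lw i ℓ p w).2.length ≤ cnt i ℓ w := by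
  induction w generalizing ℓ p with
  | nil => simp [lw]
  | cons x w ih =>
    have h := ih (ℓ + x.1.lev) x.2
    rcases Mv.lev_cases x.1 with hx | hx | hx <;> simp only [lw, cnt, hx] at h ⊢ <;>
      split_ifs at h ⊢ <;> (try simp only [List.length_cons]) <;> omega

end Walk

namespace Core

open Walk

/-- All states in the item belong to `S`. -/
def Named (S : List ℕ) (x : Item) : Prop := (∀ p ∈ x.1, p ∈ S) ∧ ∀ p ∈ x.2, p ∈ S

/-- The configurations of bounded size. -/
structure Bdd (S : List ℕ) (M : ℕ) (κ : Core) : Prop where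
  length : κ.1.length ≤ M
  length' : κ.2.1.length ≤ M
  length'' : κ.2.2.1.length ≤ M
  named : ∀ x ∈ κ.1, Named S x
  named' : ∀ x ∈ κ.2.1, Named S x
  mem : ∀ b ∈ κ.2.2.1, b ∈ S
  abs : κ.2.2.2.natAbs ≤ M

/-- Reachability by steps at one level that start at configurations of bounded size. -/
def Reach (A : BSAutomaton) (G : List (ℕ × ℤ)) (M : ℕ) (R C : Bool) : Core → Core → Prop :=
  Relation.ReflTransGen fun κ κ' => Bdd A.states M κ ∧ Step A G R C κ κ'

variable {A : BSAutomaton} {G : List (ℕ × ℤ)} {M : ℕ} {R C : Bool}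

theorem Bdd.perm {S : List ℕ} {l l' T : List Item} {P : List ℕ} {c : ℤ} (h : Bdd S M (l, T, P, c))
    (hp : l.Perm l') : Bdd S M (l', T, P, c) :=
  ⟨hp.length_eq ▸ h.1, h.2, h.3, fun x hx => h.4 x (hp.symm.subset hx), h.5, h.6, h.7⟩

theorem Reach.refl (κ : Core) : Reach A G M R C κ κ := Relation.ReflTransGen.refl

theorem Reach.trans {κ κ' κ'' : Core} (h : Reach A G M R C κ κ') (h' : Reach A G M R C κ' κ'') :
    Reach A G M R C κ κ'' := Relation.ReflTransGen.trans h h'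

theorem Reach.single {κ κ' : Core} (hκ : Bdd A.states M κ) (h : Step A G R C κ κ') :
    Reach A G M R C κ κ' := Relation.ReflTransGen.single ⟨hκ, h⟩

theorem Reach.rotate {a b T : List Item} {P : List ℕ} {c : ℤ}
    (h : Bdd A.states M (a ++ b, T, P, c)) :
    Reach A G M R C (a ++ b, T, P, c) (b ++ a, T, P, c) := by
  induction a generalizing b with
  | nil => simpa using Reach.refl _
  | cons x a ih =>
    refine (Reach.single h (.rot x (a ++ b) T P c)).trans ?_
    have := ih (b := b ++ [x]) (h.perm (by
      rw [← List.append_assoc]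
      exact (List.perm_append_singleton x (a ++ b)).symm))
    simpa using this

/-- A step that only changes some items at the front can be applied to items anywhere. -/
theorem Reach.apply {pre X X' suf T : List Item} {P P' : List ℕ} {c c' : ℤ}
    (h : Bdd A.states M (pre ++ (X ++ suf), T, P, c))
    (h' : Bdd A.states M (pre ++ (X' ++ suf), T, P', c'))
    (hs : ∀ r, Step A G R C (X ++ r, T, P, c) (X' ++ r, T, P', c')) :
    Reach A G M R C (pre ++ (X ++ suf), T, P, c) (pre ++ (X' ++ suf), T, P', c') := by
  -- The items in front are rotated to the back and, after the step, brought to the front again;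
  -- rotations do not affect the size bounds.
  refine (Reach.rotate h).trans ?_
  rw [List.append_assoc]
  refine (Reach.single ?_ (hs (suf ++ pre))).trans ?_
  · rw [← List.append_assoc]
    exact h.perm List.perm_append_comm
  · have := Reach.rotate (G := G) (R := R) (C := C) (h'.perm (l' := X' ++ suf ++ pre)
      List.perm_append_comm)
    simpa using this

theorem sg_named {p : ℕ} {w : Walk} (hw : Valid A.1 [] p w) (hp : p ∈ A.states) (i ℓ : ℤ) :
    (∀ u ∈ (sg i ℓ p w).1, u ∈ A.states) ∧ ∀ x ∈ (sg i ℓ p w).2, Named A.states x := by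
  induction w generalizing ℓ p with
  | nil => simp [sg]
  | cons x w ih =>
    have hx : x.2 ∈ A.states :=
      fin_mem (fun e he => (BSAutomaton.mem_states he).2) hp [x] ⟨hw.1, trivial⟩
    obtain ⟨h1, h2⟩ := ih hw.2 hx (ℓ + x.1.lev)
    simp only [sg]
    split_ifs
    · exact ⟨h1, h2⟩
    · exact ⟨by simpa using hp, h2⟩
    · refine ⟨by simp, fun y hy => ?_⟩
      rcases List.mem_cons.1 hy with rfl | hy
      · exact ⟨by simpa using hx, h1⟩
      · exact h2 y hy
    · exact ⟨by simp, h2⟩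

theorem lw_named {p : ℕ} {w : Walk} (hw : Valid A.1 [] p w) (hp : p ∈ A.states) (i ℓ : ℤ) :
    (∀ u ∈ (lw i ℓ p w).1, u ∈ A.states) ∧ ∀ x ∈ (lw i ℓ p w).2, Named A.states x := by
  induction w generalizing ℓ p with
  | nil => simp [lw]
  | cons x w ih =>
    have hx : x.2 ∈ A.states :=
      fin_mem (fun e he => (BSAutomaton.mem_states he).2) hp [x] ⟨hw.1, trivial⟩
    obtain ⟨h1, h2⟩ := ih hw.2 hx (ℓ + x.1.lev)
    simp only [lw]
    split_ifs
    · exact ⟨h1, h2⟩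
    · exact ⟨by simpa using hx, h2⟩
    · refine ⟨by simp, fun y hy => ?_⟩
      rcases List.mem_cons.1 hy with rfl | hy
      · exact ⟨by simpa using hp, h1⟩
      · exact h2 y hy
    · exact ⟨by simp, h2⟩

theorem lwList_named {p : ℕ} {w : Walk} (hw : Valid A.1 [] p w) (hp : p ∈ A.states) (i ℓ : ℤ)
    {x : Option ℕ} (hx : ∀ u ∈ x, u ∈ A.states) : ∀ y ∈ lwList i ℓ p w x, Named A.states y := by
  obtain ⟨h1, h2⟩ := lw_named hw hp i ℓ
  intro y hy
  simp only [lwList] at hy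
  split_ifs at hy
  · rcases List.mem_cons.1 hy with rfl | hy
    exacts [⟨hx, h1⟩, h2 y hy]
  · exact h2 y hy

theorem natAbs_adds_le {p : ℕ} {w : Walk} (hw : Valid A.1 [] p w) (i ℓ : ℤ) :
    (adds i ℓ w).natAbs ≤ cnt i ℓ w := by
  induction w generalizing ℓ p with
  | nil => simp [adds]
  | cons x w ih =>
    have h := ih hw.2 (ℓ + x.1.lev)
    have hv : x.1.val.natAbs ≤ 1 := by
      obtain ⟨x, s⟩ := x
      rcases x with _ | _ | z | z
      · simp [Mv.val]
      · simp [Mv.val]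
      · obtain ⟨⟨b, rfl, _⟩, _⟩ := hw
        cases b <;> simp [Mv.val, sgn]
      · simp [Valid, Ok] at hw
    simp only [adds, cnt]
    split_ifs <;> omega

/-- The states that remain to be visited below level `i`. -/
def keep (bot : ℕ → ℤ) (i : ℤ) (vs : List (ℕ × ℤ)) (P : List ℕ) : List ℕ :=
  P.filter fun b => ¬(bot b = i ∧ (b, i) ∈ vs)

theorem keep_cons_of_ne {bot : ℕ → ℤ} {i ℓ : ℤ} {p : ℕ} {vs : List (ℕ × ℤ)} {P : List ℕ}
    (h : ℓ ≠ i) : keep bot i ((p, ℓ) :: vs) P = keep bot i vs P := by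
  refine List.filter_congr fun b _ => ?_
  simp [Ne.symm h]

/-- All visits of the walk to level `i` are processed. -/
theorem reach_sgList {i m : ℤ} (bot : ℕ → ℤ) (hC : i = m → C = true) (w : Walk) :
    ∀ {ℓ : ℤ} {p : ℕ} {pre : List Item} {P : List ℕ} {c : ℤ} {x : Option ℕ}, Valid A.1 [] p w →
    p ∈ A.states → fin p w = A.2.2 → ℓ + lev w = m → (∀ y ∈ pre, Named A.states y) →
    (∀ u ∈ x, u ∈ A.states) → (∀ b ∈ P, b ∈ A.states) → P.length ≤ M →
    c.natAbs + cnt i ℓ w ≤ M → pre.length + (lwList i ℓ p w x).length + cnt i ℓ w ≤ M →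
    Reach A G M R C (pre ++ lwList i ℓ p w x, [], P, c)
      (pre ++ sgList i ℓ p w x, [], keep bot i (verts ℓ p w) P, c + adds i ℓ w) := by
  -- processing the first vertex
  have off : ∀ {ℓ : ℤ} {p : ℕ} {pre t : List Item} {P : List ℕ} {c : ℤ} {y : Option ℕ}
      (vs : List (ℕ × ℤ)), ℓ = i → Bdd A.states M (pre ++ (some p, y) :: t, [], keep bot i vs P, c) →
      Reach A G M R C (pre ++ (some p, y) :: t, [], keep bot i vs P, c)
        (pre ++ (some p, y) :: t, [], keep bot i ((p, ℓ) :: vs) P, c) := by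
    rintro ℓ p pre t P c y vs rfl hB
    -- A state is crossed off only at the level of its lowest visit, where its loops are collected;
    -- higher visits leave it pending.
    by_cases hp : bot p = ℓ
    · have hk : keep bot ℓ ((p, ℓ) :: vs) P = (keep bot ℓ vs P).filter (· ≠ p) := by
        rw [keep, keep, List.filter_filter]
        refine List.filter_congr fun b _ => ?_
        by_cases hb : b = p
        · simp [hb, hp]
        · simp [hb]
      rw [hk]
      exact Reach.apply (X := [(some p, y)]) (X' := [(some p, y)]) hB
        ⟨hB.1, hB.2, (List.length_filter_le _ _).trans hB.3, hB.4, hB.5,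
          fun b hb => hB.6 b (List.mem_of_mem_filter hb), hB.7⟩ fun r => .off ..
    · have hk : keep bot ℓ ((p, ℓ) :: vs) P = keep bot ℓ vs P := by
        refine List.filter_congr fun b _ => ?_
        by_cases hb : b = p
        · simp [hb, hp]
        · simp [hb]
      rw [hk]
      exact Reach.refl _
  have keep_len : ∀ (vs : List (ℕ × ℤ)) (P : List ℕ), (keep bot i vs P).length ≤ P.length :=
    fun vs P => List.length_filter_le _ _
  have keep_mem : ∀ (vs : List (ℕ × ℤ)) {P : List ℕ}, (∀ b ∈ P, b ∈ A.states) →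
      ∀ b ∈ keep bot i vs P, b ∈ A.states := fun vs P h b hb => h b (List.mem_of_mem_filter hb)
  -- The items in `pre` are left alone while the rest of the walk is processed. If the walk is above
  -- level `i`, then `x` is the first end of the segment that is under way.
  induction w with
  | nil =>
    intro ℓ p pre P c x hw hp hf hl hpre hx hP hPM hc hM
    simp only [cnt, lwList, lw, lev, fin] at hc hM hf hl
    simp only [lwList, lw, sgList, sg, verts, adds, add_zero]
    by_cases hℓ : ℓ = i
    · subst hℓ
      subst hf
      simp only [lt_irrefl, if_false, if_true, List.length_nil, List.append_nil] at hc hM ⊢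
      have hB : Bdd A.states M (pre ++ [(some A.2.2, none)], [], P, c) := by
        refine ⟨by simp; omega, by simp, hPM, ?_, by simp, hP, by simp; omega⟩
        intro y hy
        rcases List.mem_append.1 hy with hy | hy
        · exact hpre y hy
        · obtain rfl : y = _ := by simpa using hy
          exact ⟨by simpa using hp, by simp⟩
      have hk : keep bot ℓ [] P = P := by simp [keep]
      have h1 : Reach A G M R C (pre, [], P, c) (pre ++ [(some A.2.2, none)], [], P, c) := by
        have := Reach.apply (A := A) (G := G) (M := M) (R := R) (C := C) (pre := pre) (X := [])
          (X' := [(some A.2.2, none)]) (suf := []) (T := []) (P := P) (P' := P) (c := c) (c' := c)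
          (by simpa using ⟨by simp; omega, by simp, hPM, hpre, by simp, hP, by simp; omega⟩)
          (by simpa using hB)
          (fun r => .newEnd (hC (by omega)) r [] P c)
        simpa using this
      refine h1.trans ?_
      have := off (ℓ := ℓ) (t := []) (P := P) [] rfl (by rw [hk]; exact hB)
      rwa [hk] at this
    · rw [keep_cons_of_ne hℓ]
      have hk : keep bot i [] P = P := by simp [keep]
      rw [hk]
      simp only [hℓ, if_false]
      exact Reach.refl _
  | cons s w ih =>
    intro ℓ p pre P c x hw hp hf hl hpre hx hP hPM hc hM
    obtain ⟨s, p'⟩ := s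
    have hp' : p' ∈ A.states :=
      fin_mem (fun e he => (BSAutomaton.mem_states he).2) hp [(s, p')] ⟨hw.1, trivial⟩
    have hadd := natAbs_adds_le hw.2 i (ℓ + s.lev)
    by_cases hℓ : ℓ = i
    · subst hℓ
      rw [show sgList ℓ ℓ p ((s, p') :: w) x = (some p, (sg ℓ ℓ p ((s, p') :: w)).1) ::
        (sg ℓ ℓ p ((s, p') :: w)).2 by simp [sgList]]
      have hlen := length_sg ℓ ℓ p ((s, p') :: w)
      have hnam := sg_named hw hp ℓ ℓ
      simp only [if_true] at hlen
      rw [verts]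
      have hadd' := natAbs_adds_le hw ℓ ℓ
      refine Reach.trans ?_ (off (verts (ℓ + s.lev) p' w) rfl ?_)
      swap
      · refine ⟨?_, by simp, (keep_len _ _).trans hPM, ?_, by simp, keep_mem _ hP, ?_⟩
        · simp; omega
        · intro y hy
          rcases List.mem_append.1 hy with hy | hy
          · exact hpre y hy
          · rcases List.mem_cons.1 hy with rfl | hy
            · exact ⟨by simpa using hp, hnam.1⟩
            · exact hnam.2 y hy
        · simp; omega
      cases s with
      | up =>
        simp only [lwList, sg, lw, adds, cnt, Mv.lev, lt_irrefl, le_refl, if_true, if_false,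
          Mv.val, zero_add, lt_add_iff_pos_right, zero_lt_one, le_add_iff_nonneg_right,
          zero_le_one] at hM hc ⊢
        -- The ascending edge already belongs to the lowered item, which therefore starts at `p`.
        have := ih (ℓ := ℓ + 1) (pre := pre) (P := P) (c := c) (x := some p) hw.2 hp' hf
          (by simp only [lev, Mv.lev] at hl; omega) hpre (by simpa using hp) hP hPM (by omega)
          (by simp only [lwList, lt_add_iff_pos_right, zero_lt_one, if_true, List.length_cons] at hM ⊢; omega)
        simpa only [lwList, sgList, lt_add_iff_pos_right, zero_lt_one, if_true] using this
      | down =>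
        have e1 : ¬ ℓ < ℓ + -1 := by omega
        have e2 : ¬ ℓ ≤ ℓ + -1 := by omega
        have e3 : ¬ ℓ + -1 = ℓ := by omega
        simp only [lwList, sg, lw, adds, cnt, Mv.lev, lt_irrefl, le_refl, if_true, if_false,
          Mv.val, zero_add, e1, e2] at hM hc ⊢
        -- The walk leaves level `i` downwards at `p`, so nothing follows `p` in its segment, which
        -- is created as a trivial item.
        have h1 : Reach A G M R C (pre ++ (lw ℓ (ℓ + -1) p' w).2, [], P, c)
            (pre ++ [(some p, some p)] ++ (lw ℓ (ℓ + -1) p' w).2, [], P, c) := by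
          have hn := (lw_named hw.2 hp' ℓ (ℓ + -1)).2
          have := Reach.apply (A := A) (G := G) (M := M) (R := R) (C := C) (pre := pre) (X := [])
            (X' := [(some p, some p)]) (suf := (lw ℓ (ℓ + -1) p' w).2) (T := []) (P := P) (P' := P)
            (c := c) (c' := c)
            ⟨by simp; omega, by simp, hPM, ?_, by simp, hP, by simp; omega⟩
            ⟨by simp; omega, by simp, hPM, ?_, by simp, hP, by simp; omega⟩
            (fun r => .new p hp r [] P c)
          · simpa using this
          · intro y hy
            rcases List.mem_append.1 hy with hy | hy
            exacts [hpre y hy, hn y (by simpa using hy)]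
          · intro y hy
            rcases List.mem_append.1 hy with hy | hy
            · exact hpre y hy
            · rcases List.mem_cons.1 hy with rfl | hy
              exacts [⟨by simpa using hp, by simpa using hp⟩, hn y (by simpa using hy)]
        refine h1.trans ?_
        have := ih (ℓ := ℓ + -1) (pre := pre ++ [(some p, some p)]) (P := P) (c := c) (x := none)
          hw.2 hp' hf (by simp only [lev, Mv.lev] at hl; omega) ?_ (by simp) hP hPM (by omega)
          (by simp only [lwList, e1, if_false, List.length_append, List.length_cons,
                List.length_nil] at hM ⊢; omega)
        · simpa only [lwList, sgList, e1, e3, if_false, List.append_assoc, List.cons_append,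
            List.nil_append] using this
        · intro y hy
          rcases List.mem_append.1 hy with hy | hy
          · exact hpre y hy
          · obtain rfl : y = _ := by simpa using hy
            exact ⟨by simpa using hp, by simpa using hp⟩
      | add z =>
        obtain ⟨⟨b, rfl, he⟩, hw'⟩ := hw
        have hn := sg_named hw' hp' ℓ ℓ
        simp only [lwList, sg, lw, adds, cnt, Mv.lev, lt_irrefl, le_refl, if_true, if_false,
          Mv.val, add_zero] at hM hc hadd hlen ⊢
        -- The rest is processed first; its first segment starts at `p'` and is then extended
        -- backwards by the edge.
        have h1 := ih (ℓ := ℓ) (pre := pre) (P := P) (c := c) (x := none) hw' hp' hf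
          (by simp only [lev, Mv.lev] at hl; omega) hpre (by simp) hP hPM (by omega)
          (by simp only [lwList, lt_irrefl, if_false] at hM ⊢; omega)
        simp only [lwList, sgList, lt_irrefl, if_true, if_false] at h1
        refine h1.trans ?_
        have hl' := length_sg ℓ ℓ p' w
        simp only [if_true] at hl'
        have := Reach.apply (A := A) (G := G) (M := M) (R := R) (C := C) (pre := pre)
          (X := [(some p', (sg ℓ ℓ p' w).1)])
          (X' := [(some p, (sg ℓ ℓ p' w).1)]) (suf := (sg ℓ ℓ p' w).2) (T := [])
          (P := keep bot ℓ (verts ℓ p' w) P) (P' := keep bot ℓ (verts ℓ p' w) P)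
          (c := c + adds ℓ ℓ w) (c' := c + adds ℓ ℓ w + sgn b)
          ⟨by simp; omega, by simp, (keep_len _ _).trans hPM, ?_, by simp, keep_mem _ hP,
            by simp; omega⟩
          ⟨by simp; omega, by simp, (keep_len _ _).trans hPM, ?_, by simp, keep_mem _ hP,
            by have : (sgn b).natAbs = 1 := by cases b <;> simp [sgn]
               simp; omega⟩
          (fun r => .ext he _ r [] _ _)
        · rw [show c + (sgn b + adds ℓ ℓ w) = c + adds ℓ ℓ w + sgn b by ring]
          simpa using this
        · intro y hy
          rcases List.mem_append.1 hy with hy | hy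
          · exact hpre y hy
          · rcases List.mem_cons.1 hy with rfl | hy
            exacts [⟨by simpa using hp', hn.1⟩, hn.2 y (by simpa using hy)]
        · intro y hy
          rcases List.mem_append.1 hy with hy | hy
          · exact hpre y hy
          · rcases List.mem_cons.1 hy with rfl | hy
            exacts [⟨by simpa using hp, hn.1⟩, hn.2 y (by simpa using hy)]
      | att z => simp [Valid, Ok] at hw
    · rw [verts, keep_cons_of_ne hℓ]
      simp only [adds, cnt, hℓ, if_false, zero_add] at hc hM ⊢
      by_cases hlt : i < ℓ
      · by_cases hlt' : i < ℓ + s.lev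
        · have h1 := ih (ℓ := ℓ + s.lev) (pre := pre) (P := P) (c := c) (x := x) hw.2 hp' hf
            (by simp only [lev] at hl; omega) hpre hx hP hPM (by omega)
            (by simp only [lwList, lw, hlt, hlt', if_true] at hM ⊢; omega)
          simpa only [lwList, lw, sgList, sg, hlt, hlt', hlt.le, hlt'.le, if_true] using h1
        · obtain hs | hs | hs := Mv.lev_cases s
          · omega
          · have hi : ℓ + s.lev = i := by omega
            have hn := sg_named hw.2 hp' i i
            rw [hi] at hadd hc hM
            -- The segment under way has come down to level `i` at `p'`. It is set aside in `pre`
            -- and afterwards joined to the segment that the rest starts at `p'`.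
            have h1 := ih (ℓ := i) (pre := pre ++ [(x, some p')]) (P := P) (c := c)
              (x := none) hw.2 hp' hf (by simp only [lev] at hl; omega) ?_ (by simp) hP hPM
              (by omega)
              (by simp only [lwList, lw, hlt, hi, if_true, lt_irrefl, if_false, List.length_cons,
                    List.length_append, List.length_nil] at hM ⊢; omega)
            · simp only [lwList, lw, sgList, sg, hlt, hlt.le, hi, lt_irrefl, le_refl, if_true,
                if_false, List.append_assoc, List.cons_append, List.nil_append, List.length_cons]
                at h1 hM ⊢
              refine h1.trans ?_
              have hl' := length_sg i i p' w
              simp only [if_true] at hl'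
              have := Reach.apply (A := A) (G := G) (M := M) (R := R) (C := C) (pre := pre)
                (X := [(x, some p'), (some p', (sg i i p' w).1)])
                (X' := [(x, (sg i i p' w).1)]) (suf := (sg i i p' w).2) (T := [])
                (P := keep bot i (verts i p' w) P) (P' := keep bot i (verts i p' w) P)
                (c := c + adds i i w) (c' := c + adds i i w)
                ⟨by simp; omega, by simp, (keep_len _ _).trans hPM, ?_, by simp, keep_mem _ hP,
                  by simp; omega⟩
                ⟨by simp; omega, by simp, (keep_len _ _).trans hPM, ?_, by simp, keep_mem _ hP,
                  by simp; omega⟩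
                (fun r => .join ..)
              · simpa using this
              · intro y hy
                rcases List.mem_append.1 hy with hy | hy
                · exact hpre y hy
                · simp only [List.cons_append, List.nil_append, List.mem_cons] at hy
                  rcases hy with rfl | rfl | hy
                  exacts [⟨hx, by simpa using hp'⟩, ⟨by simpa using hp', hn.1⟩, hn.2 y hy]
              · intro y hy
                rcases List.mem_append.1 hy with hy | hy
                · exact hpre y hy
                · simp only [List.cons_append, List.nil_append, List.mem_cons] at hy
                  rcases hy with rfl | hy
                  exacts [⟨hx, hn.1⟩, hn.2 y hy]
            · intro y hy
              rcases List.mem_append.1 hy with hy | hy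
              · exact hpre y hy
              · obtain rfl : y = _ := by simpa using hy
                exact ⟨hx, by simpa using hp'⟩
          · omega
      · have hle : ¬ i ≤ ℓ := by omega
        have hlt' : ¬ i < ℓ + s.lev := by rcases Mv.lev_cases s with hs | hs | hs <;> omega
        have h1 := ih (ℓ := ℓ + s.lev) (pre := pre) (P := P) (c := c) (x := none) hw.2 hp' hf
            (by simp only [lev] at hl; omega) hpre (by simp) hP hPM (by omega)
            (by simp only [lwList, lw, hlt, hlt', if_false] at hM ⊢; omega)
        by_cases hi : ℓ + s.lev = i
        · have hi' : i ≤ ℓ + s.lev := hi.ge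
          simpa only [lwList, lw, sgList, sg, hlt, hlt', hle, hℓ, hi', hi, le_refl, lt_irrefl,
            if_true, if_false] using h1
        · have hi' : ¬ i ≤ ℓ + s.lev := by omega
          simpa only [lwList, lw, sgList, sg, hlt, hlt', hle, hℓ, hi', hi, le_refl, lt_irrefl,
            if_true, if_false] using h1

end Core

/-! ### Lowering the segments, adding the loops, and the work at one level -/

namespace Core

open Walk

variable {A : BSAutomaton} {G : List (ℕ × ℤ)} {M : ℕ} {R C : Bool}

/-- `b` results from `a` by edges that connect the level above to the current level. -/
def Lower (A : BSAutomaton) (a b : Item) : Prop := b.1 ∈ lefts A a.1 ∧ b.2 ∈ rights A a.2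

/-- Both functions cut the walk at the same crossings between the levels `i` and `i + 1`; they only
differ in whether the crossing edge is included. Open ends, at the beginning and the end of the
walk, stay open. -/
theorem lower_sg_lw {p : ℕ} {w : Walk} (hw : Valid A.1 [] p w) (i ℓ : ℤ) :
    (lw i ℓ p w).1 ∈ rights A (sg (i + 1) ℓ p w).1 ∧
      List.Forall₂ (Lower A) (sg (i + 1) ℓ p w).2 (lw i ℓ p w).2 := by
  induction w generalizing ℓ p with
  | nil => exact ⟨mem_rights_none.2 rfl, .nil⟩
  | cons x w ih =>
    obtain ⟨h1, h2⟩ := ih hw.2 (ℓ + x.1.lev)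
    obtain ⟨x, s⟩ := x
    simp only [sg, lw, Int.add_one_le_iff]
    split_ifs with hl hl' hl'
    · exact ⟨h1, h2⟩
    · refine ⟨?_, h2⟩
      have hx := hw.1
      cases x with
      | down => exact mem_rights_some.2 ⟨s, rfl, hx⟩
      | up => simp only [Mv.lev] at hl'; omega
      | add z => simp only [Mv.lev] at hl'; omega
      | att z => simp only [Mv.lev] at hl'; omega
    · refine ⟨mem_rights_none.2 rfl, .cons ⟨?_, h1⟩ h2⟩
      have hx := hw.1
      cases x with
      | up => exact mem_lefts_some.2 ⟨p, rfl, hx⟩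
      | down => simp only [Mv.lev] at hl'; omega
      | add z => simp only [Mv.lev] at hl'; omega
      | att z => simp only [Mv.lev] at hl'; omega
    · exact ⟨mem_rights_none.2 rfl, h2⟩

/-- The segments above level `i` of a whole run. -/
def segments (A : BSAutomaton) (w : Walk) (i : ℤ) : List Item :=
  if i ≤ 0 then (none, (sg i 0 A.2.1 w).1) :: (sg i 0 A.2.1 w).2 else (sg i 0 A.2.1 w).2

theorem lower_segments {w : Walk} (hw : Valid A.1 [] A.2.1 w) (i : ℤ) :
    List.Forall₂ (Lower A) (segments A w (i + 1)) (lwList i 0 A.2.1 w none) := by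
  obtain ⟨h1, h2⟩ := lower_sg_lw hw i 0
  simp only [segments, lwList, Int.add_one_le_iff]
  split_ifs
  · exact .cons ⟨mem_lefts_none.2 rfl, h1⟩ h2
  · exact h2

theorem Reach.low {T T' l : List Item} (h : List.Forall₂ (Lower A) T T') {P : List ℕ} {c : ℤ}
    (hT : ∀ x ∈ T, Named A.states x) (hT' : ∀ x ∈ T', Named A.states x)
    (hB : Bdd A.states M (l, [], P, c)) (hM : l.length + T.length ≤ M) :
    Reach A G M R C (l, T, P, c) (l ++ T', [], P, c) := by
  induction h generalizing l with
  | nil => simpa using Reach.refl _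
  | @cons a b T T' hab hTT ih =>
    simp only [List.length_cons] at hM
    have h1 : Bdd A.states M (l, a :: T, P, c) :=
      ⟨hB.1, by simp only [List.length_cons]; omega, hB.3, hB.4, hT, hB.6, hB.7⟩
    refine (Reach.single h1 (.low hab.1 hab.2 l T P c)).trans ?_
    have := ih (l := l ++ [b]) (fun x hx => hT x (by simp [hx])) (fun x hx => hT' x (by simp [hx]))
      ⟨by simp; omega, by simp, hB.3, ?_, by simp, hB.6, hB.7⟩ (by simp; omega)
    · simpa using this
    · intro x hx
      rcases List.mem_append.1 hx with hx | hx
      · exact hB.4 x hx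
      · exact hT' x (by simp at hx; simp [hx])

theorem Reach.gadd_nsmul {b : ℕ} {z : ℤ} (hg : (b, z) ∈ G) {l : List Item} {P : List ℕ}
    (n : ℕ) (hb : n ≠ 0 → b ∈ P) {c : ℤ} (hB : Bdd A.states M (l, [], P, c))
    (hM : c.natAbs + n * z.natAbs ≤ M) :
    Reach A G M R C (l, [], P, c) (l, [], P, c + n * z) := by
  induction n generalizing c with
  | zero => simpa using Reach.refl _
  | succ n ih =>
    have h1 : (c + z).natAbs ≤ c.natAbs + z.natAbs := Int.natAbs_add_le _ _
    have h2 : c.natAbs + (n * z.natAbs + z.natAbs) ≤ M := by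
      rwa [add_mul, one_mul] at hM
    refine (Reach.single hB (.gadd hg l [] P (hb (by simp)) c)).trans ?_
    have := ih (c := c + z) (fun _ => hb (by simp))
      ⟨hB.1, hB.2, hB.3, hB.4, hB.5, hB.6, by simp only; omega⟩ (by omega)
    rwa [show c + ((n + 1 : ℕ) : ℤ) * z = c + z + n * z by push_cast; ring]

theorem Reach.gadd_sum {l : List Item} {P : List ℕ} (dg : ℕ × ℤ → ℕ) (G' : List (ℕ × ℤ))
    (hG : ∀ g ∈ G', g ∈ G) (hdg : ∀ g ∈ G', dg g ≠ 0 → g.1 ∈ P) {c : ℤ}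
    (hB : Bdd A.states M (l, [], P, c))
    (hM : c.natAbs + (G'.map fun g => dg g * g.2.natAbs).sum ≤ M) :
    Reach A G M R C (l, [], P, c) (l, [], P, c + (G'.map fun g => (dg g : ℤ) * g.2).sum) := by
  induction G' generalizing c with
  | nil => simpa using Reach.refl _
  | cons g G' ih =>
    simp only [List.map_cons, List.sum_cons] at hM ⊢
    have h1 : (c + dg g * g.2).natAbs ≤ c.natAbs + dg g * g.2.natAbs := by
      refine (Int.natAbs_add_le _ _).trans ?_
      rw [Int.natAbs_mul, Int.natAbs_natCast]
    refine (Reach.gadd_nsmul (hG g (by simp)) (dg g) (hdg g (by simp)) hB (by omega)).trans ?_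
    have := ih (c := c + dg g * g.2) (fun g hg => hG g (by simp [hg]))
      (fun g hg => hdg g (by simp [hg])) ⟨hB.1, hB.2, hB.3, hB.4, hB.5, hB.6, by simp only; omega⟩
      (by omega)
    rwa [← add_assoc]

/-- All pending states are declared before the first level, because the base-`q` digits of the
numbers of loops may extend above all levels of the walk. -/
theorem Reach.on_all {P : List ℕ} (hP : ∀ b ∈ P, b ∈ A.states) (hM : P.length ≤ M) :
    Reach A G M R C ([], [], [], 0) ([], [], P, 0) := by
  induction P with
  | nil => exact Reach.refl _
  | cons b P ih =>
    simp only [List.length_cons] at hM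
    refine (ih (fun b hb => hP b (by simp [hb])) (by omega)).trans
      (Reach.single ⟨by simp, by simp, by simp only; omega, by simp, by simp,
        fun b hb => hP b (by simp at hb; simp [hb]), by simp⟩ (.on b (hP b (by simp)) ..))

theorem segments_named {w : Walk} (hw : Valid A.1 [] A.2.1 w) (i : ℤ) :
    ∀ x ∈ segments A w i, Named A.states x := by
  obtain ⟨h1, h2⟩ := sg_named hw A.initial_mem_states i 0
  intro x hx
  simp only [segments] at hx
  split_ifs at hx
  · rcases List.mem_cons.1 hx with rfl | hx
    exacts [⟨by simp, h1⟩, h2 x hx]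
  · exact h2 x hx

/-- All that happens at level `i`. -/
theorem reach_level {i m : ℤ} (bot : ℕ → ℤ) (hR : i = 0 → R = true) (hC : i = m → C = true)
    {w : Walk} (hw : Valid A.1 [] A.2.1 w) (hf : fin A.2.1 w = A.2.2) (hm : lev w = m)
    (dg : ℕ × ℤ → ℕ) {G' : List (ℕ × ℤ)} (hG : ∀ g ∈ G', g ∈ G) {P : List ℕ}
    (hdg : ∀ g ∈ G', dg g ≠ 0 → g.1 ∈ P) (hP : ∀ b ∈ P, b ∈ A.states) (hPM : P.length ≤ M) {c : ℤ}
    (hcM : c.natAbs + (G'.map fun g => dg g * g.2.natAbs).sum + cnt i 0 w ≤ M)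
    (hM : 1 + 2 * cnt i 0 w ≤ M) :
    Reach A G M R C ([], segments A w (i + 1), P, c)
      (segments A w i, [], keep bot i (verts 0 A.2.1 w) P,
        c + (G'.map fun g => (dg g : ℤ) * g.2).sum + adds i 0 w) := by
  have hlow := lower_segments hw i
  have hlen : (lwList i 0 A.2.1 w none).length ≤ 1 + cnt i 0 w := by
    have := length_lw i 0 A.2.1 w
    simp only [lwList]
    split_ifs
    · simp only [List.length_cons]; omega
    · omega
  have hnam := lwList_named hw A.initial_mem_states i 0 (x := none) (by simp)
  have hlen' := hlow.length_eq
  have h1 : Reach A G M R C ([], segments A w (i + 1), P, c) (lwList i 0 A.2.1 w none, [], P, c) :=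
    Reach.low hlow (segments_named hw _) hnam
      ⟨by simp, by simp, hPM, by simp, by simp, hP, by simp only; omega⟩ (by simp; omega)
  have h2 : Reach A G M R C (lwList i 0 A.2.1 w none, [], P, c)
      (lwList i 0 A.2.1 w none, [], P, c + (G'.map fun g => (dg g : ℤ) * g.2).sum) :=
    Reach.gadd_sum dg G' hG hdg ⟨by simp only; omega, by simp, hPM, hnam, by simp, hP,
      by simp only; omega⟩ (by omega)
  have hsum : ((G'.map fun g => (dg g : ℤ) * g.2).sum).natAbs ≤
      (G'.map fun g => dg g * g.2.natAbs).sum := by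
    clear hcM h2 hdg hG
    induction G' with
    | nil => simp
    | cons g G' ih =>
      simp only [List.map_cons, List.sum_cons]
      refine (Int.natAbs_add_le _ _).trans (add_le_add ?_ ih)
      rw [Int.natAbs_mul, Int.natAbs_natCast]
  have h3 := reach_sgList (A := A) (G := G) (M := M) (R := R) (C := C) bot hC w (ℓ := 0) (pre := [])
    (c := c + (G'.map fun g => (dg g : ℤ) * g.2).sum) (x := none) hw A.initial_mem_states hf
    (by omega) (by simp) (by simp) hP hPM
    (by have := Int.natAbs_add_le c (G'.map fun g => (dg g : ℤ) * g.2).sum; omega) (by simp; omega)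
  have h4 := (h1.trans h2).trans h3
  -- Away from level `0` the processed items are already the segments of the whole run. At level `0`
  -- the run begins, and `start` turns the first end of its first segment into `none`.
  rcases lt_trichotomy i 0 with hi | hi | hi
  · simpa only [List.nil_append, sgList, segments, hi, hi.le, if_true] using h4
  · subst hi
    refine h4.trans ?_
    simp only [List.nil_append, sgList, segments, le_refl, lt_irrefl, if_true, if_false]
    refine Reach.single ⟨?_, by simp, ?_, ?_, by simp, ?_, ?_⟩ (.start (hR rfl) ..)
    · have := length_sg 0 0 A.2.1 w
      simp only [if_true] at this
      simp only [List.length_cons]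
      omega
    · exact (List.length_filter_le _ _).trans hPM
    · obtain ⟨k1, k2⟩ := sg_named hw A.initial_mem_states 0 0
      intro x hx
      rcases List.mem_cons.1 hx with rfl | hx
      exacts [⟨by simpa using A.initial_mem_states, k1⟩, k2 x hx]
    · exact fun b hb => hP b (List.mem_of_mem_filter hb)
    · have k1 := natAbs_adds_le hw 0 0
      have k2 := Int.natAbs_add_le c (G'.map fun g => (dg g : ℤ) * g.2).sum
      have k3 := Int.natAbs_add_le (c + (G'.map fun g => (dg g : ℤ) * g.2).sum) (adds 0 0 w)
      simp only
      omega
  · have h5 : ¬ i < 0 := by omega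
    have h6 : ¬ (0 : ℤ) = i := by omega
    have h7 : ¬ i ≤ 0 := by omega
    simpa only [List.nil_append, sgList, segments, h5, h6, h7, if_false] using h4

end Core

/-! ### Collecting the auxiliary loops and counting the visits -/

namespace Walk

variable {E : List (ℕ × Gen × ℕ)} {G : List (ℕ × ℤ)} {q : ℕ}

/-- The walk without the auxiliary loops. -/
def proper (w : Walk) : Walk := w.filter fun x => x.1.size = 1

theorem Mv.size_cases (x : Mv) : x.size = 1 ∨ ∃ z, x = .att z := by
  cases x <;> simp [Mv.size]

theorem mem_verts_self (ℓ : ℤ) (p : ℕ) (w : Walk) : (p, ℓ) ∈ verts ℓ p w := by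
  cases w <;> simp [verts]

theorem proper_spec {p : ℕ} {w : Walk} (hw : Valid E G p w) (ℓ : ℤ) :
    Valid E [] p (proper w) ∧ fin p (proper w) = fin p w ∧ lev (proper w) = lev w ∧
      ∀ s j, leaves s j ℓ p (proper w) = leaves s j ℓ p w := by
  induction w generalizing p ℓ with
  | nil => exact ⟨trivial, rfl, rfl, fun _ _ => rfl⟩
  | cons x w ih =>
    obtain ⟨x, s⟩ := x
    obtain ⟨h1, h2, h3, h4⟩ := ih hw.2 (ℓ + x.lev)
    rcases Mv.size_cases x with hx | ⟨z, rfl⟩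
    · have : proper ((x, s) :: w) = (x, s) :: proper w := by simp [proper, hx]
      rw [this]
      refine ⟨⟨?_, h1⟩, h2, by simp [lev, h3], fun s' j => by simp [leaves, h4]⟩
      have hx' := hw.1
      cases x with
      | att z => simp [Mv.size] at hx
      | _ => exact hx'
    · have : proper ((.att z, s) :: w) = proper w := by simp [proper, Mv.size]
      obtain ⟨rfl, _⟩ := hw.1
      rw [this]
      simp only [Mv.lev, add_zero] at h4
      refine ⟨h1, h2, by simp [lev, h3, Mv.lev], fun s' j => ?_⟩
      simp [leaves, h4, Mv.size, Mv.lev]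

/-- The auxiliary loops at a state can be moved to the lowest visit to this state. -/
theorem exists_val_proper [q.AtLeastTwo] {p : ℕ} {w : Walk} (hw : Valid E G p w) (ℓ : ℤ)
    (bot : ℕ → ℤ) (hbot : ∀ b j, (b, j) ∈ verts ℓ p (proper w) → bot b ≤ j) :
    ∃ k : ℕ × ℤ → ℕ, (q : ℚ) ^ ℓ * val q w = (q : ℚ) ^ ℓ * val q (proper w) +
        ∑ g ∈ G.toFinset, k g * g.2 * (q : ℚ) ^ bot g.1 ∧
      ∀ g, k g ≠ 0 → ∃ j, (g.1, j) ∈ verts ℓ p (proper w) := by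
  have hq := BS.natCast_ne_zero q
  induction w generalizing p ℓ with
  | nil => exact ⟨fun _ => 0, by simp [val, proper], by simp⟩
  | cons x w ih =>
    obtain ⟨x, s⟩ := x
    rcases Mv.size_cases x with hx | ⟨z, rfl⟩
    · have hpr : proper ((x, s) :: w) = (x, s) :: proper w := by simp [proper, hx]
      rw [hpr] at hbot ⊢
      obtain ⟨k, h1, h2⟩ := ih hw.2 (ℓ + x.lev) fun b j hb => hbot b j (by simp [verts, hb])
      refine ⟨k, ?_, fun g hg => ?_⟩
      · rw [zpow_add₀ hq] at h1
        simp only [val, mul_add, ← mul_assoc]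
        rw [h1]
        ring
      · obtain ⟨j, hj⟩ := h2 g hg
        exact ⟨j, by simp [verts, hj]⟩
    · have hpr : proper ((.att z, s) :: w) = proper w := by simp [proper, Mv.size]
      obtain ⟨⟨rfl, hg⟩, hw⟩ := hw
      rw [hpr] at hbot ⊢
      obtain ⟨k, h1, h2⟩ := ih hw ℓ hbot
      have hself := mem_verts_self ℓ s (proper w)
      have hle := hbot s ℓ hself
      -- One loop at level `ℓ` is worth `q ^ (ℓ - bot s)` loops at the lowest level at which `s` is
      -- visited.
      refine ⟨fun g => k g + if g = (s, z) then q ^ (ℓ - bot s).toNat else 0, ?_, fun g hg => ?_⟩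
      · simp only [val, Mv.val, Mv.lev, zpow_zero, one_mul, mul_add, h1, Nat.cast_add, add_mul,
          Finset.sum_add_distrib, Nat.cast_ite, ite_mul, Nat.cast_zero, zero_mul]
        rw [Finset.sum_ite_eq' _ _ _, if_pos (List.mem_toFinset.2 hg)]
        have : (q : ℚ) ^ ℓ = (q : ℚ) ^ (ℓ - bot s).toNat * (q : ℚ) ^ bot s := by
          rw [← zpow_natCast, ← zpow_add₀ hq]
          congr 1
          omega
        rw [this]
        push_cast
        ring
      · by_cases hgs : g = (s, z)
        · exact ⟨ℓ, by rw [hgs]; exact hself⟩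
        · exact h2 g (by simpa [hgs] using hg)

/-- Without auxiliary loops every move counts as leaving a vertex, and only the last vertex is not
left. -/
theorem count_verts_le {p : ℕ} {w : Walk} (hw : Valid E [] p w) (ℓ : ℤ) (s : ℕ) (j : ℤ) :
    (verts ℓ p w).count (s, j) ≤ leaves s j ℓ p w + 1 := by
  induction w generalizing p ℓ with
  | nil => simpa [verts, leaves] using List.count_le_length (a := (s, j)) (l := [(p, ℓ)])
  | cons x w ih =>
    have h := ih hw.2 (ℓ + x.1.lev)
    have hx : x.1.size = 1 := by
      obtain ⟨x, s⟩ := x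
      rcases Mv.size_cases x with hx | ⟨z, rfl⟩
      · exact hx
      · simp [Valid, Ok] at hw
    simp only [verts, leaves, List.count_cons, hx, beq_iff_eq, Prod.mk.injEq]
    split_ifs <;> omega

theorem verts_mem {S : List ℕ} (hS : ∀ e ∈ E, e.2.2 ∈ S) {p : ℕ} {w : Walk} (hw : Valid E G p w)
    (hp : p ∈ S) (ℓ : ℤ) : ∀ v ∈ verts ℓ p w, v.1 ∈ S := by
  induction w generalizing p ℓ with
  | nil => simpa [verts] using hp
  | cons x w ih =>
    intro v hv
    rcases List.mem_cons.1 hv with rfl | hv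
    · exact hp
    · exact ih hw.2 (fin_mem hS hp [x] ⟨hw.1, trivial⟩) _ v hv

theorem cnt_eq_countP (i ℓ : ℤ) (p : ℕ) (w : Walk) :
    cnt i ℓ w = (verts ℓ p w).countP fun v => v.2 = i := by
  induction w generalizing p ℓ with
  | nil => simp [cnt, verts, List.countP_cons]
  | cons x w ih =>
    simp only [cnt, verts, List.countP_cons, ih (ℓ + x.1.lev) x.2, decide_eq_true_eq]
    omega

theorem _root_.List.length_le_mul_of_count_le {α : Type*} [BEq α] [LawfulBEq α] (l : List α)
    (s : Finset α) (hs : ∀ a ∈ l, a ∈ s) (n : ℕ) (hn : ∀ a, l.count a ≤ n) :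
    l.length ≤ s.card * n := by
  classical
  have h := Multiset.toFinset_sum_count_eq (l : Multiset α)
  rw [Multiset.coe_card] at h
  rw [← h]
  refine (Finset.sum_le_card_nsmul _ _ n fun a _ => ?_).trans ?_
  · rw [Multiset.coe_count]
    exact le_of_eq_of_le (by congr!) (hn a)
  rw [smul_eq_mul]
  exact Nat.mul_le_mul_right n (Finset.card_le_card fun a ha => hs a (by simpa using ha))

/-- At most `S.length` vertices lie at one level, and each is visited at most once more than it is
left. -/
theorem cnt_le {S : List ℕ} (hS : ∀ e ∈ E, e.2.2 ∈ S) {p : ℕ} {w : Walk} (hw : Valid E [] p w)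
    (hp : p ∈ S) (ℓ i : ℤ) {n : ℕ} (hn : ∀ s j, leaves s j ℓ p w ≤ n) :
    cnt i ℓ w ≤ S.length * (n + 1) := by
  rw [cnt_eq_countP i ℓ p, List.countP_eq_length_filter]
  refine (List.length_le_mul_of_count_le _ (S.toFinset ×ˢ {i}) ?_ (n + 1) ?_).trans ?_
  · intro v hv
    obtain ⟨hv, hi⟩ := List.mem_filter.1 hv
    simp only [Finset.mem_product, List.mem_toFinset, Finset.mem_singleton]
    exact ⟨verts_mem hS hw hp ℓ v hv, by simpa using hi⟩
  · intro v
    refine (List.Sublist.count_le v List.filter_sublist).trans ?_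
    exact (count_verts_le hw ℓ v.1 v.2).trans (Nat.add_le_add_right (hn _ _) 1)
  · refine Nat.mul_le_mul_right _ ?_
    simpa using List.toFinset_card_le S

/-- The value of a walk is the sum of what it adds at each level. -/
theorem val_eq_sum_adds [q.AtLeastTwo] {w : Walk} {i₀ T : ℤ} {ℓ : ℤ} {p : ℕ}
    (h : ∀ v ∈ verts ℓ p w, i₀ ≤ v.2 ∧ v.2 ≤ T) :
    (q : ℚ) ^ ℓ * val q w = ∑ i ∈ Finset.Icc i₀ T, adds i ℓ w * (q : ℚ) ^ i := by
  induction w generalizing ℓ p with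
  | nil => simp [val, adds]
  | cons x w ih =>
    have h1 := ih (ℓ := ℓ + x.1.lev) (p := x.2) fun v hv => h v (by simp [verts, hv])
    have h2 := h (p, ℓ) (mem_verts_self _ _ _)
    rw [zpow_add₀ (BS.natCast_ne_zero q), mul_assoc] at h1
    simp only [val, adds, mul_add, h1, Int.cast_add, add_mul, Finset.sum_add_distrib,
      Int.cast_ite, ite_mul, Int.cast_zero, zero_mul]
    rw [Finset.sum_ite_eq, if_pos (Finset.mem_Icc.2 h2)]
    ring

end Walk

/-! ### Digits and carries -/

/-- A number is determined by its digits. -/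
theorem Nat.sum_digit_mul_pow (q : ℕ) (k n : ℕ) (hk : k < q ^ n) :
    ∑ j ∈ Finset.range n, k / q ^ j % q * q ^ j = k := by
  have key : ∀ n, ∑ j ∈ Finset.range n, k / q ^ j % q * q ^ j = k % q ^ n := by
    intro n
    induction n with
    | zero => simp [Nat.mod_one]
    | succ n ih =>
      rw [Finset.sum_range_succ, ih, pow_succ, Nat.mod_mul, mul_comm (q ^ n)]
  rw [key, Nat.mod_eq_of_lt hk]

/-- This spreads `k` loops at level `b` over the levels from `b` to `T`, fewer than `q` at each, so
that the machine never counts to `k`. -/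
theorem sum_Icc_digits {q : ℕ} [q.AtLeastTwo] {b T i₀ : ℤ} (hb : i₀ ≤ b) (hT : b ≤ T + 1) (k : ℕ)
    (hk : k < q ^ (T + 1 - b).toNat) :
    ∑ i ∈ Finset.Icc i₀ T,
      ((if b ≤ i then k / q ^ (i - b).toNat % q else 0 : ℕ) : ℚ) * (q : ℚ) ^ i =
        k * (q : ℚ) ^ b := by
  have hq := BS.natCast_ne_zero q
  have h1 : ∑ i ∈ Finset.Icc i₀ T,
      ((if b ≤ i then k / q ^ (i - b).toNat % q else 0 : ℕ) : ℚ) * (q : ℚ) ^ i =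
      ∑ i ∈ Finset.Icc b T, ((k / q ^ (i - b).toNat % q : ℕ) : ℚ) * (q : ℚ) ^ i := by
    have hsub : Finset.Icc b T ⊆ Finset.Icc i₀ T := Finset.Icc_subset_Icc_left hb
    rw [← Finset.sum_subset hsub]
    · refine Finset.sum_congr rfl fun i hi => ?_
      rw [if_pos (Finset.mem_Icc.1 hi).1]
    · intro i hi hi'
      have : ¬ b ≤ i := fun h => hi' (Finset.mem_Icc.2 ⟨h, (Finset.mem_Icc.1 hi).2⟩)
      simp [this]
  have h2 : ∑ i ∈ Finset.Icc b T, ((k / q ^ (i - b).toNat % q : ℕ) : ℚ) * (q : ℚ) ^ i =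
      ∑ j ∈ Finset.range (T + 1 - b).toNat, ((k / q ^ j % q : ℕ) : ℚ) * (q : ℚ) ^ (b + j) := by
    refine Finset.sum_bij' (fun i _ => (i - b).toNat) (fun j _ => b + j) ?_ ?_ ?_ ?_ ?_
    · intro i hi
      simp only [Finset.mem_Icc, Finset.mem_range] at hi ⊢
      omega
    · intro j hj
      simp only [Finset.mem_Icc, Finset.mem_range] at hj ⊢
      omega
    · intro i hi
      simp only [Finset.mem_Icc] at hi
      omega
    · intro j hj
      simp
    · intro i hi
      simp only [Finset.mem_Icc] at hi
      congr 2
      omega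
  rw [h1, h2]
  have h3 := Nat.sum_digit_mul_pow q k _ hk
  conv_rhs => rw [← h3]
  rw [Nat.cast_sum, Finset.sum_mul]
  refine Finset.sum_congr rfl fun j _ => ?_
  rw [zpow_add₀ hq, zpow_natCast]
  push_cast
  ring

/-- If a sum of bounded multiples of powers of `q` vanishes, then the carries are bounded. -/
theorem exists_carries {q : ℕ} [q.AtLeastTwo] {i₀ T : ℤ} (hT : i₀ ≤ T + 1) (δ : ℤ → ℤ) {Δ : ℕ}
    (hδ : ∀ i, (δ i).natAbs ≤ Δ)
    (h0 : ∑ i ∈ Finset.Icc i₀ T, δ i * (q : ℚ) ^ i = 0) :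
    ∃ c : ℤ → ℤ, c (T + 1) = 0 ∧ c i₀ = 0 ∧
      (∀ i, i₀ ≤ i → i ≤ T → c i = q * c (i + 1) + δ i) ∧
      ∀ i, i₀ ≤ i → i ≤ T + 1 → (c i).natAbs ≤ Δ := by
  have hq2 : 2 ≤ q := Nat.AtLeastTwo.prop
  have hq := BS.natCast_ne_zero q
  -- Horner's scheme from the top: `c' n` is the carry at level `T + 1 - n`.
  let c' : ℕ → ℤ := fun n => Nat.rec 0 (fun n x => q * x + δ (T - n)) n
  have hc' : ∀ n : ℕ, c' (n + 1) = q * c' n + δ (T - n) := fun n => rfl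
  have hsum : ∀ n : ℕ, (Int.cast (c' n) : ℚ) * (q : ℚ) ^ (T + 1 - n) =
      ∑ i ∈ Finset.Icc (T + 1 - n) T, δ i * (q : ℚ) ^ i := by
    intro n
    induction n with
    | zero => simp [c']
    | succ n ih =>
      have hins : Finset.Icc (T + 1 - (n + 1 : ℕ)) T =
          insert (T - n : ℤ) (Finset.Icc (T + 1 - n) T) := by
        ext i
        simp only [Finset.mem_Icc, Finset.mem_insert]
        push_cast
        omega
      rw [hins, Finset.sum_insert (by simp), ← ih, hc',
        show (T + 1 - (n + 1 : ℕ) : ℤ) = T - n by push_cast; ring,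
        show (T + 1 - n : ℤ) = (T - n) + 1 by ring, zpow_add_one₀ hq]
      push_cast
      ring
  have hend : c' (T + 1 - i₀).toNat = 0 := by
    have := hsum (T + 1 - i₀).toNat
    rw [show (T + 1 - ((T + 1 - i₀).toNat : ℕ) : ℤ) = i₀ by omega, h0] at this
    have h2 : (q : ℚ) ^ i₀ ≠ 0 := zpow_ne_zero _ hq
    have h3 : (Int.cast (c' (T + 1 - i₀).toNat) : ℚ) = 0 := by
      rcases mul_eq_zero.1 this with h | h
      exacts [h, absurd h h2]
    exact_mod_cast h3
  -- The bound propagates upwards from the final carry `0`: if the next carry is at most `Δ`, then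
  -- `q * |c' n| ≤ 2 * Δ`, and `q ≥ 2`.
  have hbd : ∀ j n : ℕ, n + j = (T + 1 - i₀).toNat → (c' n).natAbs ≤ Δ := by
    intro j
    induction j with
    | zero =>
      intro n hn
      rw [show n = (T + 1 - i₀).toNat by omega, hend]
      simp
    | succ j ih =>
      intro n hn
      have h1 := ih (n + 1) (by omega)
      rw [hc'] at h1
      have h2 := hδ (T - n)
      have h3 : q * (c' n).natAbs ≤ 2 * Δ := by
        rw [show q * (c' n).natAbs = (q * c' n).natAbs by simp [Int.natAbs_mul]]
        omega
      nlinarith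
  refine ⟨fun i => c' (T + 1 - i).toNat, by simp [c'], hend, ?_, ?_⟩
  · intro i hi hi'
    simp only
    rw [show (T + 1 - i).toNat = (T - i).toNat + 1 by omega, hc',
      show (T + 1 - (i + 1)).toNat = (T - i).toNat by omega,
      show T - ((T - i).toNat : ℕ) = i by omega]
  · intro i hi hi'
    exact hbd (i - i₀).toNat _ (by omega)

/-! ### From runs to walks, and walks seen from extreme levels -/

namespace Walk

variable {E : List (ℕ × Gen × ℕ)} {G : List (ℕ × ℤ)} {q : ℕ}

theorem Valid.mono {p : ℕ} {w : Walk} (h : Valid E [] p w) : Valid E G p w := by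
  induction w generalizing p with
  | nil => trivial
  | cons x w ih =>
    refine ⟨?_, ih h.2⟩
    obtain ⟨x, s⟩ := x
    have hx := h.1
    cases x with
    | att z => simp [Ok] at hx
    | _ => exact hx

theorem exists_of_isRun [q.AtLeastTwo] {p p' : ℕ} {l : List Gen}
    (h : IsRun {e | e ∈ E} p l p') :
    ∃ w, Valid E [] p w ∧ fin p w = p' ∧ lev w = ((l.map (Gen.toBS q)).prod).m ∧
      val q w = ((l.map (Gen.toBS q)).prod).r := by
  induction h with
  | nil p => exact ⟨[], trivial, rfl, rfl, rfl⟩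
  | @cons p s p' g l he _ ih =>
    obtain ⟨w, h1, h2, h3, h4⟩ := ih
    rcases g with ⟨_ | _, b⟩
    · refine ⟨(.add (sgn b), s) :: w, ⟨⟨b, rfl, he⟩, h1⟩, h2, ?_, ?_⟩
      · cases b <;> simp [lev, Mv.lev, h3, Gen.toBS, BS.a]
      · cases b <;> simp [val, Mv.lev, Mv.val, h4, Gen.toBS, BS.a, sgn]
    · cases b
      · refine ⟨(.up, s) :: w, ⟨he, h1⟩, h2, ?_, ?_⟩
        · simp [lev, Mv.lev, h3, Gen.toBS, BS.t]
        · simp [val, Mv.lev, Mv.val, h4, Gen.toBS, BS.t]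
      · refine ⟨(.down, s) :: w, ⟨he, h1⟩, h2, ?_, ?_⟩
        · simp [lev, Mv.lev, h3, Gen.toBS, BS.t]
        · simp [val, Mv.lev, Mv.val, h4, Gen.toBS, BS.t]

theorem sg_of_le {i ℓ : ℤ} {p : ℕ} {w : Walk} (h : ∀ v ∈ verts ℓ p w, i ≤ v.2) :
    sg i ℓ p w = (none, []) := by
  induction w generalizing ℓ p with
  | nil => rfl
  | cons x w ih =>
    have h1 := ih (ℓ := ℓ + x.1.lev) (p := x.2) fun v hv => h v (by simp [verts, hv])
    have h2 : i ≤ ℓ := h (p, ℓ) (mem_verts_self _ _ _)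
    have h3 : i ≤ ℓ + x.1.lev := h (x.2, ℓ + x.1.lev) (by simp [verts, mem_verts_self])
    simp [sg, h1, h2, h3]

theorem sg_of_lt {i ℓ : ℤ} {p : ℕ} {w : Walk} (h : ∀ v ∈ verts ℓ p w, v.2 < i) :
    sg i ℓ p w = (none, []) := by
  induction w generalizing ℓ p with
  | nil => rfl
  | cons x w ih =>
    have h1 := ih (ℓ := ℓ + x.1.lev) (p := x.2) fun v hv => h v (by simp [verts, hv])
    have h2 : ℓ < i := h (p, ℓ) (mem_verts_self _ _ _)
    have h3 : ℓ + x.1.lev < i := h (x.2, ℓ + x.1.lev) (by simp [verts, mem_verts_self])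
    simp [sg, h1, h2.not_ge, h3.not_ge]

theorem exists_lowest (vs : List (ℕ × ℤ)) : ∃ bot : ℕ → ℤ, ∀ b j, (b, j) ∈ vs →
    bot b ≤ j ∧ (b, bot b) ∈ vs := by
  have : ∀ b, ∃ k : ℤ, ∀ j, (b, j) ∈ vs → k ≤ j ∧ (b, k) ∈ vs := by
    intro b
    by_cases hb : ∃ j, (b, j) ∈ vs
    · obtain ⟨j, hj⟩ := hb
      obtain ⟨v, hv, hmin⟩ := Finset.exists_min_image (vs.toFinset.filter (·.1 = b)) Prod.snd
        ⟨(b, j), by simp [hj]⟩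
      simp only [Finset.mem_filter, List.mem_toFinset] at hv hmin
      obtain ⟨v1, v2⟩ := v
      obtain ⟨hv, rfl⟩ := hv
      exact ⟨v2, fun j hj => ⟨hmin (_, j) ⟨hj, rfl⟩, hv⟩⟩
    · exact ⟨0, fun j hj => absurd ⟨j, hj⟩ hb⟩
  choose bot h using this
  exact ⟨bot, h⟩

end Walk

/-! ### Every run admits a sweep of bounded size -/

namespace Core

open Walk

/-- A bound on the size of the configurations that are needed in a sweep. -/
def bound (q : ℕ) (A : BSAutomaton) (G : List (ℕ × ℤ)) (K : ℕ) : ℕ :=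
  q * (q * K * G.length + A.states.length * (K + 2) + q) + q + q * K * G.length +
    3 * (A.states.length * (K + 2)) + 1 + A.states.length

theorem _root_.List.sum_map_le_length_mul {α : Type*} (l : List α) (f : α → ℕ) (n : ℕ)
    (h : ∀ a ∈ l, f a ≤ n) : (l.map f).sum ≤ n * l.length := by
  induction l with
  | nil => simp
  | cons a l ih =>
    have h1 := h a (by simp)
    have h2 := ih fun b hb => h b (by simp [hb])
    simp only [List.map_cons, List.sum_cons, List.length_cons]
    rw [mul_add, mul_one]
    omega

theorem _root_.List.natAbs_sum_map_le {α : Type*} (l : List α) (f : α → ℤ) :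
    (l.map f).sum.natAbs ≤ (l.map fun a => (f a).natAbs).sum := by
  induction l with
  | nil => simp
  | cons a l ih =>
    simp only [List.map_cons, List.sum_cons]
    exact (Int.natAbs_add_le _ _).trans (by omega)

/-- A run yields a sweep through the levels. -/
theorem exists_sweep {q : ℕ} [q.AtLeastTwo] {A : BSAutomaton} {G : List (ℕ × ℤ)} {D : BoundTable}
    {K : ℕ} (hD : D.Closed q A.1 G A.states) (hG : D.Suffices G K) (hK : 1 ≤ K)
    (hGK : ∀ g ∈ G, g.2.natAbs ≤ K) {r : ℚ} {m : ℤ} (h : AbsPath q A.1 A.2.1 0 r A.2.2 m)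
    (sd : ℤ → ℤ) (hsd : ∀ i, (sd i).natAbs ≤ q) (I J : ℤ)
    (hsum : ∀ i₀ T, i₀ ≤ I → J ≤ T → r = ∑ i ∈ Finset.Icc i₀ T, sd i * (q : ℚ) ^ i) :
    ∃ i₀ T, i₀ ≤ I ∧ J ≤ T ∧ i₀ ≤ T ∧ ∃ κ : ℤ → Core,
      (∀ R C, Reach A G (bound q A G K) R C ([], [], [], 0) (κ (T + 1))) ∧
      κ i₀ = ([(none, none)], [], [], 0) ∧
      ∀ i, i₀ ≤ i → i ≤ T → Bdd A.states (bound q A G K) (κ (i + 1)) ∧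
        ∃ κ' ∈ level q (sd i) (κ (i + 1)), ∀ R C : Bool, (i = 0 → R = true) → (i = m → C = true) →
          Reach A G (bound q A G K) R C κ' (κ i) := by
  have hq := BS.natCast_ne_zero q
  obtain ⟨l, hl, rfl, hm⟩ := h
  obtain ⟨w₁, h1, h2, h3, h4⟩ := exists_of_isRun (q := q) hl
  have hS : ∀ e ∈ A.1, e.2.2 ∈ A.states := fun e he => (BSAutomaton.mem_states he).2
  -- The walk is made thin first. Then its auxiliary loops are stripped off and collected, with
  -- multiplicities `k`, at the lowest visits to their states.
  obtain ⟨w₂, k1, k2, k3, k4, k5⟩ := exists_thin hD hG hK hS A.initial_mem_states 0 w₁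
    (h1.mono (G := G))
  obtain ⟨p1, p2, p3, p4⟩ := proper_spec k1 0
  obtain ⟨bot, hbot⟩ := exists_lowest (verts 0 A.2.1 (proper w₂))
  obtain ⟨k, hk, hk'⟩ := exists_val_proper (q := q) k1 0 bot fun b j hb => (hbot b j hb).1
  set w := proper w₂ with hw
  have hf : fin A.2.1 w = A.2.2 := by rw [p2, k2, h2]
  have hm' : lev w = m := by rw [p3, k3, h3]; omega
  have hcnt : ∀ i, cnt i 0 w ≤ A.states.length * (K + 2) := fun i =>
    cnt_le hS p1 A.initial_mem_states 0 i fun s j => by rw [p4]; exact k5 s j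
  -- The sweep has to cover all levels in `F`. The entries `bot g.1 + k g` leave room for all
  -- base-`q` digits of `k g`, because `k g < q ^ k g`.
  obtain ⟨F, hF⟩ : ∃ F : List ℤ, F = (verts 0 A.2.1 w).map Prod.snd ++
    (G.map fun g => bot g.1) ++ (G.map fun g => bot g.1 + k g) ++ [0, I, J] := ⟨_, rfl⟩
  obtain ⟨T, hT⟩ := F.toFinset.exists_le
  obtain ⟨i₀, hi₀⟩ : ∃ i₀ : ℤ, ∀ i ∈ F, i₀ ≤ i := by
    obtain ⟨x, hx⟩ := (F.map Neg.neg).toFinset.exists_le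
    refine ⟨-x, fun i hi => ?_⟩
    have := hx (-i) (by simpa using hi)
    omega
  replace hT : ∀ i ∈ F, i ≤ T := fun i hi => hT i (by simpa using hi)
  have hv : ∀ v ∈ verts 0 A.2.1 w, i₀ ≤ v.2 ∧ v.2 ≤ T := fun v hv =>
    have : v.2 ∈ F := by rw [hF]; simp; left; exact ⟨v.1, hv⟩
    ⟨hi₀ _ this, hT _ this⟩
  have hb1 : ∀ g ∈ G, i₀ ≤ bot g.1 ∧ bot g.1 ≤ T := fun g hg =>
    have : bot g.1 ∈ F := by
      rw [hF]
      simp only [List.mem_append]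
      exact .inl (.inl (.inr (List.mem_map.2 ⟨g, hg, rfl⟩)))
    ⟨hi₀ _ this, hT _ this⟩
  have hb2 : ∀ g ∈ G, bot g.1 + k g ≤ T := fun g hg => hT _ (by
      rw [hF]
      simp only [List.mem_append]
      exact .inl (.inr (List.mem_map.2 ⟨g, hg, rfl⟩)))
  have hI : i₀ ≤ I := hi₀ _ (by simp [hF])
  have hJ : J ≤ T := hT _ (by simp [hF])
  have h00 : i₀ ≤ 0 ∧ 0 ≤ T := ⟨hi₀ _ (by simp [hF]), hT _ (by simp [hF])⟩
  have hk0 : ∀ g ∈ G, k g < q ^ (T + 1 - bot g.1).toNat := fun g hg => by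
    refine (Nat.lt_pow_self (Nat.AtLeastTwo.prop (n := q))).trans_le ?_
    exact Nat.pow_le_pow_right (by have := Nat.AtLeastTwo.prop (n := q); omega)
      (by have := hb2 g hg; omega)
  -- The number of copies of the loop `g` added at level `i` is a base-`q` digit of `k g`, counted
  -- from the level `bot g.1`.
  let dg : ℤ → ℕ × ℤ → ℕ := fun i g =>
    if bot g.1 ≤ i then k g / q ^ (i - bot g.1).toNat % q else 0
  have hdgq : ∀ i g, dg i g ≤ q := fun i g => by
    simp only [dg]
    split_ifs
    · exact (Nat.mod_lt _ (by have := Nat.AtLeastTwo.prop (n := q); omega)).le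
    · omega
  have hgs : ∀ i, (G.dedup.map fun g => dg i g * g.2.natAbs).sum ≤ q * K * G.length := fun i => by
    refine (List.sum_map_le_length_mul _ _ (q * K) fun g hg => ?_).trans ?_
    · exact Nat.mul_le_mul (hdgq i g) (hGK g (by simpa using hg))
    · exact Nat.mul_le_mul_left _ (List.dedup_sublist G).length_le
  have hgs' : ∀ i, (G.dedup.map fun g => (dg i g : ℤ) * g.2).sum.natAbs ≤ q * K * G.length :=
    fun i => by
      refine (List.natAbs_sum_map_le _ _).trans ((le_of_eq ?_).trans (hgs i))
      simp [Int.natAbs_mul]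
  -- The net change of the carry at level `i`: loops and edges of the walk minus the written digit.
  -- Duplicates in `G` are removed because the multiplicities were summed over a finset.
  let δ : ℤ → ℤ := fun i => (G.dedup.map fun g => (dg i g : ℤ) * g.2).sum + adds i 0 w - sd i
  have hδ : ∀ i, (δ i).natAbs ≤ q * K * G.length + A.states.length * (K + 2) + q := fun i => by
    have e1 := hgs' i
    have e2 := (natAbs_adds_le p1 i 0).trans (hcnt i)
    have e3 := hsd i
    simp only [δ]
    omega
  have h0 : ∑ i ∈ Finset.Icc i₀ T, δ i * (q : ℚ) ^ i = 0 := by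
    have e1 := hsum i₀ T hI hJ
    have e2 := val_eq_sum_adds (q := q) hv
    have e3 : ∑ i ∈ Finset.Icc i₀ T,
        ((G.dedup.map fun g => (dg i g : ℤ) * g.2).sum : ℤ) * (q : ℚ) ^ i =
        ∑ g ∈ G.toFinset, k g * g.2 * (q : ℚ) ^ bot g.1 := by
      have : ∀ i, (((G.dedup.map fun g => (dg i g : ℤ) * g.2).sum : ℤ) : ℚ) =
          ∑ g ∈ G.toFinset, (dg i g : ℚ) * g.2 := by
        intro i
        have : G.toFinset = G.dedup.toFinset := by ext; simp
        rw [this, List.sum_toFinset _ G.nodup_dedup]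
        simp [Function.comp_def]
      simp_rw [this, Finset.sum_mul]
      rw [Finset.sum_comm]
      refine Finset.sum_congr rfl fun g hg => ?_
      have hg' : g ∈ G := by simpa using hg
      have e4 := sum_Icc_digits (q := q) (T := T) (i₀ := i₀) (hb1 g hg').1
        (by have := (hb1 g hg').2; omega) (k g) (hk0 g hg')
      rw [mul_right_comm, ← e4, Finset.sum_mul]
      exact Finset.sum_congr rfl fun i _ => by simp only [dg]; ring
    simp only [zpow_zero, one_mul] at e1 e2 hk
    rw [← h4, ← k4, hk, e2, ← e3, ← Finset.sum_add_distrib] at e1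
    rw [← sub_eq_zero, ← Finset.sum_sub_distrib] at e1
    rw [← e1]
    refine Finset.sum_congr rfl fun i _ => ?_
    simp only [δ]
    push_cast
    ring
  obtain ⟨c, c1, c2, c3, c4⟩ := exists_carries (by omega) δ hδ h0
  -- After the work at level `i`, exactly the visited states whose lowest visit lies strictly below
  -- `i` are pending.
  let P : ℤ → List ℕ := fun i =>
    A.states.filter fun b => (b, bot b) ∈ verts 0 A.2.1 w ∧ bot b < i
  have hP : ∀ i, (∀ b ∈ P i, b ∈ A.states) ∧ (P i).length ≤ A.states.length := fun i =>
    ⟨fun b hb => List.mem_of_mem_filter hb, List.length_filter_le _ _⟩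
  refine ⟨i₀, T, hI, hJ, by omega, fun i => (segments A w i, [], P i, c i), ?_, ?_, ?_⟩
  · intro R C
    have e1 : segments A w (T + 1) = [] := by
      rw [segments, if_neg (by omega), sg_of_lt fun v h => by have := (hv v h).2; omega]
    simp only [e1, c1]
    exact Reach.on_all (hP _).1 (by have := (hP (T + 1)).2; simp only [bound]; omega)
  · have e1 : segments A w i₀ = [(none, none)] := by
      rw [segments, if_pos (by omega), sg_of_le fun v h => (hv v h).1]
    have e2 : P i₀ = [] := by
      refine List.filter_eq_nil_iff.2 fun b _ => ?_
      simp only [decide_eq_true_eq, not_and, not_lt]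
      exact fun hb => (hv _ hb).1
    simp only [e1, e2, c2]
  · intro i hi hi'
    have b1 := hcnt (i + 1)
    have b2 := (hP (i + 1)).2
    have b3 := c4 (i + 1) (by omega) (by omega)
    have b4 := hcnt i
    have b5 := hgs i
    have b6 := hsd i
    have b7 := Nat.mul_le_mul_left q b3
    refine ⟨⟨?_, by simp, ?_, segments_named p1 _, by simp, (hP _).1, ?_⟩,
      ([], segments A w (i + 1), P (i + 1), q * c (i + 1) - sd i), by simp [level], ?_⟩
    · have := length_sg (i + 1) 0 A.2.1 w
      simp only [segments, bound]
      split_ifs <;> (try simp only [List.length_cons]) <;> omega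
    · simp only [bound]; omega
    · have := Nat.le_mul_of_pos_left (c (i + 1)).natAbs
        (show 0 < q by have := Nat.AtLeastTwo.prop (n := q); omega)
      simp only [bound]
      omega
    · intro R C hR hC
      have b8 : (q * c (i + 1)).natAbs = q * (c (i + 1)).natAbs := by simp [Int.natAbs_mul]
      have e1 := reach_level (A := A) (G := G) (M := bound q A G K) (R := R) (C := C) bot hR hC p1
        hf hm' (dg i) (G' := G.dedup) (fun g hg => by simpa using hg) (P := P (i + 1)) ?_ (hP _).1
        (by simp only [bound]; omega) (c := q * c (i + 1) - sd i)
        (by simp only [bound]; omega) (by simp only [bound]; omega)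
      · have e2 : keep bot i (verts 0 A.2.1 w) (P (i + 1)) = P i := by
          simp only [keep, P, List.filter_filter]
          refine List.filter_congr fun b _ => ?_
          rw [Bool.eq_iff_iff]
          simp only [Bool.and_eq_true, decide_eq_true_eq]
          constructor
          · rintro ⟨e, e', e''⟩
            refine ⟨e', lt_of_le_of_ne (by omega) ?_⟩
            rintro rfl
            exact e ⟨rfl, e'⟩
          · rintro ⟨e, e'⟩
            exact ⟨fun e'' => by omega, e, by omega⟩
        rw [e2] at e1
        simp only [c3 i hi hi']
        convert e1 using 4
        simp only [δ]
        ring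
      · intro g hg hd
        simp only [dg] at hd
        split_ifs at hd with hd'
        · have hkg : k g ≠ 0 := by
            intro h
            simp [h] at hd
          obtain ⟨j, hj⟩ := hk' g hkg
          have := (hbot g.1 j hj).2
          exact List.mem_filter.2 ⟨verts_mem hS p1 A.initial_mem_states 0 (g.1, bot g.1) this,
            by simp only [decide_eq_true_eq]; exact ⟨this, by omega⟩⟩
        · exact absurd rfl hd

end Core

/-! ### Characterization of pointed expansions -/

theorem Nat.digit_sum_mul_pow {q : ℕ} (b : ℕ → ℕ) (hb : ∀ j, b j < q) (n : ℕ) :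
    (∑ j ∈ Finset.range n, b j * q ^ j) < q ^ n ∧
      ∀ j < n, (∑ j ∈ Finset.range n, b j * q ^ j) / q ^ j % q = b j := by
  have hq : 0 < q := (Nat.zero_le _).trans_lt (hb 0)
  induction n with
  | zero => simp
  | succ n ih =>
    obtain ⟨h1, h2⟩ := ih
    rw [Finset.sum_range_succ]
    constructor
    · have : b n * q ^ n + q ^ n ≤ q * q ^ n := by
        rw [← Nat.succ_mul]
        exact Nat.mul_le_mul_right _ (hb n)
      rw [pow_succ, mul_comm _ q]
      omega
    · intro j hj
      rcases Nat.lt_succ_iff_lt_or_eq.1 hj with hj | rfl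
      · obtain ⟨e, rfl⟩ : ∃ e, n = j + 1 + e := ⟨n - (j + 1), by omega⟩
        rw [← h2 j hj, show b (j + 1 + e) * q ^ (j + 1 + e) =
          q ^ j * (q * (b (j + 1 + e) * q ^ e)) by ring, Nat.add_mul_div_left _ _ (by positivity),
          Nat.add_mul_mod_self_left]
      · rw [Nat.add_mul_div_right _ _ (by positivity), Nat.div_eq_of_lt h1, zero_add,
          Nat.mod_eq_of_lt (hb j)]

theorem sum_Icc_zpow_eq {q : ℕ} [q.AtLeastTwo] (a : ℤ → ℕ) (h k : ℕ) :
    ∑ i ∈ Finset.Icc (-k : ℤ) h, (a i : ℚ) * (q : ℚ) ^ i =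
      (∑ j ∈ Finset.range (h + k + 1), a (j - k) * q ^ j : ℕ) * (q : ℚ) ^ (-k : ℤ) := by
  have hq := BS.natCast_ne_zero q
  rw [Nat.cast_sum, Finset.sum_mul]
  refine Finset.sum_bij' (fun i _ => (i + k).toNat) (fun j _ => (j : ℤ) - k) ?_ ?_ ?_ ?_ ?_
  · intro i hi
    simp only [Finset.mem_Icc, Finset.mem_range] at hi ⊢
    omega
  · intro j hj
    simp only [Finset.mem_Icc, Finset.mem_range] at hj ⊢
    omega
  · intro i hi
    simp only [Finset.mem_Icc] at hi
    omega
  · intro j hj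
    simp
  · intro i hi
    simp only [Finset.mem_Icc] at hi
    rw [show (((i + k).toNat : ℕ) : ℤ) - k = i by omega]
    push_cast
    rw [mul_assoc, ← zpow_natCast, ← zpow_add₀ hq]
    congr 2
    omega

namespace BS

variable {q : ℕ} [q.AtLeastTwo] {v : BS q}

theorem zpow_eq_pow_mul (k : ℕ) {i : ℤ} (hi : -k ≤ i) :
    (q : ℚ) ^ i = (q : ℚ) ^ (i + k).toNat * (q : ℚ) ^ (-k : ℤ) := by
  rw [← zpow_natCast, ← zpow_add₀ (natCast_ne_zero q)]
  congr 1
  omega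

theorem digit_eq {N k : ℕ} (hN : |v.r| = N * (q : ℚ) ^ (-k : ℤ)) {i : ℤ} (hi : -k ≤ i) :
    (v.digit i : ℕ) = N / q ^ (i + k).toNat % q := by
  have hq := natCast_ne_zero q
  simp only [digit]
  congr 1
  rw [← Nat.floor_div_eq_div (K := ℚ), hN, zpow_neg _ i, zpow_eq_pow_mul k hi]
  congr 1
  have : (q : ℚ) ^ (-k : ℤ) ≠ 0 := zpow_ne_zero _ hq
  push_cast
  field_simp

theorem abs_lt_pow_iff {N k h : ℕ} (hN : |v.r| = N * (q : ℚ) ^ (-k : ℤ)) :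
    |v.r| < (q : ℚ) ^ h ↔ N < q ^ (h + k) := by
  have hq : (0 : ℚ) < q := by have := Nat.AtLeastTwo.prop (n := q); exact_mod_cast (by omega)
  rw [hN, zpow_neg, ← div_eq_mul_inv, div_lt_iff₀ (by positivity), zpow_natCast, ← pow_add]
  exact_mod_cast Iff.rfl

theorem exists_nat_iff {N k l : ℕ} (hN : |v.r| = N * (q : ℚ) ^ (-k : ℤ)) (hl : l ≤ k) :
    (∃ n : ℕ, |v.r| * (q : ℚ) ^ l = n) ↔ q ^ (k - l) ∣ N := by
  have hq : (0 : ℚ) < q := by have := Nat.AtLeastTwo.prop (n := q); exact_mod_cast (by omega)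
  obtain ⟨e, rfl⟩ := Nat.exists_eq_add_of_le hl
  have : |v.r| * (q : ℚ) ^ l = N / (q : ℚ) ^ e := by
    rw [hN, zpow_neg, zpow_natCast, pow_add]
    field_simp
  rw [this, Nat.add_sub_cancel_left]
  constructor
  · rintro ⟨n, hn⟩
    rw [div_eq_iff (by positivity)] at hn
    exact ⟨n, by rw [mul_comm]; exact_mod_cast hn⟩
  · rintro ⟨n, rfl⟩
    exact ⟨n, by push_cast; field_simp⟩

/-- The pointed expansion is determined by its properties. -/
theorem hi_lo_digit_eq {h k : ℕ} {a : ℤ → ℕ} (ha : ∀ i, a i < q)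
    (hr : |v.r| = ∑ i ∈ Finset.Icc (-k : ℤ) h, (a i : ℚ) * (q : ℚ) ^ i) (hkm : -k ≤ v.m)
    (hmh : v.m ≤ h) (hh : a h ≠ 0 ∨ h = 0 ∨ v.m = h) (hk : a (-k) ≠ 0 ∨ k = 0 ∨ v.m = -k) :
    v.hi = h ∧ v.lo = k ∧ ∀ i : ℤ, -k ≤ i → i ≤ h → (v.digit i : ℕ) = a i := by
  have hq2 := Nat.AtLeastTwo.prop (n := q)
  rw [sum_Icc_zpow_eq] at hr
  obtain ⟨h1, h2⟩ := Nat.digit_sum_mul_pow (fun j : ℕ => a (j - k)) (fun j => ha _) (h + k + 1)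
  set N := ∑ j ∈ Finset.range (h + k + 1), a (j - k) * q ^ j with hN
  refine ⟨?_, ?_, ?_⟩
  · refine le_antisymm (Nat.sInf_le ⟨hmh, ?_⟩) (le_csInf ⟨h, hmh, ?_⟩ ?_)
    · rw [abs_lt_pow_iff hr]
      convert h1 using 2
      ring
    · rw [abs_lt_pow_iff hr]
      convert h1 using 2
      ring
    -- If fewer positions sufficed on the left, the digit at `h` would vanish; the alternatives in
    -- `hh` exclude a smaller `b` directly.
    · rintro b ⟨hb1, hb2⟩
      by_contra! hbh
      rw [abs_lt_pow_iff hr] at hb2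
      rcases hh with hh | hh | hh
      · have := h2 (h + k) (by omega)
        rw [Nat.div_eq_of_lt (hb2.trans_le (Nat.pow_le_pow_right (by omega) (by omega)))] at this
        simp at this
        exact hh this.symm
      · omega
      · omega
  · have hmem : -v.m ≤ k ∧ ∃ N : ℕ, |v.r| * (q : ℚ) ^ k = N :=
      ⟨by omega, (exists_nat_iff hr le_rfl).2 (by simp)⟩
    refine le_antisymm (Nat.sInf_le hmem) (le_csInf ⟨k, hmem⟩ ?_)
    -- If fewer positions sufficed on the right, `q` would divide `N` and the digit at `-k` would
    -- vanish.
    rintro b ⟨hb1, hb2⟩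
    by_contra! hbk
    rw [exists_nat_iff hr hbk.le] at hb2
    rcases hk with hk | hk | hk
    · have h3 := h2 0 (by omega)
      have h4 : q ∣ N := (dvd_pow_self q (by omega)).trans hb2
      rw [pow_zero, Nat.div_one, Nat.mod_eq_zero_of_dvd h4] at h3
      simp at h3
      exact hk h3.symm
    · omega
    · omega
  · intro i hi hi'
    rw [digit_eq hr hi, h2 _ (by omega)]
    congr 1
    omega

theorem pe_eq (v : BS q) : v.pe = Sum.inl (decide (v.r < 0)) ::
    (List.range (v.hi + v.lo + 1)).map fun j : ℕ =>
      Sum.inr (v.digit (v.hi - j), decide ((v.hi : ℤ) - j = 0), decide ((v.hi : ℤ) - j = v.m)) := by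
  simp [pe, ← List.map_eq_flatMap]

theorem exists_pow_gt (x : ℚ) : ∃ n : ℕ, x < (q : ℚ) ^ n :=
  pow_unbounded_of_one_lt x (by have := Nat.AtLeastTwo.prop (n := q); exact_mod_cast this)

/-- The properties of the pointed expansion. -/
theorem expansion_spec (v : BS q) :
    |v.r| = ∑ i ∈ Finset.Icc (-v.lo : ℤ) v.hi, ((v.digit i : ℕ) : ℚ) * (q : ℚ) ^ i ∧
      -v.lo ≤ v.m ∧ v.m ≤ v.hi ∧ ((v.digit v.hi : ℕ) ≠ 0 ∨ v.hi = 0 ∨ v.m = v.hi) ∧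
      ((v.digit (-v.lo) : ℕ) ≠ 0 ∨ v.lo = 0 ∨ v.m = -v.lo) := by
  have hq2 := Nat.AtLeastTwo.prop (n := q)
  have hq : (0 : ℚ) < q := by exact_mod_cast (by omega)
  have hhi : v.m ≤ v.hi ∧ |v.r| < (q : ℚ) ^ (v.hi + 1) := by
    refine Nat.sInf_mem (s := {k : ℕ | v.m ≤ k ∧ |v.r| < (q : ℚ) ^ (k + 1)}) ?_
    obtain ⟨n, hn⟩ := exists_pow_gt (q := q) |v.r|
    refine ⟨n + v.m.toNat, by push_cast; omega, hn.trans_le ?_⟩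
    exact pow_le_pow_right₀ (by exact_mod_cast (by omega)) (by omega)
  have hlo : -v.m ≤ v.lo ∧ ∃ N : ℕ, |v.r| * (q : ℚ) ^ v.lo = N := by
    refine Nat.sInf_mem (s := {k : ℕ | -v.m ≤ k ∧ ∃ N : ℕ, |v.r| * (q : ℚ) ^ k = N}) ?_
    obtain ⟨n, i, hr⟩ := v.r_mem
    refine ⟨(-i).toNat + (-v.m).toNat, by push_cast; omega,
      n.natAbs * q ^ (i + ((-i).toNat + (-v.m).toNat : ℕ)).toNat, ?_⟩
    have : |(q : ℚ) ^ i| = (q : ℚ) ^ i := abs_of_pos (by positivity)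
    rw [hr, abs_mul, this, mul_assoc, ← zpow_natCast, ← zpow_add₀ hq.ne']
    push_cast
    rw [Nat.cast_natAbs, Int.cast_abs, ← zpow_natCast]
    congr 2
    omega
  obtain ⟨hlo, N, hN⟩ := hlo
  replace hN : |v.r| = N * (q : ℚ) ^ (-v.lo : ℤ) := by
    rw [← hN, mul_assoc, zpow_neg, zpow_natCast, mul_inv_cancel₀ (by positivity), mul_one]
  have hNlt : N < q ^ (v.hi + v.lo + 1) := by
    rw [show v.hi + v.lo + 1 = v.hi + 1 + v.lo by ring]
    exact (abs_lt_pow_iff hN).1 hhi.2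
  refine ⟨?_, by omega, hhi.1, ?_, ?_⟩
  · rw [sum_Icc_zpow_eq fun i => (v.digit i : ℕ), hN]
    congr 2
    conv_lhs => rw [← Nat.sum_digit_mul_pow q N _ hNlt]
    refine Finset.sum_congr rfl fun j hj => ?_
    rw [digit_eq hN (by omega), show ((j : ℤ) - v.lo + v.lo).toNat = j by omega]
  · by_contra! hc
    obtain ⟨h1, h2, h3⟩ := hc
    rw [digit_eq hN (by omega), show ((v.hi : ℤ) + v.lo).toNat = v.hi + v.lo by omega,
      Nat.mod_eq_of_lt (by
        rw [Nat.div_lt_iff_lt_mul (by positivity)]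
        rwa [pow_succ, mul_comm] at hNlt), Nat.div_eq_zero_iff] at h1
    have h4 : N < q ^ (v.hi + v.lo) := by
      rcases h1 with h1 | h1
      · exact absurd h1 (by positivity)
      · exact h1
    -- With a zero digit at the top and neither mark there, `v.hi - 1` would meet both conditions,
    -- against minimality.
    have h5 : v.hi ≤ v.hi - 1 := Nat.sInf_le (by
      refine ⟨by omega, ?_⟩
      rwa [show v.hi - 1 + 1 = v.hi by omega, abs_lt_pow_iff hN])
    omega
  · by_contra! hc
    obtain ⟨h1, h2, h3⟩ := hc
    rw [digit_eq hN (by omega), show (-(v.lo : ℤ) + v.lo).toNat = 0 by omega, pow_zero,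
      Nat.div_one] at h1
    have h5 : v.lo ≤ v.lo - 1 := Nat.sInf_le (by
      refine ⟨by omega, ?_⟩
      rw [exists_nat_iff hN (by omega), show v.lo - (v.lo - 1) = 1 by omega, pow_one]
      exact Nat.dvd_of_mod_eq_zero h1)
    omega

end BS

/-! ### The shape of pointed expansions -/

/-- The digits with their decorations. -/
abbrev PEDigit (q : ℕ) : Type := Fin q × Bool × Bool

namespace PEDigit

variable {q : ℕ}

/-- The digit may be the first or the last one of a pointed expansion. -/
def Sig (x : PEDigit q) : Prop := (x.1 : ℕ) ≠ 0 ∨ x.2.1 = true ∨ x.2.2 = true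

instance (x : PEDigit q) : Decidable x.Sig := inferInstanceAs (Decidable (_ ∨ _))

/-- The number with the given digits, where the first one is at level `i` and the other ones are
above it. -/
def sum (i : ℤ) : List (Option (PEDigit q)) → ℚ
  | [] => 0
  | x :: H => (x.elim 0 fun y => (y.1 : ℕ) : ℕ) * (q : ℚ) ^ i + sum (i + 1) H

/-- The radix point is at level `0` and the cursor is at level `m`. -/
def Marked (i m : ℤ) : List (Option (PEDigit q)) → Prop
  | [] => True
  | x :: H => (∀ y ∈ x, (y.2.1 = true → i = 0) ∧ (y.2.2 = true → i = m)) ∧ Marked (i + 1) m H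

theorem sum_replicate_append (i : ℤ) (n : ℕ) (H : List (Option (PEDigit q))) :
    sum i (List.replicate n none ++ H) = sum (i + n) H := by
  induction n generalizing i with
  | zero => simp
  | succ n ih =>
    rw [List.replicate_succ, List.cons_append, sum, ih]
    simp [add_assoc, add_comm (1 : ℤ)]

theorem sum_append_replicate (i : ℤ) (n : ℕ) (H : List (Option (PEDigit q))) :
    sum i (H ++ List.replicate n none) = sum i H := by
  induction H generalizing i with
  | nil =>
    have := sum_replicate_append i n ([] : List (Option (PEDigit q)))
    simpa [sum] using this
  | cons x H ih => simp [sum, ih]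

theorem sum_map_some [q.AtLeastTwo] (i : ℤ) (D : List (PEDigit q)) :
    sum i (D.map some) = (∑ j ∈ Finset.range D.length,
      (D[j]?.elim 0 fun y => (y.1 : ℕ)) * q ^ j : ℕ) * (q : ℚ) ^ i := by
  induction D generalizing i with
  | nil => simp [sum]
  | cons x D ih =>
    rw [List.map_cons, sum, ih, List.length_cons, Finset.sum_range_succ',
      zpow_add_one₀ (BS.natCast_ne_zero q)]
    simp only [List.getElem?_cons_succ, List.getElem?_cons_zero, Option.elim_some, pow_zero,
      mul_one, pow_succ, ← mul_assoc, ← Finset.sum_mul]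
    push_cast
    ring

theorem marked_replicate_append (i m : ℤ) (n : ℕ) (H : List (Option (PEDigit q))) :
    Marked i m (List.replicate n none ++ H) ↔ Marked (i + n) m H := by
  induction n generalizing i with
  | zero => simp
  | succ n ih =>
    rw [List.replicate_succ, List.cons_append, Marked, ih]
    simp [add_assoc, add_comm (1 : ℤ)]

theorem marked_append_replicate (i m : ℤ) (n : ℕ) (H : List (Option (PEDigit q))) :
    Marked i m (H ++ List.replicate n none) ↔ Marked i m H := by
  induction H generalizing i with
  | nil =>
    have := marked_replicate_append i m n ([] : List (Option (PEDigit q)))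
    simpa [Marked] using this
  | cons x H ih => simp [Marked, ih]

theorem marked_map_some (i m : ℤ) (D : List (PEDigit q)) (h : ∀ (j : ℕ) (x : PEDigit q),
    D[j]? = some x → (x.2.1 = true → i + j = 0) ∧ (x.2.2 = true → i + j = m)) :
    Marked i m (D.map some) := by
  induction D generalizing i with
  | nil => trivial
  | cons x D ih =>
    refine ⟨fun y hy => ?_, ih (i + 1) fun j y hy => ?_⟩
    · obtain rfl : x = y := by simpa using hy
      simpa using h 0 x (by simp)
    · have := h (j + 1) y (by simpa using hy)
      push_cast at this
      rwa [add_assoc, add_comm 1]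

theorem _root_.List.exists_index_of_countP_eq_one {α : Type*} {p : α → Bool} {l : List α}
    (h : l.countP p = 1) :
    ∃ j < l.length, ∀ (j' : ℕ) (x : α), l[j']? = some x → (p x = true ↔ j' = j) := by
  induction l with
  | nil => simp at h
  | cons x l ih =>
    by_cases hx : p x = true
    · rw [List.countP_cons_of_pos hx] at h
      have h0 : l.countP p = 0 := by omega
      rw [List.countP_eq_zero] at h0
      refine ⟨0, by simp, fun j' y hy => ?_⟩
      cases j' with
      | zero =>
        obtain rfl : x = y := by simpa using hy
        simpa using hx
      | succ j' =>
        have := h0 y (List.mem_of_getElem? (by simpa using hy))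
        simpa using this
    · rw [List.countP_cons_of_neg hx] at h
      obtain ⟨j, hj, hj'⟩ := ih h
      refine ⟨j + 1, by simpa using hj, fun j' y hy => ?_⟩
      cases j' with
      | zero =>
        obtain rfl : x = y := by simpa using hy
        simpa using hx
      | succ j' =>
        rw [hj' j' y (by simpa using hy)]
        simp

/-- A list of digits of the right shape is a pointed expansion. -/
theorem exists_pe [q.AtLeastTwo] {D : List (PEDigit q)} (hr : D.countP (fun x => x.2.1) = 1)
    (hc : D.countP (fun x => x.2.2) = 1) (hhead : ∀ x ∈ D.head?, x.Sig)
    (hlast : ∀ x ∈ D.getLast?, x.Sig) (s : Bool) (hs : s = true → ∃ x ∈ D, (x.1 : ℕ) ≠ 0)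
    (a b : ℕ) :
    ∃ (v : BS q) (i : ℤ), v.pe = Sum.inl s :: D.reverse.map Sum.inr ∧
      Marked i v.m (List.replicate b none ++ (D.map some ++ List.replicate a none)) ∧
      v.r = (if s then -1 else 1) *
        sum i (List.replicate b none ++ (D.map some ++ List.replicate a none)) := by
  have hq2 := Nat.AtLeastTwo.prop (n := q)
  have hq : (0 : ℚ) < q := by exact_mod_cast (by omega)
  obtain ⟨k, hk, hk'⟩ := List.exists_index_of_countP_eq_one hr
  obtain ⟨l, hl, hl'⟩ := List.exists_index_of_countP_eq_one hc
  -- The radix point has index `k` counted from the lowest digit, so the digits occupy the levels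
  -- from `-k` to `h`, and the cursor, with index `l`, is at level `l - k`.
  obtain ⟨h, hh⟩ : ∃ h, h + k + 1 = D.length := ⟨D.length - 1 - k, by omega⟩
  let f : ℤ → ℕ := fun i => D[(i + k).toNat]?.elim 0 fun y => (y.1 : ℕ)
  have hf : ∀ i, f i < q := by
    intro i
    simp only [f]
    cases D[(i + k).toNat]? with
    | none => simp; omega
    | some y => simp
  have hsum := sum_Icc_zpow_eq (q := q) f h k
  have hsum' : sum (-k) (D.map some) = ∑ i ∈ Finset.Icc (-k : ℤ) h, (f i : ℚ) * (q : ℚ) ^ i := by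
    rw [hsum, sum_map_some, hh]
    congr 2
    refine Finset.sum_congr rfl fun j _ => ?_
    simp [f]
  set Z := ∑ i ∈ Finset.Icc (-k : ℤ) h, (f i : ℚ) * (q : ℚ) ^ i with hZ
  have hZ0 : 0 ≤ Z := Finset.sum_nonneg fun i _ => by positivity
  have hZs : s = true → 0 < Z := by
    intro hs'
    obtain ⟨x, hx, hx0⟩ := hs hs'
    obtain ⟨j, hj, hjx⟩ := List.mem_iff_getElem.1 hx
    refine Finset.sum_pos' (fun i _ => by positivity) ⟨j - k, by simp; omega, ?_⟩
    have : f (j - k) = x.1 := by simp [f, hj, hjx]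
    rw [this]
    have : (0 : ℚ) < ((x.1 : ℕ) : ℚ) := by exact_mod_cast Nat.pos_of_ne_zero hx0
    positivity
  let v : BS q := ⟨(if s then -1 else 1) * Z, (l : ℤ) - k, (if s then -1 else 1) *
    ((∑ j ∈ Finset.range (h + k + 1), f (j - k) * q ^ j : ℕ) : ℤ), -k, by
      rw [hsum]; push_cast; split_ifs <;> simp⟩
  have hvabs : |v.r| = Z := by
    simp only [v]
    split_ifs
    · rw [neg_one_mul, abs_neg, abs_of_nonneg hZ0]
    · rw [one_mul, abs_of_nonneg hZ0]
  have hvneg : decide (v.r < 0) = s := by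
    simp only [v]
    cases s
    · simpa using hZ0
    · simpa using hZs rfl
  have hvm : v.m = (l : ℤ) - k := rfl
  have hget : ∀ i : ℤ, -k ≤ i → i ≤ h → ∃ x, D[(i + k).toNat]? = some x ∧ f i = x.1 ∧
      (x.2.1 = true ↔ i = 0) ∧ (x.2.2 = true ↔ i = v.m) := by
    intro i hi hi'
    have hlt : (i + k).toNat < D.length := by omega
    refine ⟨D[(i + k).toNat], by simp [hlt], by simp [f, hlt], ?_, ?_⟩
    · rw [hk' (i + k).toNat _ (by simp [hlt])]; omega
    · rw [hl' (i + k).toNat _ (by simp [hlt])]; omega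
  obtain ⟨e1, e2, e3⟩ := BS.hi_lo_digit_eq (v := v) hf hvabs (by omega) (by omega) (by
      obtain ⟨x, h1, h2, h3, h4⟩ := hget h (by omega) le_rfl
      have := hlast x (by
        rw [List.getLast?_eq_getElem?, Option.mem_def, ← h1]
        congr 1
        omega)
      rcases this with this | this | this
      · left; rwa [h2]
      · right; left; have := h3.1 this; omega
      · right; right; exact (h4.1 this).symm) (by
      obtain ⟨x, h1, h2, h3, h4⟩ := hget (-k) le_rfl (by omega)
      have := hhead x (by
        rw [List.head?_eq_getElem?, Option.mem_def, ← h1]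
        simp)
      rcases this with this | this | this
      · left; rwa [h2]
      · right; left; have := h3.1 this; omega
      · right; right; exact (h4.1 this).symm)
  -- The `b` blank levels lie below the lowest digit, which is at level `-k`.
  refine ⟨v, -k - b, ?_, ?_, ?_⟩
  · rw [BS.pe_eq, hvneg, e1, e2]
    congr 1
    refine List.ext_getElem (by simp [hh]) fun j hj hj' => ?_
    simp only [List.length_map, List.length_range] at hj
    obtain ⟨x, h1, h2, h3, h4⟩ := hget ((h : ℤ) - j) (by omega) (by omega)
    have h5 := e3 ((h : ℤ) - j) (by omega) (by omega)
    simp only [List.getElem_map, List.getElem_range, List.getElem_reverse]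
    have h6 : D[D.length - 1 - j]? = some x := by
      rw [← h1]
      congr 1
      omega
    rw [List.getElem?_eq_getElem (by omega), Option.some_inj] at h6
    rw [h6]
    congr 1
    refine Prod.ext (Fin.ext (h5.trans h2)) (Prod.ext ?_ ?_)
    · rw [Bool.eq_iff_iff, decide_eq_true_eq]; exact h3.symm
    · rw [Bool.eq_iff_iff, decide_eq_true_eq]; exact h4.symm
  · rw [marked_replicate_append, marked_append_replicate, sub_add_cancel]
    refine marked_map_some _ _ _ fun j x hx => ⟨fun h => ?_, fun h => ?_⟩
    · have := (hk' j x hx).1 h; omega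
    · have := (hl' j x hx).1 h; omega
  · rw [sum_replicate_append, sum_append_replicate, sub_add_cancel, hsum']

end PEDigit

/-! ### The sweep with output -/

/-- What is remembered about the output: whether the sign (mode `0`), the first digit (mode `1`) or
the last digit (mode `2`) has yet to be written; the sign; whether the radix point, the cursor and a
nonzero digit have been written; whether the last digit is a zero without decorations; and whether
the radix point and the cursor are at the current level. -/
abbrev Phase : Type := Fin 4 × Bool × Bool × Bool × Bool × Bool × Bool × Bool

namespace Phase

variable {q : ℕ}

/-- The signed digit. -/
def signed (s : Bool) (d : ℕ) : ℤ := if s then -d else d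

/-- The passage to the next level, with the given output; the result is the new phase and the signed
digit at the new level. -/
def next : Phase → Option (PELetter q) → Option (Phase × ℤ)
  | (mode, _, _), some (.inl s) =>
    if mode = 0 then some ((1, s, false, false, false, false, false, false), 0) else none
  | (mode, s, r, c, nz, lz, _, _), none =>
    if mode = 0 ∨ (mode = 2 ∧ lz = true) then none
    else some ((if mode = 1 then 1 else 3, s, r, c, nz, lz, false, false), 0)
  | (mode, s, r, c, nz, _, _, _), some (.inr x) =>
    if ((mode = 1 ∧ PEDigit.Sig x) ∨ mode = 2) ∧ ¬(x.2.1 = true ∧ r = true) ∧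
      ¬(x.2.2 = true ∧ c = true) then
      some ((2, s, x.2.1 || r, x.2.2 || c, decide ((x.1 : ℕ) ≠ 0) || nz, !decide (PEDigit.Sig x),
        x.2.1, x.2.2), signed s x.1)
    else none

/-- The output is complete. -/
def Final : Phase → Prop
  | (_, s, r, c, nz, lz, _, _) => r = true ∧ c = true ∧ lz = false ∧ (s = true → nz = true)

instance : DecidablePred Final := fun _ => inferInstanceAs (Decidable (_ ∧ _))

/-- The meaning of a phase, where `D` are the digits that have been written, `H` are these digits
together with the levels above and below, and `W` is the output. -/
def Meaning (D : List (PEDigit q)) (H : List (Option (PEDigit q))) (W : List (PELetter q)) :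
    Phase → Prop
  | (mode, s, r, c, nz, lz, R, C) =>
    (mode = 0 → H = [] ∧ W = []) ∧ (mode ≠ 0 → W = .inl s :: D.reverse.map .inr) ∧
    (mode = 0 ∨ mode = 1 → D = [] ∧ r = false ∧ c = false ∧ nz = false ∧ lz = false) ∧
    (∃ a b : ℕ, H = List.replicate b none ++ (D.map some ++ List.replicate a none) ∧
      (mode ≠ 3 → b = 0)) ∧ (mode = 2 → D ≠ []) ∧
    D.countP (fun x => x.2.1) = (if r then 1 else 0) ∧
    D.countP (fun x => x.2.2) = (if c then 1 else 0) ∧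
    (nz = true → ∃ x ∈ D, (x.1 : ℕ) ≠ 0) ∧ (lz = false → ∀ x ∈ D.head?, x.Sig) ∧
    (∀ x ∈ D.getLast?, x.Sig) ∧
    (R = true → ∃ y, H.head? = some (some y) ∧ y.2.1 = true) ∧
    (C = true → ∃ y, H.head? = some (some y) ∧ y.2.2 = true)

/-- The digit at the current level. -/
def letterDigit : Option (PELetter q) → Option (PEDigit q)
  | some (.inr x) => some x
  | _ => none

/-- Blank levels before the first digit are counted by `a`, those after the last digit by `b`, and
the mode keeps them from being mixed with digits. The sign can only change in the first move, when
`H = []` and no digit depends on it. -/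
theorem Meaning.next {D : List (PEDigit q)} {H : List (Option (PEDigit q))}
    {W : List (PELetter q)} {φ φ' : Phase} (h : Meaning D H W φ) {o : Option (PELetter q)} {d : ℤ}
    (hn : φ.next o = some (φ', d)) :
    (∃ D', Meaning D' (letterDigit o :: H) (W ++ o.toList) φ') ∧
      d = signed φ'.2.1 ((letterDigit o).elim 0 fun y => (y.1 : ℕ)) ∧
      (φ.2.1 = φ'.2.1 ∨ H = []) := by
  obtain ⟨mode, s, r, c, nz, lz, R, C⟩ := φ
  obtain ⟨h1, h2, h3, ⟨a, b, rfl, hb⟩, hD, h5, h6, h7, h8, h9, -, -⟩ := h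
  rcases o with _ | s' | x
  · simp only [Phase.next] at hn
    by_cases hm : mode = 0 ∨ (mode = 2 ∧ lz = true)
    · rw [if_pos hm] at hn
      simp at hn
    rw [if_neg hm] at hn
    obtain ⟨rfl, rfl⟩ : _ ∧ _ := by simpa using hn
    simp only [not_or] at hm
    refine ⟨⟨D, ?_⟩, by simp [signed, letterDigit], .inl rfl⟩
    refine ⟨?_, ?_, ?_, ?_, by split_ifs <;> simp, h5, h6, h7, h8, h9, by simp, by simp⟩
    · split_ifs <;> simp
    · intro _
      simpa using h2 hm.1
    · intro hm'
      refine h3 (.inr ?_)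
      split_ifs at hm' with hm''
      · exact hm''
      · simp at hm'
    · by_cases hm1 : mode = 1
      · obtain ⟨rfl, -⟩ := h3 (.inr hm1)
        obtain rfl := hb (by rw [hm1]; decide)
        exact ⟨a + 1, 0, by simp [letterDigit, List.replicate_succ], by simp⟩
      · exact ⟨a, b + 1, by simp [letterDigit, List.replicate_succ], by simp [hm1]⟩
  · simp only [Phase.next] at hn
    split_ifs at hn with hm
    obtain ⟨rfl, rfl⟩ : _ ∧ _ := by simpa using hn
    obtain ⟨rfl, -⟩ := h3 (.inl hm)
    obtain ⟨hH, rfl⟩ := h1 hm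
    rw [hH]
    refine ⟨⟨[], ?_⟩, by simp [signed, letterDigit], .inr rfl⟩
    -- Writing the sign is also a passage to a level, which becomes a first blank level at the top.
    exact ⟨by simp, by simp, by simp, ⟨1, 0, by simp [letterDigit], by simp⟩, by simp, by simp, by simp,
      by simp, by simp, by simp, by simp, by simp⟩
  · simp only [Phase.next] at hn
    split_ifs at hn with hm
    obtain ⟨rfl, rfl⟩ : _ ∧ _ := by simpa using hn
    obtain ⟨hm, hr, hc⟩ := hm
    have hm0 : mode ≠ 0 := by rintro rfl; simp at hm
    have hm3 : mode ≠ 3 := by rintro rfl; simp at hm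
    obtain rfl := hb hm3
    refine ⟨⟨x :: D, ?_⟩, by simp [letterDigit], .inl rfl⟩
    refine ⟨by simp, ?_, by simp, ⟨a, 0, by simp [letterDigit], by simp⟩, by simp, ?_, ?_, ?_, ?_, ?_, ?_, ?_⟩
    · intro _
      simp [h2 hm0]
    · rw [List.countP_cons, h5]
      rcases x with ⟨x, _ | _, x'⟩ <;> cases r <;> simp at hr ⊢
    · rw [List.countP_cons, h6]
      rcases x with ⟨x, x', _ | _⟩ <;> cases c <;> simp at hc ⊢
    · intro hnz
      rcases Bool.or_eq_true_iff.1 hnz with h | h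
      · exact ⟨x, by simp, by simpa using h⟩
      · obtain ⟨y, hy, hy'⟩ := h7 h
        exact ⟨y, by simp [hy], hy'⟩
    · intro hl y hy
      obtain rfl : x = y := by simpa using hy
      simpa using hl
    · intro y hy
      cases D with
      | nil =>
        obtain rfl : x = y := by simpa using hy
        rcases hm with hm | hm
        · exact hm.2
        · exact absurd rfl (hD hm)
      | cons z D => exact h9 y (by simpa using hy)
    · intro h
      exact ⟨x, by simp [letterDigit], h⟩
    · intro h
      exact ⟨x, by simp [letterDigit], h⟩

theorem Meaning.exists_pe [q.AtLeastTwo] {D : List (PEDigit q)} {H : List (Option (PEDigit q))}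
    {W : List (PELetter q)} {φ : Phase} (h : Meaning D H W φ) (hφ : φ.Final) :
    ∃ (v : BS q) (i : ℤ), v.pe = W ∧ PEDigit.Marked i v.m H ∧
      v.r = (if φ.2.1 then -1 else 1) * PEDigit.sum i H := by
  obtain ⟨mode, s, r, c, nz, lz, R, C⟩ := φ
  obtain ⟨h1, h2, h3, ⟨a, b, rfl, hb⟩, hD, h5, h6, h7, h8, h9, -, -⟩ := h
  obtain ⟨rfl, rfl, rfl, hs⟩ := hφ
  have hm : mode ≠ 0 := fun hm => by simpa using h3 (.inl hm)
  rw [h2 hm]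
  exact PEDigit.exists_pe h5 h6 (h8 rfl) h9 s (fun h => h7 (hs h)) a b

/-- The phase after level `i` in the sweep for `v`. -/
noncomputable def ofLevel [q.AtLeastTwo] (v : BS q) (i : ℤ) : Phase :=
  if v.hi < i then (1, decide (v.r < 0), false, false, false, false, false, false)
  else if -v.lo ≤ i then
    (2, decide (v.r < 0), decide (i ≤ 0), decide (i ≤ v.m),
      decide (∃ j ∈ Finset.Icc i v.hi, (v.digit j : ℕ) ≠ 0),
      !decide (PEDigit.Sig (v.digit i, decide (i = 0), decide (i = v.m))), decide (i = 0),
      decide (i = v.m))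
  else (3, decide (v.r < 0), true, true,
    decide (∃ j ∈ Finset.Icc (-v.lo : ℤ) v.hi, (v.digit j : ℕ) ≠ 0), false, false, false)

/-- The output at level `i` in the sweep for `v`. -/
noncomputable def letter [q.AtLeastTwo] (v : BS q) (i : ℤ) : Option (PELetter q) :=
  if -v.lo ≤ i ∧ i ≤ v.hi then some (.inr (v.digit i, decide (i = 0), decide (i = v.m))) else none

/-- The signed digit at level `i` in the sweep for `v`. -/
noncomputable def coeff [q.AtLeastTwo] (v : BS q) (i : ℤ) : ℤ :=
  if -v.lo ≤ i ∧ i ≤ v.hi then signed (decide (v.r < 0)) (v.digit i) else 0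

/-- The expansion of `v` passes all tests of `next`: by the minimality of `hi` and `lo`, its first
and last digits are nonzero or decorated, and the levels `0` and `v.m` of the two marks lie between
`-v.lo` and `v.hi`. -/
theorem next_ofLevel [q.AtLeastTwo] (v : BS q) (i : ℤ) :
    (ofLevel v (i + 1)).next (letter v i) = some (ofLevel v i, coeff v i) := by
  obtain ⟨-, h1, h2, h3, h4⟩ := v.expansion_spec
  rcases lt_or_ge (v.hi : ℤ) i with hi | hi
  · have e1 : (v.hi : ℤ) < i + 1 := by omega
    have e2 : ¬(-v.lo ≤ i ∧ i ≤ v.hi) := by omega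
    simp [ofLevel, letter, coeff, hi, e1, e2, next]
  rcases lt_or_ge i (-v.lo) with hl | hl
  · have e1 : ¬ (v.hi : ℤ) < i + 1 := by omega
    have e2 : ¬(-v.lo ≤ i ∧ i ≤ v.hi) := by omega
    have e3 : ¬(-v.lo ≤ i) := by omega
    have e4 : ¬ (v.hi : ℤ) < i := by omega
    by_cases hl' : -v.lo ≤ i + 1
    · have hlo : -(v.lo : ℤ) = i + 1 := by omega
      have e5 : PEDigit.Sig (v.digit (i + 1), decide (i + 1 = 0), decide (i + 1 = v.m)) := by
        simp only [PEDigit.Sig, decide_eq_true_eq, ← hlo]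
        rcases h4 with h | h | h
        · exact .inl h
        · right; left; omega
        · right; right; omega
      have e6 : i + 1 ≤ v.m := by omega
      have e7 : i + 1 ≤ 0 := by omega
      have e8 : ¬ i + 1 ≤ i := by omega
      simp [ofLevel, letter, coeff, e1, e4, e5, e6, e7, e8, hlo, next]
    · simp [ofLevel, letter, coeff, e1, e3, e4, hl', next]
  · have e2 : (-v.lo ≤ i ∧ i ≤ v.hi) := by omega
    have e4 : ¬ (v.hi : ℤ) < i := by omega
    by_cases hi' : (v.hi : ℤ) < i + 1
    · obtain rfl : i = v.hi := by omega
      have e5 : PEDigit.Sig (v.digit v.hi, decide ((v.hi : ℤ) = 0), decide ((v.hi : ℤ) = v.m)) := by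
        simp only [PEDigit.Sig, decide_eq_true_eq]
        rcases h3 with h | h | h
        · exact .inl h
        · right; left; omega
        · right; right; omega
      simp only [ofLevel, letter, coeff, hi', e2, e4, next, e5, if_true, if_false, and_self]
      simp
      constructor
      · omega
      · omega
    · have e5 : -v.lo ≤ i + 1 := by omega
      simp only [ofLevel, letter, coeff, hi', e2, e4, next, e5, if_true, if_false, and_self]
      rw [if_pos]
      · simp only [Option.some_inj, Prod.mk.injEq, true_and, and_true]
        refine ⟨?_, ?_, ?_⟩
        · rw [Bool.eq_iff_iff]; simp; omega
        · rw [Bool.eq_iff_iff]; simp; omega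
        · rw [Bool.eq_iff_iff]
          simp only [Bool.or_eq_true, decide_eq_true_eq, Finset.mem_Icc]
          constructor
          · rintro (h | ⟨j, h, h'⟩)
            exacts [⟨i, by omega, h⟩, ⟨j, by omega, h'⟩]
          · rintro ⟨j, h, h'⟩
            rcases eq_or_ne j i with rfl | hj
            exacts [.inl h', .inr ⟨j, by omega, h'⟩]
      · simp; omega

/-- Both marks have been passed at the lowest digit, this digit is nonzero or decorated, and a
negative number has a nonzero digit. -/
theorem final_ofLevel [q.AtLeastTwo] (v : BS q) {i : ℤ} (hi : i ≤ -v.lo) : (ofLevel v i).Final := by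
  obtain ⟨h0, h1, h2, h3, h4⟩ := v.expansion_spec
  have key : v.r < 0 → ∃ j ∈ Finset.Icc (-v.lo : ℤ) v.hi, (v.digit j : ℕ) ≠ 0 := by
    intro hr
    by_contra! hc
    rw [Finset.sum_eq_zero fun j hj => by rw [hc j hj]; simp] at h0
    exact hr.ne (abs_eq_zero.1 h0)
  have e4 : ¬ (v.hi : ℤ) < i := by omega
  by_cases hi' : -v.lo ≤ i
  · obtain rfl : i = -v.lo := by omega
    simp only [ofLevel, e4, le_refl, if_true, if_false, Final, decide_eq_true_eq, 
      Bool.not_eq_false']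
    refine ⟨by omega, h1, ?_, key⟩
    rcases h4 with h | h | h
    · exact .inl h
    · right; left; simp [h]
    · right; right; simp [h]
  · simp only [ofLevel, e4, hi', if_false, Final, decide_eq_true_eq, true_and]
    exact key

theorem reduceOption_letters [q.AtLeastTwo] (v : BS q) (a b : ℕ) :
    ((List.range (a + (v.hi + v.lo + 1) + b)).map fun j : ℕ =>
      letter v (v.hi + a - j)).reduceOption =
      (List.range (v.hi + v.lo + 1)).map fun j : ℕ =>
        Sum.inr (v.digit (v.hi - j), decide ((v.hi : ℤ) - j = 0), decide ((v.hi : ℤ) - j = v.m)) := by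
  have hnone : ∀ (n : ℕ) (f : ℕ → ℤ), (∀ j < n, letter v (f j) = none) →
      ((List.range n).map fun j => letter v (f j)).reduceOption = [] := by
    intro n f hf
    rw [List.map_congr_left (g := fun _ => none) fun j hj => hf j (by simpa using hj)]
    simp
  rw [List.range_add, List.range_add]
  simp only [List.map_append, List.reduceOption_append, List.map_map, Function.comp_def]
  rw [hnone a, hnone b fun j => _, List.nil_append, List.append_nil]
  · rw [List.map_congr_left (g := fun j : ℕ => some (Sum.inr (v.digit (v.hi - j),
      decide ((v.hi : ℤ) - j = 0), decide ((v.hi : ℤ) - j = v.m))))]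
    · rw [List.reduceOption, List.filterMap_map]
      exact congrFun List.filterMap_eq_map _
    · intro j hj
      rw [List.mem_range] at hj
      rw [show (v.hi : ℤ) + a - (a + j : ℕ) = v.hi - j by push_cast; ring, letter, if_pos (by omega)]
  · intro j hj
    rw [letter, if_neg (by push_cast; omega)]
  · intro j hj
    rw [letter, if_neg (by omega)]

theorem natAbs_coeff_le [q.AtLeastTwo] (v : BS q) (i : ℤ) : (coeff v i).natAbs ≤ q := by
  have := (v.digit i).isLt
  simp only [coeff, signed]
  split_ifs <;> omega

theorem eq_sum_coeff [q.AtLeastTwo] (v : BS q) {i₀ T : ℤ} (hi : i₀ ≤ -v.lo) (hT : v.hi ≤ T) :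
    v.r = ∑ i ∈ Finset.Icc i₀ T, coeff v i * (q : ℚ) ^ i := by
  obtain ⟨h0, -⟩ := v.expansion_spec
  rw [← Finset.sum_subset (Finset.Icc_subset_Icc hi hT)]
  · by_cases hr : v.r < 0
    · rw [← neg_neg v.r, ← abs_of_neg hr, h0, ← Finset.sum_neg_distrib]
      refine Finset.sum_congr rfl fun i hi => ?_
      simp [coeff, Finset.mem_Icc.1 hi, signed, hr]
    · rw [← abs_of_nonneg (not_lt.1 hr), h0]
      refine Finset.sum_congr rfl fun i hi => ?_
      simp [coeff, Finset.mem_Icc.1 hi, signed, hr]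
  · intro i _ hi
    rw [Finset.mem_Icc] at hi
    simp [coeff, hi]

end Phase

/-! ### Soundness and completeness of the sweep with output -/

namespace Sweep

open Core

variable {q : ℕ} {A : BSAutomaton} {G : List (ℕ × ℤ)}

/-- The possible outputs at a level. -/
noncomputable def letters (q : ℕ) : List (Option (PELetter q)) := Finset.univ.toList

/-- The transitions from a configuration. -/
noncomputable def succ (q : ℕ) (A : BSAutomaton) (G : List (ℕ × ℤ)) (x : Phase × Core) :
    List (Option (PELetter q) × Phase × Core) :=
  ((micro A G x.1.2.2.2.2.2.2.1 x.1.2.2.2.2.2.2.2 x.2).map fun κ => (none, x.1, κ)) ++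
  (letters q).flatMap fun o => (x.1.next o).toList.flatMap fun y =>
    (level q y.2 x.2).map fun κ => (o, y.1, κ)

theorem mem_succ {x y : Phase × Core} {o : Option (PELetter q)} :
    (o, y) ∈ succ q A G x ↔
      (o = none ∧ y.1 = x.1 ∧ Step A G x.1.2.2.2.2.2.2.1 x.1.2.2.2.2.2.2.2 x.2 y.2) ∨
      ∃ d, x.1.next o = some (y.1, d) ∧ y.2 ∈ level q d x.2 := by
  obtain ⟨φ, κ⟩ := y
  simp only [succ, List.mem_append, List.mem_map, List.mem_flatMap, letters, Finset.mem_toList,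
    Finset.mem_univ, true_and, Option.mem_toList, mem_micro, Prod.mk.injEq]
  constructor
  · rintro (⟨κ', h, rfl, rfl, rfl⟩ | ⟨o', ⟨φ', d⟩, h, κ', h', rfl, rfl, rfl⟩)
    exacts [.inl ⟨rfl, rfl, h⟩, .inr ⟨d, h, h'⟩]
  · rintro (⟨rfl, rfl, h⟩ | ⟨d, h, h'⟩)
    exacts [.inl ⟨κ, h, rfl, rfl, rfl⟩, .inr ⟨o, (φ, d), h, κ, h', rfl, rfl, rfl⟩]

/-- The first configuration. -/
def init : Phase × Core :=
  ((0, false, false, false, false, false, false, false), [], [], [], 0)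

theorem isRun_of_reach {M : ℕ} {R C : Bool} {κ κ' : Core} (h : Reach A G M R C κ κ') {φ : Phase}
    (hR : φ.2.2.2.2.2.2.1 = R) (hC : φ.2.2.2.2.2.2.2 = C) :
    ∃ l, IsRun {e : (Phase × Core) × Option (PELetter q) × Phase × Core |
      Bdd A.states M e.1.2 ∧ e.2 ∈ succ q A G e.1} (φ, κ) l (φ, κ') ∧ l.reduceOption = [] := by
  subst hR hC
  induction h with
  | refl => exact ⟨[], .nil _, rfl⟩
  | @tail κ₁ κ₂ _ h ih =>
    obtain ⟨l, h1, h2⟩ := ih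
    refine ⟨l ++ [none], h1.append (.cons ⟨h.1, ?_⟩ (.nil _)), by
      rw [List.reduceOption_append, h2]; rfl⟩
    exact mem_succ.2 (.inl ⟨rfl, rfl, h.2⟩)

/-- The meaning of a configuration with output `W`. -/
def Meaning (q : ℕ) [q.AtLeastTwo] (A : BSAutomaton) (W : List (PELetter q)) (x : Phase × Core) :
    Prop :=
  ∃ D H, x.1.Meaning D H W ∧ ∀ i m, PEDigit.Marked i m H →
    Tot q A i m x.2 (x.2.2.2.2 * (q : ℚ) ^ i + (if x.1.2.1 then -1 else 1) * PEDigit.sum i H)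

variable [q.AtLeastTwo]

theorem meaning_init : Meaning q A [] init := by
  refine ⟨[], [], ?_, fun i m _ => ?_⟩
  · simp only [init]
    exact ⟨by simp, by simp, by simp, ⟨0, 0, by simp, by simp⟩, by simp, by simp, by simp, by simp,
      by simp, by simp, by simp, by simp⟩
  · simpa [init, PEDigit.sum] using tot_init i m

/-- The machine does not know the number of its level, as the marks may still be to come. The
invariant is therefore claimed for all `i` and `m` that are compatible with the marks written so
far; the flags for the current level then force `i = 0` and `i = m`, as `start` and `newEnd`
require. On passage to the next level, the old invariant is used at `i + 1`. -/
theorem Meaning.succ (hG : ∀ g ∈ G, AbsPath q A.1 g.1 0 g.2 g.1 0) {W : List (PELetter q)}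
    {x y : Phase × Core} {o : Option (PELetter q)} (h : Meaning q A W x)
    (hy : (o, y) ∈ succ q A G x) : Meaning q A (W ++ o.toList) y := by
  obtain ⟨D, H, h1, h2⟩ := h
  rcases mem_succ.1 hy with ⟨rfl, h3, h4⟩ | ⟨d, h3, h4⟩
  · refine ⟨D, H, by simpa [h3] using h1, fun i m hm => ?_⟩
    have h5 := Tot.step hG ?_ ?_ (h2 i m hm) h4
    · rw [h3]
      convert h5 using 1
      ring
    · obtain ⟨⟨mode, s, r, c, nz, lz, R, C⟩, κ⟩ := x
      obtain ⟨-, -, -, -, -, -, -, -, -, -, h, -⟩ := h1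
      intro hR
      obtain ⟨z, hz, hz'⟩ := h hR
      cases H with
      | nil => simp at hz
      | cons w H =>
        obtain rfl : w = some z := by simpa using hz
        exact (hm.1 z rfl).1 hz'
    · obtain ⟨⟨mode, s, r, c, nz, lz, R, C⟩, κ⟩ := x
      obtain ⟨-, -, -, -, -, -, -, -, -, -, -, h⟩ := h1
      intro hR
      obtain ⟨z, hz, hz'⟩ := h hR
      cases H with
      | nil => simp at hz
      | cons w H =>
        obtain rfl : w = some z := by simpa using hz
        exact (hm.1 z rfl).2 hz'
  · obtain ⟨⟨D', h5⟩, h6, h7⟩ := h1.next h3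
    refine ⟨D', _, h5, fun i m hm => ?_⟩
    obtain ⟨h8, h9⟩ := (h2 (i + 1) m hm.2).level h4
    convert h8 using 1
    rw [h9, PEDigit.sum, h6, zpow_add_one₀ (BS.natCast_ne_zero q)]
    have h10 : (if x.1.2.1 then -1 else 1) * PEDigit.sum (i + 1) H =
        (if y.1.2.1 then -1 else 1) * PEDigit.sum (i + 1) H := by
      rcases h7 with h7 | h7
      · rw [h7]
      · simp [h7, PEDigit.sum]
    rw [h10]
    simp only [Phase.signed]
    split_ifs <;> push_cast <;> ring

theorem Meaning.isRun (hG : ∀ g ∈ G, AbsPath q A.1 g.1 0 g.2 g.1 0)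
    {x y : Phase × Core} {l : List (Option (PELetter q))}
    (hl : IsRun {e | e.2 ∈ Sweep.succ q A G e.1} x l y) {W : List (PELetter q)}
    (h : Meaning q A W x) : Meaning q A (W ++ l.reduceOption) y := by
  induction hl generalizing W with
  | nil p => simpa using h
  | @cons p p' p'' o l he _ ih =>
    have := ih (h.succ hG he)
    cases o <;> simpa using this

/-- Complete runs of the sweep write pointed expansions of accepted elements. -/
theorem mem_of_isRun (hG : ∀ g ∈ G, AbsPath q A.1 g.1 0 g.2 g.1 0) {φ : Phase} (hφ : φ.Final)
    {l : List (Option (PELetter q))}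
    (hl : IsRun {e | e.2 ∈ succ q A G e.1} init l (φ, [(none, none)], [], [], 0)) :
    l.reduceOption ∈ peLanguage (A.accepted q) := by
  obtain ⟨D, H, h1, h2⟩ := meaning_init.isRun (A := A) hG hl
  -- Only now is the level fixed, by the marks in the finished word. With carry `0` the invariant
  -- then yields a run that adds exactly `v.r`.
  obtain ⟨v, i, h3, h4, h5⟩ := h1.exists_pe hφ
  obtain ⟨w, hw, hr, hm⟩ := (h2 i v.m h4).final
  refine ⟨v, ⟨w, hw, ?_⟩, by simpa using h3⟩
  refine BS.ext ?_ (by simpa using hm)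
  rw [h5]
  simpa using hr

/-- Pointed expansions of accepted elements are written by complete runs of the sweep. -/
theorem exists_isRun {D : BoundTable} {K : ℕ} (hD : D.Closed q A.1 G A.states)
    (hG : D.Suffices G K) (hK : 1 ≤ K) (hGK : ∀ g ∈ G, g.2.natAbs ≤ K) {v : BS q}
    (hv : v ∈ A.accepted q) :
    ∃ (φ : Phase) (l : List (Option (PELetter q))), φ.Final ∧ l.reduceOption = v.pe ∧
      IsRun {e | Bdd A.states (bound q A G K) e.1.2 ∧ e.2 ∈ succ q A G e.1} init l
        (φ, [(none, none)], [], [], 0) := by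
  obtain ⟨w, hw, rfl⟩ := hv
  set v := (w.map (Gen.toBS q)).prod with hv
  obtain ⟨-, hlm, hmh, -⟩ := v.expansion_spec
  obtain ⟨i₀, T, h1, h2, -, κ, h3, h4, h5⟩ := exists_sweep (r := v.r) (m := v.m) hD hG hK hGK
    ⟨w, hw, by simp [hv], by simp [hv]⟩ (Phase.coeff v) (Phase.natAbs_coeff_le v) (-v.lo) v.hi
    fun i₀ T hi hT => Phase.eq_sum_coeff v hi hT
  have key : ∀ n : ℕ, (n : ℤ) ≤ T + 1 - i₀ → ∃ l, IsRun {e : (Phase × Core) ×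
      Option (PELetter q) × Phase × Core | Bdd A.states (bound q A G K) e.1.2 ∧
        e.2 ∈ succ q A G e.1} (Phase.ofLevel v (T + 1), κ (T + 1)) l
        (Phase.ofLevel v (T + 1 - n), κ (T + 1 - n)) ∧
      l.reduceOption = ((List.range n).map fun j : ℕ => Phase.letter v (T - j)).reduceOption := by
    intro n
    induction n with
    | zero => exact fun _ => ⟨[], by simpa using IsRun.nil _, by simp⟩
    | succ n ih =>
      intro hn
      obtain ⟨l, e1, e2⟩ := ih (by omega)
      obtain ⟨e3, κ', e4, e5⟩ := h5 (T - n) (by omega) (by omega)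
      rw [show T - (n : ℤ) + 1 = T + 1 - n by ring] at e3 e4
      obtain ⟨l', e6, e7⟩ := isRun_of_reach (q := q) (φ := Phase.ofLevel v (T - n))
        (e5 (Phase.ofLevel v (T - n)).2.2.2.2.2.2.1 (Phase.ofLevel v (T - n)).2.2.2.2.2.2.2
          (fun h => by
            rw [h, Phase.ofLevel, if_neg (by omega), if_pos (by omega)]
            simp)
          (fun h => by
            rw [h, Phase.ofLevel, if_neg (by omega), if_pos (by omega)]
            simp)) rfl rfl
      refine ⟨l ++ Phase.letter v (T - n) :: l', ?_, ?_⟩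
      · refine e1.append (.cons (p' := (Phase.ofLevel v (T - n), κ')) ⟨e3, mem_succ.2 (.inr ⟨Phase.coeff v (T - n), ?_, e4⟩)⟩ ?_)
        · rw [← Phase.next_ofLevel, show T - (n : ℤ) + 1 = T + 1 - n by ring]
        · rwa [show T + 1 - ((n + 1 : ℕ) : ℤ) = T - n by push_cast; ring]
      · rw [List.range_succ, List.map_append, List.reduceOption_append, List.reduceOption_append, e2]
        congr 1
        simp only [List.map_cons, List.map_nil, List.reduceOption_singleton]
        cases Phase.letter v (T - n) <;> simp [e7]
  obtain ⟨l, e1, e2⟩ := key (T + 1 - i₀).toNat (by omega)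
  obtain ⟨l', e3, e4⟩ := isRun_of_reach (q := q) (φ := Phase.ofLevel v (T + 1)) (h3 _ _) rfl rfl
  -- The first edge writes the sign and leads to level `T + 1`. There `l'` silently declares the
  -- pending states, and `l` goes through the levels from `T` down to `i₀`.
  refine ⟨Phase.ofLevel v i₀, some (.inl (decide (v.r < 0))) :: (l' ++ l),
    Phase.final_ofLevel v h1, ?_, ?_⟩
  · obtain ⟨a, ha⟩ := Int.eq_ofNat_of_zero_le (show 0 ≤ T - v.hi by omega)
    obtain ⟨b, hb⟩ := Int.eq_ofNat_of_zero_le (show 0 ≤ -v.lo - i₀ by omega)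
    have := Phase.reduceOption_letters v a b
    rw [BS.pe_eq, List.reduceOption_cons_of_some, List.reduceOption_append, e4, e2, ← this,
      show (T + 1 - i₀).toNat = a + (v.hi + v.lo + 1) + b by omega,
      show T = v.hi + a by omega]
    simp
  · refine .cons (p' := (Phase.ofLevel v (T + 1), [], [], [], 0)) ⟨?_, ?_⟩ (e3.append ?_)
    · exact ⟨by simp [init], by simp [init], by simp [init], by simp [init], by simp [init],
        by simp [init], by simp [init]⟩
    · refine mem_succ.2 (.inr ⟨0, ?_, by simp [init, level]⟩)
      have : (v.hi : ℤ) < T + 1 := by omega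
      simp [init, Phase.next, Phase.ofLevel, this]
    · rw [← h4]
      convert e1 using 3 <;> omega

end Sweep

/-! ### Primitive recursive functions -/

attribute [fun_prop] Primrec PrimrecPred

namespace Primrec

variable {α β γ σ : Type*} [Primcodable α] [Primcodable β] [Primcodable γ] [Primcodable σ]

@[fun_prop]
theorem fun_id : Primrec fun a : α => a := .id

@[fun_prop]
theorem fun_const (b : β) : Primrec fun _ : α => b := .const b

@[fun_prop]
theorem fun_comp {f : β → σ} {g : α → β} (hf : Primrec f) (hg : Primrec g) :
    Primrec fun a => f (g a) := hf.comp hg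

@[fun_prop]
theorem fun_fst {f : α → β × γ} (hf : Primrec f) : Primrec fun a => (f a).1 := fst.comp hf

@[fun_prop]
theorem fun_snd {f : α → β × γ} (hf : Primrec f) : Primrec fun a => (f a).2 := snd.comp hf

@[fun_prop]
theorem fun_pair {f : α → β} {g : α → γ} (hf : Primrec f) (hg : Primrec g) :
    Primrec fun a => (f a, g a) := hf.pair hg

@[fun_prop]
theorem fun_cons {f : α → β} {g : α → List β} (hf : Primrec f) (hg : Primrec g) :
    Primrec fun a => f a :: g a := list_cons.comp hf hg

@[fun_prop]
theorem fun_append {f g : α → List β} (hf : Primrec f) (hg : Primrec g) :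
    Primrec fun a => f a ++ g a := list_append.comp hf hg

@[fun_prop]
theorem fun_map {f : α → List β} {g : α → β → σ} (hf : Primrec f)
    (hg : Primrec fun p : α × β => g p.1 p.2) : Primrec fun a => (f a).map (g a) :=
  list_map hf hg

@[fun_prop]
theorem fun_flatMap {f : α → List β} {g : α → β → List σ} (hf : Primrec f)
    (hg : Primrec fun p : α × β => g p.1 p.2) : Primrec fun a => (f a).flatMap (g a) :=
  list_flatMap hf hg

@[fun_prop]
theorem fun_some {f : α → β} (hf : Primrec f) : Primrec fun a => some (f a) :=
  option_some.comp hf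

@[fun_prop]
theorem fun_head? {f : α → List β} (hf : Primrec f) : Primrec fun a => (f a).head? :=
  list_head?.comp hf

@[fun_prop]
theorem fun_tail {f : α → List β} (hf : Primrec f) : Primrec fun a => (f a).tail :=
  list_tail.comp hf

@[fun_prop]
theorem fun_length {f : α → List β} (hf : Primrec f) : Primrec fun a => (f a).length :=
  list_length.comp hf

@[fun_prop]
theorem fun_range {f : α → ℕ} (hf : Primrec f) : Primrec fun a => List.range (f a) :=
  list_range.comp hf

@[fun_prop]
theorem fun_toList {f : α → Option β} (hf : Primrec f) : Primrec fun a => (f a).toList :=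
  optionToList.comp hf

@[fun_prop]
theorem fun_encode {f : α → β} (hf : Primrec f) : Primrec fun a => Encodable.encode (f a) :=
  Primrec.encode.comp hf

@[fun_prop]
theorem fun_ite {p : α → Prop} [DecidablePred p] {f g : α → β} (hp : PrimrecPred p)
    (hf : Primrec f) (hg : Primrec g) : Primrec fun a => if p a then f a else g a :=
  ite hp hf hg

@[fun_prop]
theorem fun_filter {p : α → β → Prop} [∀ a, DecidablePred (p a)] {f : α → List β} (hf : Primrec f)
    (hp : PrimrecPred fun x : α × β => p x.1 x.2) :
    Primrec fun a => (f a).filter fun b => p a b := by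
  let _ : DecidablePred fun x : α × β => p x.1 x.2 := fun x => inferInstance
  refine (list_flatMap (g := fun a b => if p a b then [b] else []) hf
    (show Primrec fun x : α × β => if p x.1 x.2 then [x.2] else [] by fun_prop)).of_eq fun a => ?_
  rw [← List.filterMap_eq_filter, List.filterMap_eq_flatMap_toList]
  congr 1
  funext b
  by_cases h : p a b <;> simp [h, Option.guard]

@[fun_prop]
theorem fun_nat_add {f g : α → ℕ} (hf : Primrec f) (hg : Primrec g) :
    Primrec fun a => f a + g a := nat_add.comp hf hg

@[fun_prop]
theorem fun_nat_mul {f g : α → ℕ} (hf : Primrec f) (hg : Primrec g) :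
    Primrec fun a => f a * g a := nat_mul.comp hf hg

@[fun_prop]
theorem fun_int_add {f g : α → ℤ} (hf : Primrec f) (hg : Primrec g) :
    Primrec fun a => f a + g a := int_add.comp hf hg

@[fun_prop]
theorem fun_int_sub {f g : α → ℤ} (hf : Primrec f) (hg : Primrec g) :
    Primrec fun a => f a - g a := int_sub.comp hf hg

@[fun_prop]
theorem fun_int_neg {f : α → ℤ} (hf : Primrec f) : Primrec fun a => -f a := int_neg.comp hf

@[fun_prop]
theorem fun_int_natCast {f : α → ℕ} (hf : Primrec f) : Primrec fun a => (f a : ℤ) :=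
  int_natCast.comp hf

@[fun_prop]
theorem fun_int_natAbs {f : α → ℤ} (hf : Primrec f) : Primrec fun a => (f a).natAbs :=
  int_natAbs.comp hf

@[fun_prop]
theorem fun_int_nat_mul {f : α → ℕ} {g : α → ℤ} (hf : Primrec f) (hg : Primrec g) :
    Primrec fun a => (f a : ℤ) * g a := int_nat_mul.comp hf hg

end Primrec

namespace PrimrecPred

variable {α β : Type*} [Primcodable α] [Primcodable β]

@[fun_prop]
theorem fun_const (p : Prop) : PrimrecPred fun _ : α => p :=
  ⟨fun _ => Classical.dec p, .const _⟩

@[fun_prop]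
theorem fun_eq {f g : α → β} (hf : Primrec f) (hg : Primrec g) : PrimrecPred fun a => f a = g a :=
  Primrec.eq.comp hf hg

@[fun_prop]
theorem fun_and {p r : α → Prop} (hp : PrimrecPred p) (hr : PrimrecPred r) :
    PrimrecPred fun a => p a ∧ r a := hp.and hr

@[fun_prop]
theorem fun_or {p r : α → Prop} (hp : PrimrecPred p) (hr : PrimrecPred r) :
    PrimrecPred fun a => p a ∨ r a := hp.or hr

@[fun_prop]
theorem fun_not {p : α → Prop} (hp : PrimrecPred p) : PrimrecPred fun a => ¬ p a := hp.not

@[fun_prop]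
theorem fun_imp {p r : α → Prop} (hp : PrimrecPred p) (hr : PrimrecPred r) :
    PrimrecPred fun a => p a → r a := (hp.not.or hr).of_eq fun a => by tauto

@[fun_prop]
theorem fun_forall_mem {f : α → List β} {p : α → β → Prop} (hf : Primrec f)
    (hp : PrimrecPred fun x : α × β => p x.1 x.2) : PrimrecPred fun a => ∀ b ∈ f a, p a b :=
  Primrec.forall_mem hf hp

@[fun_prop]
theorem fun_exists_mem {f : α → List β} {p : α → β → Prop} (hf : Primrec f)
    (hp : PrimrecPred fun x : α × β => p x.1 x.2) : PrimrecPred fun a => ∃ b ∈ f a, p a b :=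
  Primrec.exists_mem hf hp

@[fun_prop]
theorem fun_mem {f : α → β} {l : α → List β} (hf : Primrec f) (hl : Primrec l) :
    PrimrecPred fun a => f a ∈ l a :=
  (Primrec.exists_mem (p := fun a b => b = f a) hl
    (Primrec.eq.comp .snd (hf.comp .fst))).of_eq fun a => by simp

@[fun_prop]
theorem fun_nat_le {f g : α → ℕ} (hf : Primrec f) (hg : Primrec g) :
    PrimrecPred fun a => f a ≤ g a := Primrec.nat_le.comp hf hg

@[fun_prop]
theorem fun_int_le {f g : α → ℤ} (hf : Primrec f) (hg : Primrec g) :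
    PrimrecPred fun a => f a ≤ g a := Primrec.int_le.comp hf hg

@[fun_prop]
theorem fun_int_lt {f g : α → ℤ} (hf : Primrec f) (hg : Primrec g) :
    PrimrecPred fun a => f a < g a := Primrec.int_lt.comp hf hg

end PrimrecPred

/-! ### The finite automaton of the sweep -/

section

variable {α β : Type*} [Primcodable α] [Primcodable β] {A : α → BSAutomaton} {G : α → List (ℕ × ℤ)}

@[fun_prop]
theorem primrec_sgn {f : α → Bool} (hf : Primrec f) : Primrec fun a => sgn (f a) :=
  (Primrec.dom_finite sgn).comp hf

@[fun_prop]
theorem BSAutomaton.primrec_states (hA : Primrec A) : Primrec fun a => (A a).states := by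
  unfold BSAutomaton.states
  fun_prop

namespace Core

@[fun_prop]
theorem primrec_lefts (hA : Primrec A) {x : α → Option ℕ} (hx : Primrec x) :
    Primrec fun a => lefts (A a) (x a) := by
  unfold lefts
  fun_prop

@[fun_prop]
theorem primrec_rights (hA : Primrec A) {x : α → Option ℕ} (hx : Primrec x) :
    Primrec fun a => rights (A a) (x a) := by
  unfold rights
  fun_prop

@[fun_prop]
theorem primrec_micro (hA : Primrec A) (hG : Primrec G) {R C : α → Bool} (hR : Primrec R)
    (hC : Primrec C) {κ : α → Core} (hκ : Primrec κ) :
    Primrec fun a => micro (A a) (G a) (R a) (C a) (κ a) := by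
  unfold micro
  fun_prop

@[fun_prop]
theorem primrec_level (q : ℕ) {d : α → ℤ} (hd : Primrec d) {κ : α → Core} (hκ : Primrec κ) :
    Primrec fun a => level q (d a) (κ a) := by
  unfold level
  fun_prop

@[fun_prop]
theorem primrec_bound (q : ℕ) (hA : Primrec A) (hG : Primrec G) {K : α → ℕ} (hK : Primrec K) :
    Primrec fun a => bound q (A a) (G a) (K a) := by
  unfold bound
  fun_prop

end Core

/-- The lists of length at most `n` with elements in `l`. -/
def List.listsUpTo {γ : Type*} (l : List γ) : ℕ → List (List γ)
  | 0 => [[]]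
  | n + 1 => [] :: l.flatMap fun b => (l.listsUpTo n).map fun t => b :: t

theorem List.mem_listsUpTo {γ : Type*} {l t : List γ} {n : ℕ} (h : t.length ≤ n) (ht : ∀ b ∈ t, b ∈ l) :
    t ∈ l.listsUpTo n := by
  induction n generalizing t with
  | zero => simpa [listsUpTo] using h
  | succ n ih =>
    cases t with
    | nil => simp [listsUpTo]
    | cons b t =>
      simp only [listsUpTo, mem_cons, mem_flatMap, mem_map]
      exact .inr ⟨b, ht b (by simp), t, ih (by simpa using h) fun c hc => ht c (by simp [hc]), rfl⟩

@[fun_prop]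
theorem List.primrec_listsUpTo {l : α → List β} (hl : Primrec l) {n : α → ℕ} (hn : Primrec n) :
    Primrec fun a => (l a).listsUpTo (n a) := by
  refine (Primrec.nat_rec' (g := fun _ => [[]])
    (h := fun a (x : ℕ × List (List β)) => [] :: (l a).flatMap fun b => x.2.map fun t => b :: t)
    hn (.const _) (by unfold Primrec₂; fun_prop)).of_eq fun a => ?_
  induction n a with
  | zero => rfl
  | succ n ih => rw [List.listsUpTo, ← ih]

namespace Core

/-- The items with states in `S`. -/
def items (S : List ℕ) : List Item :=
  (none :: S.map some).flatMap fun x => (none :: S.map some).map fun y => (x, y)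

/-- The configurations of bounded size. -/
def all (S : List ℕ) (M : ℕ) : List Core :=
  ((items S).listsUpTo M).flatMap fun l => ((items S).listsUpTo M).flatMap fun T =>
    (S.listsUpTo M).flatMap fun P => (List.range (M + 1)).flatMap fun n : ℕ =>
      [(l, T, P, (n : ℤ)), (l, T, P, -(n : ℤ))]

theorem mem_items {S : List ℕ} {x : Item} (h : Named S x) : x ∈ items S := by
  have : ∀ o : Option ℕ, (∀ p ∈ o, p ∈ S) → o ∈ none :: S.map some := by
    intro o ho
    cases o with
    | none => simp
    | some p => simpa using ho p rfl
  exact List.mem_flatMap.2 ⟨x.1, this _ h.1, List.mem_map.2 ⟨x.2, this _ h.2, rfl⟩⟩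

theorem Bdd.mem_all {S : List ℕ} {M : ℕ} {κ : Core} (h : Bdd S M κ) : κ ∈ all S M := by
  obtain ⟨l, T, P, c⟩ := κ
  simp only [all, List.mem_flatMap]
  refine ⟨l, List.mem_listsUpTo h.length fun x hx => mem_items (h.named x hx),
    T, List.mem_listsUpTo h.length' fun x hx => mem_items (h.named' x hx),
    P, List.mem_listsUpTo h.length'' h.mem, c.natAbs, ?_, ?_⟩
  · have := h.abs
    simp only [List.mem_range] at this ⊢
    omega
  · rcases Int.natAbs_eq c with hc | hc
    · rw [← hc]; simp
    · rw [← hc]; simp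

@[fun_prop]
theorem primrec_all {S : α → List ℕ} (hS : Primrec S) {M : α → ℕ} (hM : Primrec M) :
    Primrec fun a => all (S a) (M a) := by
  unfold all items
  fun_prop

end Core

namespace Sweep

open Core

@[fun_prop]
theorem primrec_next {q : ℕ} {φ : α → Phase} (hφ : Primrec φ) {o : α → Option (PELetter q)}
    (ho : Primrec o) : Primrec fun a => (φ a).next (o a) :=
  (Primrec.dom_finite fun x : Phase × Option (PELetter q) => x.1.next x.2).comp (hφ.pair ho)

@[fun_prop]
theorem primrec_succ (q : ℕ) (hA : Primrec A) (hG : Primrec G) {x : α → Phase × Core}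
    (hx : Primrec x) : Primrec fun a => succ q (A a) (G a) (x a) := by
  unfold succ
  fun_prop

/-- The sweep as an automaton. -/
noncomputable def automaton (q : ℕ) (A : BSAutomaton) (G : List (ℕ × ℤ)) (K : ℕ) :
    EpsAutomaton (PELetter q) :=
  ((Finset.univ : Finset Phase).toList.flatMap fun φ =>
    (all A.states (bound q A G K)).flatMap fun κ => (succ q A G (φ, κ)).map fun y =>
      (Encodable.encode (φ, κ), y.1, Encodable.encode y.2),
    Encodable.encode init,
    ((Finset.univ : Finset Phase).filter Phase.Final).toList.map fun φ =>
      Encodable.encode ((φ, [(none, none)], [], [], 0) : Phase × Core))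

@[fun_prop]
theorem primrec_automaton (q : ℕ) (hA : Primrec A) (hG : Primrec G) {K : α → ℕ} (hK : Primrec K) :
    Primrec fun a => automaton q (A a) (G a) (K a) := by
  unfold automaton
  fun_prop

/-- Only bounded configurations have outgoing edges. All edges belong to the unrestricted sweep, so
soundness is inherited; completeness holds because the runs of `exists_isRun` only leave bounded
configurations. -/
theorem language_automaton {q : ℕ} [q.AtLeastTwo] {A : BSAutomaton} {G : List (ℕ × ℤ)}
    {D : BoundTable} {K : ℕ} (hG : ∀ g ∈ G, AbsPath q A.1 g.1 0 g.2 g.1 0)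
    (hD : D.Closed q A.1 G A.states) (hDG : D.Suffices G K) (hK : 1 ≤ K)
    (hGK : ∀ g ∈ G, g.2.natAbs ≤ K) :
    (automaton q A G K).language = peLanguage (A.accepted q) := by
  have h1 : ∀ (x : Phase × Core) l p,
      IsRun {e | e ∈ (automaton q A G K).1} (Encodable.encode x) l p →
      ∃ y, p = Encodable.encode y ∧ IsRun {e | e.2 ∈ succ q A G e.1} x l y := by
    intro x l p h
    generalize hx : Encodable.encode x = p₀ at h
    induction h generalizing x with
    | nil p => exact ⟨x, hx.symm, .nil x⟩
    | @cons p p' p'' o l he _ ih =>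
      simp only [automaton, Set.mem_ofPred_eq, List.mem_flatMap, List.mem_map, Prod.mk.injEq] at he
      obtain ⟨φ, -, κ, -, ⟨o', y⟩, hy, e1, rfl, e3⟩ := he
      obtain rfl : (φ, κ) = x := Encodable.encode_injective (e1.trans hx.symm)
      obtain ⟨z, hz, hz'⟩ := ih y e3
      exact ⟨z, hz, .cons hy hz'⟩
  have h2 : ∀ (x y : Phase × Core) l, IsRun {e | Bdd A.states (bound q A G K) e.1.2 ∧
      e.2 ∈ succ q A G e.1} x l y →
      IsRun {e | e ∈ (automaton q A G K).1} (Encodable.encode x) l (Encodable.encode y) := by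
    intro x y l h
    induction h with
    | nil p => exact .nil _
    | @cons p p' p'' o l he _ ih =>
      refine .cons ?_ ih
      simp only [automaton, Set.mem_ofPred_eq, List.mem_flatMap, List.mem_map]
      exact ⟨p.1, by simp, p.2, he.1.mem_all, (o, p'), he.2, rfl⟩
  ext w
  constructor
  · rintro ⟨p, hp, l, hl, rfl⟩
    simp only [automaton, List.mem_map, Finset.mem_toList, Finset.mem_filter, Finset.mem_univ,
      true_and] at hp
    obtain ⟨φ, hφ, rfl⟩ := hp
    obtain ⟨y, hy, hl⟩ := h1 init l _ hl
    obtain rfl := Encodable.encode_injective hy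
    exact mem_of_isRun hG hφ hl
  · rintro ⟨v, hv, rfl⟩
    obtain ⟨φ, l, hφ, hl, hr⟩ := exists_isRun hD hDG hK hGK hv
    refine ⟨_, ?_, l, h2 _ _ _ hr, hl⟩
    simp only [automaton, List.mem_map, Finset.mem_toList, Finset.mem_filter, Finset.mem_univ,
      true_and]
    exact ⟨φ, hφ, rfl⟩

end Sweep

end

/-! ### Certificates -/

/-- Unbounded search: the codes of candidates are tested one after another, and a witness is known
to turn up. How it comes about is irrelevant, so its existence may be proved classically. -/
theorem exists_computable_of_forall_exists {α β : Type*} [Primcodable α] [Primcodable β]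
    {P : α → β → Prop} (hP : PrimrecPred fun x : α × β => P x.1 x.2) (h : ∀ a, ∃ b, P a b) :
    ∃ F : α → β, Computable F ∧ ∀ a, P a (F a) := by
  classical
  let g : α → ℕ → Option β := fun a n =>
    (Encodable.decode (α := β) n).bind fun b => if P a b then some b else none
  have hg : Computable₂ g := Computable.bind_decode_iff.2
    (show Primrec fun x : α × β => if P x.1 x.2 then some x.2 else none by fun_prop).to_comp
  have hspec : ∀ a, ∀ b ∈ Nat.rfindOpt (g a), P a b := by
    intro a b hb
    obtain ⟨n, hn⟩ := Nat.rfindOpt_spec hb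
    simp only [g, Option.mem_def, Option.bind_eq_some_iff] at hn
    obtain ⟨c, -, hc⟩ := hn
    split_ifs at hc with hP
    · obtain rfl : c = b := by simpa using hc
      exact hP
  have hdom : ∀ a, (Nat.rfindOpt (g a)).Dom := by
    intro a
    obtain ⟨b, hb⟩ := h a
    exact Nat.rfindOpt_dom.2 ⟨Encodable.encode b, b, by simp [g, hb]⟩
  exact ⟨fun a => (Nat.rfindOpt (g a)).get (hdom a),
    (Partrec.rfindOpt hg).of_eq_tot fun a => Part.get_mem _, fun a => hspec a _ (Part.get_mem _)⟩

/-- Triples `(p, p', z)` such that there is a walk from `p` to `p'` that stays above its first level,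
returns to it and adds `z`; all such triples are found for some `n`. -/
def derived (q : ℕ) (E : List (ℕ × Gen × ℕ)) (S : List ℕ) : ℕ → List (ℕ × ℕ × ℤ)
  | 0 => (S.map fun p => (p, p, 0)) ++
    E.flatMap fun f => if f.2.1.1 = false then [(f.1, f.2.2, sgn f.2.1.2)] else []
  | n + 1 => derived q E S n ++
    ((derived q E S n).flatMap fun x => E.flatMap fun f => E.flatMap fun f' =>
      if f.2.1 = (true, false) ∧ f.2.2 = x.1 ∧ f'.2.1 = (true, true) ∧ f'.1 = x.2.1 then
        [(f.1, f'.2.2, (q : ℤ) * x.2.2)] else []) ++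
    (derived q E S n).flatMap fun x => (derived q E S n).flatMap fun y =>
      if x.2.1 = y.1 then [(x.1, y.2.1, x.2.2 + y.2.2)] else []

/-- The triple is found eventually. -/
def Derivable (q : ℕ) (E : List (ℕ × Gen × ℕ)) (S : List ℕ) (p p' : ℕ) (z : ℤ) : Prop :=
  ∃ n, (p, p', z) ∈ derived q E S n

section

variable {q : ℕ} {E : List (ℕ × Gen × ℕ)} {S : List ℕ}

theorem derived_mono {m n : ℕ} (h : m ≤ n) : derived q E S m ⊆ derived q E S n := by
  induction h with
  | refl => exact fun _ h => h
  | step _ ih => exact fun x hx => by simp [derived, ih hx]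

theorem absPath_of_mem_derived [q.AtLeastTwo] {n : ℕ} {x : ℕ × ℕ × ℤ}
    (h : x ∈ derived q E S n) : AbsPath q E x.1 0 x.2.2 x.2.1 0 := by
  induction n generalizing x with
  | zero =>
    simp only [derived, List.mem_append, List.mem_map, List.mem_flatMap] at h
    rcases h with ⟨p, -, rfl⟩ | ⟨⟨p, ⟨g, b⟩, p'⟩, hf, h⟩
    · simpa using AbsPath.refl p 0
    · split_ifs at h with hg
      · simp only [List.mem_singleton] at h
        simp only at hg
        subst h hg
        simpa using AbsPath.add (q := q) hf 0
      · simp at h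
  | succ n ih =>
    simp only [derived, List.mem_append, List.mem_flatMap, or_assoc] at h
    rcases h with h | ⟨y, hy, ⟨p, g, s⟩, hf, ⟨s', g', p'⟩, hf', h⟩ | ⟨y, hy, y', hy', h⟩
    · exact ih h
    · split_ifs at h with hg
      · simp only at hg
        obtain ⟨rfl, rfl, rfl, rfl⟩ := hg
        simp only [List.mem_singleton] at h
        subst h
        have h1 := (ih hy).shift 1
        have h2 := ((AbsPath.up hf 0).trans h1).trans (AbsPath.down hf' 0)
        simpa using h2
      · simp at h
    · split_ifs at h with hg
      · simp only [List.mem_singleton] at h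
        subst h
        have h1 := ih hy
        rw [hg] at h1
        simpa using h1.trans (ih hy')
      · simp at h

namespace Derivable

theorem nil {p : ℕ} (hp : p ∈ S) : Derivable q E S p p 0 := ⟨0, by simp [derived, hp]⟩

theorem add {p p' : ℕ} {b : Bool} (h : (p, (false, b), p') ∈ E) :
    Derivable q E S p p' (sgn b) := by
  refine ⟨0, ?_⟩
  simp only [derived, List.mem_append, List.mem_flatMap]
  exact .inr ⟨_, h, by simp⟩

theorem lift {p s s' p' : ℕ} {z : ℤ} (h : (p, (true, false), s) ∈ E) (hz : Derivable q E S s s' z)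
    (h' : (s', (true, true), p') ∈ E) : Derivable q E S p p' (q * z) := by
  obtain ⟨n, hn⟩ := hz
  refine ⟨n + 1, ?_⟩
  simp only [derived, List.mem_append, List.mem_flatMap]
  exact .inl (.inr ⟨_, hn, _, h, _, h', by simp⟩)

theorem comp {p s p' : ℕ} {z z' : ℤ} (hz : Derivable q E S p s z) (hz' : Derivable q E S s p' z') :
    Derivable q E S p p' (z + z') := by
  obtain ⟨n, hn⟩ := hz
  obtain ⟨n', hn'⟩ := hz'
  refine ⟨max n n' + 1, ?_⟩
  simp only [derived, List.mem_append, List.mem_flatMap]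
  exact .inr ⟨_, derived_mono (le_max_left n n') hn, _, derived_mono (le_max_right n n') hn',
    by simp⟩

theorem nsmul {p : ℕ} {z : ℤ} (hp : p ∈ S) (hz : Derivable q E S p p z) (n : ℕ) :
    Derivable q E S p p (n * z) := by
  induction n with
  | zero => simpa using nil hp
  | succ n ih =>
    have := ih.comp hz
    rwa [show (n : ℤ) * z + z = ((n + 1 : ℕ) : ℤ) * z by push_cast; ring] at this

theorem mem (hS : ∀ e ∈ E, e.1 ∈ S ∧ e.2.2 ∈ S) {p p' : ℕ} {z : ℤ} (h : Derivable q E S p p' z) :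
    p ∈ S ∧ p' ∈ S := by
  obtain ⟨n, hn⟩ := h
  induction n generalizing p p' z with
  | zero =>
    simp only [derived, List.mem_append, List.mem_map, List.mem_flatMap] at hn
    rcases hn with ⟨p, hp, h⟩ | ⟨f, hf, h⟩
    · simp only [Prod.mk.injEq] at h
      obtain ⟨rfl, rfl, -⟩ := h
      exact ⟨hp, hp⟩
    · split_ifs at h with hg
      · simp only [List.mem_singleton, Prod.mk.injEq] at h
        obtain ⟨rfl, rfl, -⟩ := h
        exact hS f hf
      · simp at h
  | succ n ih =>
    simp only [derived, List.mem_append, List.mem_flatMap, or_assoc] at hn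
    rcases hn with h | ⟨y, hy, f, hf, f', hf', h⟩ | ⟨y, hy, y', hy', h⟩
    · exact ih h
    · split_ifs at h with hg
      · simp only [List.mem_singleton, Prod.mk.injEq] at h
        obtain ⟨rfl, rfl, -⟩ := h
        exact ⟨(hS f hf).1, (hS f' hf').2⟩
      · simp at h
    · split_ifs at h with hg
      · simp only [List.mem_singleton, Prod.mk.injEq] at h
        obtain ⟨rfl, rfl, -⟩ := h
        exact ⟨(ih hy).1, (ih hy').2⟩
      · simp at h

end Derivable

/-- The list consists of the minimum if there is one and is empty otherwise. That the bound is
attained is what makes the table closed under composition. -/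
theorem exists_lower_bounds (L : Set ℤ) (hL : L.Nonempty) :
    ∃ l : List ℤ, (∀ x ∈ l, x ∈ L ∧ ∀ z ∈ L, x ≤ z) ∧ (BddBelow L → l ≠ []) := by
  by_cases h : BddBelow L
  · exact ⟨[sInf L], by simpa using ⟨Int.csInf_mem hL h, fun z hz => csInf_le h hz⟩, by simp⟩
  · exact ⟨[], by simp, fun h' => absurd h' h⟩

theorem exists_upper_bounds (L : Set ℤ) (hL : L.Nonempty) :
    ∃ l : List ℤ, (∀ x ∈ l, x ∈ L ∧ ∀ z ∈ L, z ≤ x) ∧ (BddAbove L → l ≠ []) := by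
  by_cases h : BddAbove L
  · exact ⟨[sSup L], by simpa using ⟨Int.csSup_mem hL h, fun z hz => le_csSup h hz⟩, by simp⟩
  · exact ⟨[], by simp, fun h' => absurd h' h⟩

/-- The auxiliary loops at one state. -/
theorem exists_loops {p : ℕ} (hp : p ∈ S) : ∃ G : List (ℕ × ℤ),
    (∀ g ∈ G, g.1 = p ∧ Derivable q E S p p g.2) ∧
    ((BddBelow {z | Derivable q E S p p z} ∧ BddAbove {z | Derivable q E S p p z}) ∨
      ∃ g ∈ G, g.2 ≠ 0 ∧ ((BddBelow {z | Derivable q E S p p z} ∧ 0 < g.2) ∨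
        (BddAbove {z | Derivable q E S p p z} ∧ g.2 < 0) ∨ (p, -g.2) ∈ G)) := by
  by_cases h1 : ∃ x > 0, Derivable q E S p p x
  · obtain ⟨x, hx, hx'⟩ := h1
    by_cases h2 : ∃ y > 0, Derivable q E S p p (-y)
    · obtain ⟨y, hy, hy'⟩ := h2
      lift x to ℕ using hx.le
      lift y to ℕ using hy.le
      -- Repeating the loop `x` exactly `y` times and the loop `-y` exactly `x` times gives two
      -- opposite loops.
      refine ⟨[(p, y * x), (p, -(y * x))], ?_, .inr ⟨(p, y * x), by simp, ?_, .inr (.inr (by simp))⟩⟩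
      · intro g hg
        simp only [List.mem_cons, List.not_mem_nil, or_false] at hg
        rcases hg with rfl | rfl
        · exact ⟨rfl, hx'.nsmul hp y⟩
        · have := hy'.nsmul hp x
          exact ⟨rfl, by rwa [show (x : ℤ) * -y = -(y * x) by ring] at this⟩
      · exact (mul_pos hy hx).ne'
    · refine ⟨[(p, x)], by simpa using hx', .inr ⟨(p, x), by simp, hx.ne', .inl ⟨⟨0, ?_⟩, hx⟩⟩⟩
      intro z hz
      by_contra! hz0
      exact h2 ⟨-z, by omega, by simpa using hz⟩
  · have hbd : BddAbove {z | Derivable q E S p p z} := ⟨0, fun z hz => by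
      by_contra! hz0
      exact h1 ⟨z, hz0, hz⟩⟩
    by_cases h2 : ∃ y < 0, Derivable q E S p p y
    · obtain ⟨y, hy, hy'⟩ := h2
      exact ⟨[(p, y)], by simpa using hy', .inr ⟨(p, y), by simp, hy.ne, .inr (.inl ⟨hbd, hy⟩)⟩⟩
    · refine ⟨[], by simp, .inl ⟨⟨0, fun z hz => ?_⟩, hbd⟩⟩
      by_contra! hz0
      exact h2 ⟨z, hz0, hz⟩

/-- A certificate consists of auxiliary loops, a table of bounds, a bound on the loops, and a number
of steps in which the loops are found. -/
abbrev Certificate : Type := List (ℕ × ℤ) × BoundTable × ℕ × ℕ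

/-- The certificate is valid for the automaton. -/
def Certificate.Valid (q : ℕ) (A : BSAutomaton) (c : Certificate) : Prop :=
  (∀ g ∈ c.1, (g.1, g.1, g.2) ∈ derived q A.1 A.states c.2.2.2) ∧
    c.2.1.Closed q A.1 c.1 A.states ∧ c.2.1.Suffices c.1 c.2.2.1 ∧ 1 ≤ c.2.2.1 ∧
    ∀ g ∈ c.1, g.2.natAbs ≤ c.2.2.1

/-- The ideal table: one entry for each pair with a derivable value, containing the exact extrema
where they exist. -/
theorem exists_table (hS : ∀ e ∈ E, e.1 ∈ S ∧ e.2.2 ∈ S) : ∃ D : BoundTable,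
    (∀ p p' z, Derivable q E S p p' z → ∃ e ∈ D, e.1 = p ∧ e.2.1 = p') ∧
    ∀ e ∈ D, (∃ z, Derivable q E S e.1 e.2.1 z) ∧
      (∀ e' ∈ D, e.1 = e'.1 ∧ e.2.1 = e'.2.1 → e = e') ∧
      (∀ x ∈ e.2.2.1, Derivable q E S e.1 e.2.1 x ∧ ∀ z, Derivable q E S e.1 e.2.1 z → x ≤ z) ∧
      (∀ x ∈ e.2.2.2, Derivable q E S e.1 e.2.1 x ∧ ∀ z, Derivable q E S e.1 e.2.1 z → z ≤ x) ∧
      (BddBelow {z | Derivable q E S e.1 e.2.1 z} → e.2.2.1 ≠ []) ∧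
      (BddAbove {z | Derivable q E S e.1 e.2.1 z} → e.2.2.2 ≠ []) := by
  classical
  have h1 : ∀ x : ℕ × ℕ, ∃ l : List ℤ, (∃ z, Derivable q E S x.1 x.2 z) →
      (∀ y ∈ l, Derivable q E S x.1 x.2 y ∧ ∀ z, Derivable q E S x.1 x.2 z → y ≤ z) ∧
      (BddBelow {z | Derivable q E S x.1 x.2 z} → l ≠ []) := by
    intro x
    by_cases h : ∃ z, Derivable q E S x.1 x.2 z
    · obtain ⟨l, hl⟩ := exists_lower_bounds {z | Derivable q E S x.1 x.2 z} h
      exact ⟨l, fun _ => hl⟩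
    · exact ⟨[], fun h' => absurd h' h⟩
  have h2 : ∀ x : ℕ × ℕ, ∃ l : List ℤ, (∃ z, Derivable q E S x.1 x.2 z) →
      (∀ y ∈ l, Derivable q E S x.1 x.2 y ∧ ∀ z, Derivable q E S x.1 x.2 z → z ≤ y) ∧
      (BddAbove {z | Derivable q E S x.1 x.2 z} → l ≠ []) := by
    intro x
    by_cases h : ∃ z, Derivable q E S x.1 x.2 z
    · obtain ⟨l, hl⟩ := exists_upper_bounds {z | Derivable q E S x.1 x.2 z} h
      exact ⟨l, fun _ => hl⟩
    · exact ⟨[], fun h' => absurd h' h⟩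
  choose lo hlo using h1
  choose hi hhi using h2
  refine ⟨((S ×ˢ S).filter fun x => ∃ z, Derivable q E S x.1 x.2 z).map fun x =>
    (x.1, x.2, lo x, hi x), ?_, ?_⟩
  · intro p p' z hz
    refine ⟨_, List.mem_map.2 ⟨(p, p'), List.mem_filter.2 ⟨?_, by simpa using ⟨z, hz⟩⟩, rfl⟩,
      rfl, rfl⟩
    obtain ⟨h, h'⟩ := hz.mem hS
    exact List.mem_product.2 ⟨h, h'⟩
  · intro e he
    obtain ⟨x, hx, rfl⟩ := List.mem_map.1 he
    have hx' : ∃ z, Derivable q E S x.1 x.2 z := by simpa using (List.mem_filter.1 hx).2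
    refine ⟨hx', ?_, (hlo x hx').1, (hhi x hx').1, (hlo x hx').2, (hhi x hx').2⟩
    rintro e' he' ⟨e1, e2⟩
    obtain ⟨y, hy, rfl⟩ := List.mem_map.1 he'
    obtain rfl : x = y := Prod.ext e1 e2
    rfl

/-- The ideal table is closed. If a composite entry is bounded on one side, so is each part, because
the other part can be held at a fixed value. The extrema of the parts are attained, so their
composition is a derivable value of the composite entry and respects its bound. -/
theorem Certificate.exists_valid (q : ℕ) [q.AtLeastTwo] (A : BSAutomaton) :
    ∃ c : Certificate, c.Valid q A := by
  have hq : (0 : ℤ) ≤ q := by positivity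
  have hS : ∀ e ∈ A.1, e.1 ∈ A.states ∧ e.2.2 ∈ A.states := fun e he => BSAutomaton.mem_states he
  obtain ⟨D, hD1, hD2⟩ := exists_table (q := q) hS
  have hloops : ∀ p : ℕ, ∃ G : List (ℕ × ℤ), p ∈ A.states →
    (∀ g ∈ G, g.1 = p ∧ Derivable q A.1 A.states p p g.2) ∧
    ((BddBelow {z | Derivable q A.1 A.states p p z} ∧
        BddAbove {z | Derivable q A.1 A.states p p z}) ∨
      ∃ g ∈ G, g.2 ≠ 0 ∧ ((BddBelow {z | Derivable q A.1 A.states p p z} ∧ 0 < g.2) ∨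
        (BddAbove {z | Derivable q A.1 A.states p p z} ∧ g.2 < 0) ∨ (p, -g.2) ∈ G)) := by
    intro p
    by_cases hp : p ∈ A.states
    · obtain ⟨G, hG⟩ := exists_loops (q := q) (E := A.1) hp
      exact ⟨G, fun _ => hG⟩
    · exact ⟨[], fun h => absurd h hp⟩
  choose loops hloops using hloops
  let G := A.states.flatMap loops
  have hG : ∀ g ∈ G, Derivable q A.1 A.states g.1 g.1 g.2 := by
    intro g hg
    obtain ⟨p, hp, hg⟩ := List.mem_flatMap.1 hg
    obtain ⟨rfl, h⟩ := (hloops p hp).1 g hg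
    exact h
  obtain ⟨n, hn⟩ : ∃ n, ∀ g ∈ G, (g.1, g.1, g.2) ∈ derived q A.1 A.states n := by
    choose! f hf using hG
    obtain ⟨n, hn⟩ := (G.map f).toFinset.exists_le
    exact ⟨n, fun g hg => derived_mono (hn (f g) (by simp; exact ⟨_, _, hg, rfl⟩)) (hf g hg)⟩
  obtain ⟨K, hK⟩ := (1 :: G.map fun g => g.2.natAbs).toFinset.exists_le
  have hKG : ∀ g ∈ G, g.2.natAbs ≤ K := fun g hg =>
    hK _ (List.mem_toFinset.2 (List.mem_cons_of_mem _ (List.mem_map.2 ⟨g, hg, rfl⟩)))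
  have within : ∀ p p' z, Derivable q A.1 A.states p p' z →
      ∃ e ∈ D, e.1 = p ∧ e.2.1 = p' ∧ Within z e.2.2 := by
    intro p p' z hz
    obtain ⟨e, he, rfl, rfl⟩ := hD1 p p' z hz
    obtain ⟨-, -, h1, h2, -⟩ := hD2 e he
    exact ⟨e, he, rfl, rfl, fun l hl => (h1 l hl).2 z hz, fun l hl => (h2 l hl).2 z hz⟩
  have exists_lo : ∀ e ∈ D, BddBelow {z | Derivable q A.1 A.states e.1 e.2.1 z} →
      ∃ l ∈ e.2.2.1, Derivable q A.1 A.states e.1 e.2.1 l := by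
    intro e he h
    obtain ⟨-, -, h1, -, h2, -⟩ := hD2 e he
    obtain ⟨l, hl⟩ := List.exists_mem_of_ne_nil _ (h2 h)
    exact ⟨l, hl, (h1 l hl).1⟩
  have exists_hi : ∀ e ∈ D, BddAbove {z | Derivable q A.1 A.states e.1 e.2.1 z} →
      ∃ l ∈ e.2.2.2, Derivable q A.1 A.states e.1 e.2.1 l := by
    intro e he h
    obtain ⟨-, -, -, h1, -, h2⟩ := hD2 e he
    obtain ⟨l, hl⟩ := List.exists_mem_of_ne_nil _ (h2 h)
    exact ⟨l, hl, (h1 l hl).1⟩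
  have hq1 : (1 : ℤ) ≤ q := by have := Nat.AtLeastTwo.prop (n := q); omega
  refine ⟨(G, D, K, n), hn, ⟨?_, ?_, ?_, ?_, ?_, ?_⟩, ?_, hK 1 (by simp), hKG⟩
  · exact fun e he => (hD2 e he).2.1
  · exact fun p hp => within p p 0 (.nil hp)
  · rintro ⟨p, ⟨g, b⟩, p'⟩ hf rfl
    exact within _ _ _ (.add hf)
  · exact fun g hg => within _ _ _ (hG g hg)
  · rintro ⟨p, g, s⟩ hf rfl e he h1 ⟨s', g', p'⟩ hf' ⟨h2, h3⟩
    simp only at h1 h2 h3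
    subst h1 h2 h3
    obtain ⟨⟨z, hz⟩, -⟩ := hD2 e he
    have key : ∀ z, Derivable q A.1 A.states e.1 e.2.1 z →
      Derivable q A.1 A.states p p' (q * z) := fun z hz => .lift hf hz hf'
    obtain ⟨e', he', rfl, rfl⟩ := hD1 p p' _ (key z hz)
    obtain ⟨-, -, k1, k2, -⟩ := hD2 e' he'
    refine ⟨e', he', rfl, rfl, fun l' hl' => ?_, fun l' hl' => ?_⟩
    -- A lower bound `l'` for all `q * z` bounds `z` below by `-|l'|`, since `q ≥ 1`.
    · obtain ⟨l, hl, hl2⟩ := exists_lo e he ⟨-|l'|, fun z hz => by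
        have := (k1 l' hl').2 _ (key z hz)
        have := neg_abs_le l'
        by_contra! hc
        nlinarith [mul_nonneg (sub_nonneg.2 hq1) (show 0 ≤ -z by linarith [abs_nonneg l'])]⟩
      exact ⟨l, hl, (k1 l' hl').2 _ (key l hl2)⟩
    · obtain ⟨l, hl, hl2⟩ := exists_hi e he ⟨|l'|, fun z hz => by
        have := (k2 l' hl').2 _ (key z hz)
        have := le_abs_self l'
        by_contra! hc
        nlinarith [mul_nonneg (sub_nonneg.2 hq1) (show 0 ≤ z by linarith [abs_nonneg l'])]⟩
      exact ⟨l, hl, (k2 l' hl').2 _ (key l hl2)⟩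
  · intro e he e' he' h
    obtain ⟨⟨z, hz⟩, -⟩ := hD2 e he
    obtain ⟨⟨z', hz'⟩, -⟩ := hD2 e' he'
    have key : ∀ z z', Derivable q A.1 A.states e.1 e.2.1 z →
        Derivable q A.1 A.states e'.1 e'.2.1 z' →
        Derivable q A.1 A.states e.1 e'.2.1 (z + z') := fun z z' hz hz' => by
      rw [h] at hz
      exact hz.comp hz'
    obtain ⟨e'', he'', h1, h2⟩ := hD1 _ _ _ (key z z' hz hz')
    obtain ⟨-, -, k1, k2, -⟩ := hD2 e'' he''
    rw [h1, h2] at k1 k2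
    refine ⟨e'', he'', h1, h2, fun l'' hl'' => ?_, fun l'' hl'' => ?_⟩
    · obtain ⟨l, hl, hl2⟩ := exists_lo e he ⟨l'' - z', fun y hy => by
        have := (k1 l'' hl'').2 _ (key y z' hy hz')
        omega⟩
      obtain ⟨l', hl', hl2'⟩ := exists_lo e' he' ⟨l'' - z, fun y hy => by
        have := (k1 l'' hl'').2 _ (key z y hz hy)
        omega⟩
      exact ⟨l, hl, l', hl', (k1 l'' hl'').2 _ (key _ _ hl2 hl2')⟩
    · obtain ⟨l, hl, hl2⟩ := exists_hi e he ⟨l'' - z', fun y hy => by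
        have := (k2 l'' hl'').2 _ (key y z' hy hz')
        omega⟩
      obtain ⟨l', hl', hl2'⟩ := exists_hi e' he' ⟨l'' - z, fun y hy => by
        have := (k2 l'' hl'').2 _ (key z y hz hy)
        omega⟩
      exact ⟨l, hl, l', hl', (k2 l'' hl'').2 _ (key _ _ hl2 hl2')⟩
  · intro e he h
    obtain ⟨⟨z, hz⟩, -, -, -, k1, k2⟩ := hD2 e he
    rw [← h] at k1 k2
    have hp := (hz.mem hS).1
    have hsub : ∀ g ∈ loops e.1, g ∈ G := fun g hg => List.mem_flatMap.2 ⟨_, hp, hg⟩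
    obtain ⟨k3, ⟨k4, k5⟩ | ⟨g, hg, k4, k5⟩⟩ := hloops e.1 hp
    · exact .inl ⟨k1 k4, k2 k5⟩
    · refine .inr ⟨g, hsub g hg, (k3 g hg).1, k4, hKG g (hsub g hg), ?_⟩
      rcases k5 with k5 | k5 | k5
      · exact .inl ⟨k1 k5.1, k5.2⟩
      · exact .inr (.inl ⟨k2 k5.1, k5.2⟩)
      · exact .inr (.inr (hsub _ k5))

end

/-! ### Primitive recursiveness of the validity of certificates -/

section

variable {α : Type*} [Primcodable α]

@[fun_prop]
theorem primrec_derived (q : ℕ) {E : α → List (ℕ × Gen × ℕ)} (hE : Primrec E) {S : α → List ℕ}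
    (hS : Primrec S) {n : α → ℕ} (hn : Primrec n) :
    Primrec fun a => derived q (E a) (S a) (n a) := by
  refine (Primrec.nat_rec' (g := fun a => ((S a).map fun p => (p, p, (0 : ℤ))) ++
    (E a).flatMap fun f => if f.2.1.1 = false then [(f.1, f.2.2, sgn f.2.1.2)] else [])
    (h := fun a (x : ℕ × List (ℕ × ℕ × ℤ)) => x.2 ++
    (x.2.flatMap fun x => (E a).flatMap fun f => (E a).flatMap fun f' =>
      if f.2.1 = (true, false) ∧ f.2.2 = x.1 ∧ f'.2.1 = (true, true) ∧ f'.1 = x.2.1 then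
        [(f.1, f'.2.2, (q : ℤ) * x.2.2)] else []) ++
    x.2.flatMap fun y => x.2.flatMap fun z =>
      if y.2.1 = z.1 then [(y.1, z.2.1, y.2.2 + z.2.2)] else [])
    hn (by fun_prop) (by unfold Primrec₂; fun_prop)).of_eq fun a => ?_
  induction n a with
  | zero => rfl
  | succ n ih => rw [derived, ← ih]

theorem primrecPred_closed (q : ℕ) {E : α → List (ℕ × Gen × ℕ)} (hE : Primrec E)
    {G : α → List (ℕ × ℤ)} (hG : Primrec G) {S : α → List ℕ} (hS : Primrec S)
    {D : α → BoundTable} (hD : Primrec D) :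
    PrimrecPred fun a => (D a).Closed q (E a) (G a) (S a) := by
  have h1 : PrimrecPred fun a => (∀ e ∈ D a, ∀ e' ∈ D a, e.1 = e'.1 ∧ e.2.1 = e'.2.1 → e = e') ∧
      (∀ p ∈ S a, ∃ e ∈ D a, e.1 = p ∧ e.2.1 = p ∧ Within 0 e.2.2) ∧
      (∀ f ∈ E a, f.2.1.1 = false → ∃ e ∈ D a, e.1 = f.1 ∧ e.2.1 = f.2.2 ∧
        Within (sgn f.2.1.2) e.2.2) ∧
      ∀ g ∈ G a, ∃ e ∈ D a, e.1 = g.1 ∧ e.2.1 = g.1 ∧ Within g.2 e.2.2 := by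
    unfold Within
    fun_prop
  have h2 : PrimrecPred fun a => ∀ f ∈ E a, f.2.1 = (true, false) → ∀ e ∈ D a, e.1 = f.2.2 →
      ∀ f' ∈ E a, f'.2.1 = (true, true) ∧ f'.1 = e.2.1 → ∃ e' ∈ D a, e'.1 = f.1 ∧ e'.2.1 = f'.2.2 ∧
      (∀ l' ∈ e'.2.2.1, ∃ l ∈ e.2.2.1, l' ≤ q * l) ∧
      ∀ h' ∈ e'.2.2.2, ∃ h ∈ e.2.2.2, q * h ≤ h' := by
    fun_prop
  have h3 : PrimrecPred fun a => ∀ e ∈ D a, ∀ e' ∈ D a, e.2.1 = e'.1 → ∃ e'' ∈ D a, e''.1 = e.1 ∧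
      e''.2.1 = e'.2.1 ∧
      (∀ l'' ∈ e''.2.2.1, ∃ l ∈ e.2.2.1, ∃ l' ∈ e'.2.2.1, l'' ≤ l + l') ∧
      ∀ h'' ∈ e''.2.2.2, ∃ h ∈ e.2.2.2, ∃ h' ∈ e'.2.2.2, h + h' ≤ h'' := by
    fun_prop
  refine (h1.and (h2.and h3)).of_eq fun a => ?_
  constructor
  · rintro ⟨⟨h1, h2, h3, h4⟩, h5, h6⟩
    exact ⟨h1, h2, h3, h4, h5, h6⟩
  · rintro ⟨h1, h2, h3, h4, h5, h6⟩
    exact ⟨⟨h1, h2, h3, h4⟩, h5, h6⟩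

theorem primrecPred_suffices {G : α → List (ℕ × ℤ)} (hG : Primrec G) {K : α → ℕ}
    (hK : Primrec K) {D : α → BoundTable} (hD : Primrec D) :
    PrimrecPred fun a => (D a).Suffices (G a) (K a) := by
  unfold BoundTable.Suffices
  fun_prop

theorem Certificate.primrecPred_valid (q : ℕ) :
    PrimrecPred fun x : BSAutomaton × Certificate => x.2.Valid q x.1 := by
  unfold Certificate.Valid
  refine .and (by fun_prop) (.and ?_ (.and ?_ (by fun_prop)))
  · exact primrecPred_closed q (by fun_prop) (by fun_prop) (by fun_prop) (by fun_prop)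
  · exact primrecPred_suffices (by fun_prop) (by fun_prop) (by fun_prop)

end

/-- An automaton for the pointed expansions can be computed. -/
theorem exists_computable_automaton (q : ℕ) [q.AtLeastTwo] :
    ∃ f : BSAutomaton → WordAutomaton (PELetter q), Computable f ∧
      ∀ A : BSAutomaton, (f A).language = peLanguage (A.accepted q) := by
  obtain ⟨F, hF, hF'⟩ := exists_computable_of_forall_exists (Certificate.primrecPred_valid q)
    (Certificate.exists_valid q)
  obtain ⟨B, hB, hB'⟩ : ∃ B : BSAutomaton × Certificate → WordAutomaton (PELetter q), Primrec B ∧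
      ∀ A c, B (A, c) = EpsAutomaton.elim (Sweep.automaton q A c.1 c.2.2.1) :=
    ⟨fun x => EpsAutomaton.elim (Sweep.automaton q x.1 x.2.1 x.2.2.2.1),
      EpsAutomaton.primrec_elim.comp (by fun_prop), fun _ _ => rfl⟩
  refine ⟨fun A => B (A, F A), hB.to_comp.comp (Computable.id.pair hF), fun A => ?_⟩
  obtain ⟨h1, h2, h3, h4, h5⟩ := hF' A
  show (B (A, F A)).language = _
  rw [hB', EpsAutomaton.elim_language]
  exact Sweep.language_automaton (fun g hg => absPath_of_mem_derived (h1 g hg)) h2 h3 h4 h5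

/-! ### Rational subsets -/

namespace BS

variable {q : ℕ} [q.AtLeastTwo]

/-- The group is generated by `a` and `t`. -/
theorem exists_word (g : BS q) : ∃ u : List Gen, (u.map (Gen.toBS q)).prod = g := by
  have hq := natCast_ne_zero q
  have hmul : ∀ g h : BS q, (∃ u : List Gen, (u.map (Gen.toBS q)).prod = g) →
      (∃ u : List Gen, (u.map (Gen.toBS q)).prod = h) →
      ∃ u : List Gen, (u.map (Gen.toBS q)).prod = g * h := by
    rintro _ _ ⟨u, rfl⟩ ⟨v, rfl⟩
    exact ⟨u ++ v, by simp⟩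
  have hone : ∃ u : List Gen, (u.map (Gen.toBS q)).prod = 1 := ⟨[], by simp⟩
  have hgen : ∀ x : Gen, ∃ u : List Gen, (u.map (Gen.toBS q)).prod = Gen.toBS q x :=
    fun x => ⟨[x], by simp⟩
  have hT : ∀ k : ℤ, ∃ u : List Gen,
      (u.map (Gen.toBS q)).prod = (⟨0, k, 0, 0, by simp⟩ : BS q) := by
    intro k
    induction k with
    | zero => exact hone
    | succ k ih =>
      convert hmul _ _ ih (hgen (true, false)) using 3
      ext <;> simp [Gen.toBS, t]
    | pred k ih =>
      convert hmul _ _ ih (hgen (true, true)) using 3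
      ext <;> simp [Gen.toBS, t, sub_eq_add_neg]
  have hN : ∀ n : ℤ, ∃ u : List Gen,
      (u.map (Gen.toBS q)).prod = (⟨n, 0, n, 0, by simp⟩ : BS q) := by
    intro n
    induction n with
    | zero => convert hone using 3; ext <;> simp
    | succ n ih =>
      convert hmul _ _ ih (hgen (false, false)) using 3
      ext <;> simp [Gen.toBS, a]
    | pred n ih =>
      convert hmul _ _ ih (hgen (false, true)) using 3
      ext <;> simp [Gen.toBS, a, sub_eq_add_neg]
  -- For `r = n * q ^ i`, the element is `t ^ i * a ^ n * t ^ (m - i)`.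
  obtain ⟨n, i, hr⟩ := g.r_mem
  convert hmul _ _ (hmul _ _ (hT i) (hN n)) (hT (g.m - i)) using 3
  ext
  · simp [hr, mul_comm]
  · simp

/-- Even an edge labelled `1` has to become a path with at least one edge; the prefix `t t⁻¹` makes
any word nonempty. -/
theorem exists_cons_word (g : BS q) :
    ∃ (x : Gen) (u : List Gen), Gen.toBS q x * (u.map (Gen.toBS q)).prod = g := by
  obtain ⟨u, hu⟩ := exists_word g
  exact ⟨(true, false), (true, true) :: u, by simp [Gen.toBS, hu]⟩

end BS

/-- A path that reads a word and leads to `p`, where the states are given by what remains to be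
read. -/
def wordPath {Q : Type*} (φ : List Gen × Q → ℕ) (p : Q) : List Gen → List (ℕ × Gen × ℕ)
  | [] => []
  | y :: v => (φ (y :: v, p), y, φ (v, p)) :: wordPath φ p v

theorem mem_wordPath {Q : Type*} {φ : List Gen × Q → ℕ} {p : Q} {u : List Gen}
    {e : ℕ × Gen × ℕ} (h : e ∈ wordPath φ p u) : ∃ y v, e = (φ (y :: v, p), y, φ (v, p)) := by
  induction u with
  | nil => simp [wordPath] at h
  | cons y v ih =>
    rcases List.mem_cons.1 h with rfl | h
    · exact ⟨y, v, rfl⟩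
    · exact ih h

theorem isRun_wordPath {Q : Type*} {φ : List Gen × Q → ℕ} {p : Q} {u : List Gen}
    {E : Set (ℕ × Gen × ℕ)} (h : ∀ e ∈ wordPath φ p u, e ∈ E) : IsRun E (φ (u, p)) u (φ ([], p)) := by
  induction u with
  | nil => exact .nil _
  | cons y v ih => exact .cons (h _ (by simp [wordPath])) (ih fun e he => h e (by simp [wordPath, he]))

/-- Every rational subset is accepted by an automaton with labels in `{a, a⁻¹, t, t⁻¹}`. -/
theorem IsRationalSubset.exists_accepted_eq {q : ℕ} [q.AtLeastTwo] {R : Set (BS q)}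
    (hR : IsRationalSubset R) : ∃ A : BSAutomaton, A.accepted q = R := by
  obtain ⟨Q, _, E, hE, q₀, q_f, rfl⟩ := hR
  -- A state of the subdivided automaton is the part of a label that is still to be read, together
  -- with the target; the original state `p` is `([], p)`.
  obtain ⟨φ, hφ⟩ := exists_injective_nat (List Gen × Q)
  choose x u hxu using BS.exists_cons_word (q := q)
  obtain ⟨l, hl⟩ : ∃ l : List (Q × BS q × Q), ∀ e, e ∈ l ↔ e ∈ E :=
    ⟨hE.toFinset.toList, by simp⟩
  let E' : List (ℕ × Gen × ℕ) := l.flatMap fun e =>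
    (φ ([], e.1), x e.2.1, φ (u e.2.1, e.2.2)) :: wordPath φ e.2.2 (u e.2.1)
  refine ⟨(E', φ ([], q₀), φ ([], q_f)), ?_⟩
  ext g
  constructor
  · rintro ⟨w, hw, rfl⟩
    have key : ∀ s w s', IsRun {e | e ∈ E'} s w s' → s' = φ ([], q_f) → ∀ v p, s = φ (v, p) →
        ∃ w', IsRun E p w' q_f ∧
          (v.map (Gen.toBS q)).prod * w'.prod = (w.map (Gen.toBS q)).prod := by
      intro s w s' h
      induction h with
      | nil s =>
        intro hs v p hs'
        obtain ⟨rfl, rfl⟩ := Prod.mk.inj (hφ (hs.symm.trans hs'))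
        exact ⟨[], .nil _, by simp⟩
      | @cons s s₁ s' y w he _ ih =>
        intro hs' v p hs
        obtain ⟨⟨p₁, g, p₂⟩, hg, he⟩ := List.mem_flatMap.1 he
        rcases List.mem_cons.1 he with he | he
        · simp only [Prod.mk.injEq] at he
          obtain ⟨e1, rfl, rfl⟩ := he
          obtain ⟨rfl, rfl⟩ := Prod.mk.inj (hφ (hs.symm.trans e1))
          obtain ⟨w', h1, h2⟩ := ih hs' _ _ rfl
          refine ⟨g :: w', .cons ((hl _).1 hg) h1, ?_⟩
          simp only [List.map_nil, List.prod_nil, one_mul, List.map_cons, List.prod_cons, ← h2,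
            ← mul_assoc, hxu]
        · obtain ⟨z, v', he⟩ := mem_wordPath he
          simp only [Prod.mk.injEq] at he
          obtain ⟨e1, rfl, rfl⟩ := he
          obtain ⟨rfl, rfl⟩ := Prod.mk.inj (hφ (hs.symm.trans e1))
          obtain ⟨w', h1, h2⟩ := ih hs' _ _ rfl
          exact ⟨w', h1, by simp [← h2, mul_assoc]⟩
    obtain ⟨w', h1, h2⟩ := key _ _ _ hw rfl [] q₀ rfl
    exact ⟨w', h1, by simpa using h2⟩
  · rintro ⟨w, hw, rfl⟩
    induction hw with
    | nil p => exact ⟨[], .nil _, by simp⟩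
    | @cons p p' p'' g w he _ ih =>
      obtain ⟨w', h1, h2⟩ := ih
      have hsub : ∀ e ∈ (φ ([], p), x g, φ (u g, p')) :: wordPath φ p' (u g), e ∈ E' :=
        fun e h => List.mem_flatMap.2 ⟨(p, g, p'), (hl _).2 he, h⟩
      refine ⟨x g :: (u g ++ w'), .cons (hsub _ (by simp)) (IsRun.append (isRun_wordPath fun e h =>
        hsub e (by simp [h])) h1), ?_⟩
      simp [← h2, ← mul_assoc, hxu]

/-- The language of a nondeterministic automaton is regular. -/
theorem WordAutomaton.isRegular {Γ : Type} (B : WordAutomaton Γ) : B.language.IsRegular := by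
  classical
  -- A run only meets the initial state and targets of edges, so the other sources may be omitted.
  -- The final states are included so that they can be named as elements of `S`.
  let S : Finset ℕ := (B.2.1 :: (B.2.2 ++ B.1.map fun e => e.2.2)).toFinset
  let M : NFA Γ S :=
    { step := fun s x => {s' | ((s : ℕ), x, (s' : ℕ)) ∈ B.1}
      start := {s | (s : ℕ) = B.2.1}
      accept := {s | (s : ℕ) ∈ B.2.2} }
  have key : ∀ (w : List Γ) (T : Set S) (s' : S),
      s' ∈ M.evalFrom T w ↔ ∃ s ∈ T, IsRun {e | e ∈ B.1} (s : ℕ) w s' := by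
    intro w
    induction w with
    | nil =>
      intro T s'
      rw [NFA.evalFrom_nil]
      refine ⟨fun h => ⟨s', h, .nil _⟩, ?_⟩
      rintro ⟨s, hs, h⟩
      generalize hx : (s : ℕ) = a at h
      generalize hy : (s' : ℕ) = b at h
      cases h
      rwa [← Subtype.ext (hx.trans hy.symm)]
    | cons x w ih =>
      intro T s'
      rw [NFA.evalFrom_cons, ih]
      constructor
      · rintro ⟨s, hs, h⟩
        obtain ⟨s₀, hs₀, h₀⟩ := NFA.mem_stepSet.1 hs
        exact ⟨s₀, hs₀, .cons h₀ h⟩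
      · rintro ⟨s, hs, h⟩
        cases h with
        | @cons _ p _ _ _ he h =>
          refine ⟨⟨p, ?_⟩, NFA.mem_stepSet.2 ⟨s, hs, he⟩, h⟩
          simp only [S, List.mem_toFinset, List.mem_cons, List.mem_append, List.mem_map]
          exact .inr (.inr ⟨_, he, rfl⟩)
  refine ⟨_, inferInstance, M.toDFA, ?_⟩
  rw [NFA.toDFA_correct]
  ext w
  rw [NFA.mem_accepts]
  constructor
  · rintro ⟨s, hs, h⟩
    obtain ⟨s₀, hs₀, h⟩ := (key _ _ _).1 h
    have hs₀' : (s₀ : ℕ) = B.2.1 := hs₀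
    exact ⟨s, hs, hs₀' ▸ h⟩
  · rintro ⟨p, hp, h⟩
    refine ⟨⟨p, by simp [S, hp]⟩, hp, (key _ _ _).2 ⟨⟨B.2.1, by simp [S]⟩, rfl, h⟩⟩

/-- For `q ≥ 2`, every rational subset of `BS(1,q)` is PE-regular, and an automaton for the language
of pointed expansions can be computed from an automaton for the rational subset. -/
theorem mainTheorem2 (q : ℕ) [q.AtLeastTwo] :
    (∀ R : Set (BS q), IsRationalSubset R → IsPERegular R) ∧
    (∃ f : BSAutomaton → WordAutomaton (PELetter q), Computable f ∧
      ∀ A : BSAutomaton, (f A).language = peLanguage (A.accepted q)) := by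
  refine ⟨fun R hR => ?_, exists_computable_automaton q⟩
  obtain ⟨A, rfl⟩ := hR.exists_accepted_eq
  obtain ⟨f, -, hf⟩ := exists_computable_automaton q
  rw [IsPERegular, ← hf A]
  exact (f A).isRegular
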